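/- Let $0<|q|<1$, fix a square root $q^{1/2}$ of $q$, put $\Omega(q)=\{q^{-k}:k=0,1,2,\dots\}$, $(u;q)_n=\prod_{i=0}^{n-1}(1-uq^i)$, $(u_1,\dots,u_r;q)_n=\prod_i(u_i;q)_n$, and $x(z)=(z+z^{-1})/2$. Let $N,M$ be integers with $0\le M\le N-2$, and let $a,b,c,d$ be nonzero complex numbers with $$ab=q^{-N+1},\qquad a^2=q^{-M},\qquad abcd\notin\Omega(q),\qquad ac,ad,bc,bd,cd\notin\Omega(q)\setminus\{q^{-N+1}\}.$$ Let $p_n(x)=p_n(x;a,b,c,d|q)$, $n\ge0$, be the Askey–Wilson polynomials $$p_n(x)=\frac{1}{(2a)^n(abcdq^{n-1};q)_n}\sum_{k=0}^n\frac{(q^{-n},abcdq^{n-1};q)_k}{(q;q)_k}\,q^k\,(abq^k,acq^k,adq^k;q)_{n-k}\prod_{i=0}^{k-1}(1-2aq^ix+a^2q^{2i}).$$ **The functional $\mathscr L_0$.** Put $\mu_j(\alpha)=(\alpha q^j+\alpha^{-1}q^{-j})/2$ and $$A_j(\alpha)=\frac{(q^{-N+1},\alpha c,\alpha d,\alpha^2;q)_j}{(q,\alpha^2q^N,\alpha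 c^{-1}q,\alpha d^{-1}q;q)_j}\,\frac{1-\alpha^2q^{2j}}{(cdq^{-N})^j(1-\alpha^2)},$$ where for $M=0$ the factor $1-\alpha^2$ in the denominator, which does not depend on $j$, is omitted. For polynomials $p$ let $\mathscr L_0^\alpha(p)=\sum_{j=0}^{N-1}A_j(\alpha)p(\mu_j(\alpha))$ and $$\mathscr L_0(p)=\sum_{0\le j<M/2}\Big[(A_j'(a)+A_{M-j}'(a))\,p(\mu_j(a))+A_j(a)(q^j-q^{M-j})\,p'(\mu_j(a))\Big]+\sum_{j=M+1}^{N-1}A_j'(a)\,p(\mu_j(a))+\epsilon\,A_{M/2}'(a)\,p(\mu_{M/2}(a)),$$ where $\epsilon=1$ if $M$ is even, and the last term is absent if $M$ is odd. **The functional $\mathscr L_N$.** Let $\tilde a,\tilde b,\tilde c,\tilde d$ be $aq^{N/2},bq^{N/2},cq^{N/2},dq^{N/2}$. Call the points $uq^k$ convergent poles and the points $u^{-1}q^{-k}$ divergent poles ($u\in\{\tilde a,\tilde b,\tilde c,\tilde d\}$, $k\ge0$), and let $Z$ be the set of points that are both. Let $\Gamma_1,\Gamma_2$ be contours (finite unions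 of closed curves, avoiding $0$ and all these poles), each encircling once (winding number $1$) the convergent poles not in $Z$ and having winding number $0$ about the divergent poles not in $Z$, such that the points of $Z$ lie between them: they have winding number $0$ for $\Gamma_1$ and $1$ for $\Gamma_2$. Put $$\mathscr L_N(p)=\int_{\Gamma_1\cup\Gamma_2}p(x(z))\,\frac1z\,w(x(z))\,dz,\qquad w(x)=\frac{h(x,1)h(x,-1)h(x,q^{1/2})h(x,-q^{1/2})}{h(x,\tilde a)h(x,\tilde b)h(x,\tilde c)h(x,\tilde d)},\qquad h(x,\alpha)=\prod_{k=0}^\infty(1-2\alpha xq^k+\alpha^2q^{2k}).$$ Let $\mathscr D_q$ be the divided difference operator on polynomials given by $$(\mathscr D_qf)(x(z))=\frac{f(x(q^{1/2}z))-f(x(q^{-1/2}z))}{x(q^{1/2}z)-x(q^{-1/2}z)}.$$ Then: 1. $\mathscr L_0(p)=\lim_{\alpha\to a}\mathscr L_0^\alpha(p)/(\alpha-a)$ for every polynomial $p$. 2. Each $p_n$ is monic of degree $n$, and $(p_n)_{n\le N}$ is the unique family of monic polynomials with $\deg p_n=n$ satisfying $\mathscr L_0(p_np_m)=0$ for $0\le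 m<n\le N$. 3. The roots of $p_N$ are the points $\mu_j(a)$, $0\le j\le N-1$. Those with $M+1\le j\le N-1$, and $\mu_{M/2}(a)$ if $M$ is even, are simple; the remaining ones, $\mu_j(a)$ with $0\le j<M/2$, are double. 4. Such contours exist, and for every choice of them the form $\langle f,g\rangle=\mathscr L_0(fg)+\mathscr L_N(\mathscr D_q^Nf\cdot\mathscr D_q^Ng)$ satisfies $\langle p_n,p_m\rangle=0$ for $n\ne m$ and $\langle p_n,p_n\rangle\ne0$ for all $n\ge0$; and $(p_n)_{n\ge0}$ is the only sequence of monic polynomials, $\deg p_n=n$, that satisfies $\langle p_n,p_m\rangle=0$ for all $n\ne m$. -/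

import Mathlib

open Polynomial Filter Topology

noncomputable section

namespace AskeyWilson

/-- The finite `q`-Pochhammer symbol `(a;q)_n`. -/
def qPoch (a q : ℂ) (n : ℕ) : ℂ := ∏ i ∈ Finset.range n, (1 - a * q ^ i)

/-- The set `Ω(q) = {q^{-k} : k = 0, 1, 2, …}`. -/
def Omega (q : ℂ) : Set ℂ := {w | ∃ k : ℕ, w = q ^ (-(k : ℤ))}

/-- The monic Askey–Wilson polynomial
`(ab,ac,ad;q)_n / ((2a)^n (abcd q^{n-1};q)_n)`
`  * ₄φ₃(q^{-n}, abcd q^{n-1}, a e^{iθ}, a e^{-iθ}; ab, ac, ad; q, q)`, `x = cos θ`.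
The prefactor `(ab;q)_n` is divided by the denominator `(ab;q)_k` of the `k`-th term to give
`(ab q^k;q)_{n-k}`, and likewise for `ac` and `ad`, so that the formula makes sense
when `ab ∈ Ω(q)`; and `(a e^{iθ}, a e^{-iθ};q)_k = ∏_{i<k} (1 - 2 a q^i x + a² q^{2i})`. -/
def awPoly (q a b c d : ℂ) (n : ℕ) : ℂ[X] :=
  C (1 / ((2 * a) ^ n * qPoch (a * b * c * d * q ^ ((n : ℤ) - 1)) q n)) *
    ∑ k ∈ Finset.range (n + 1),
      C (qPoch (q ^ (-(n : ℤ))) q k * qPoch (a * b * c * d * q ^ ((n : ℤ) - 1)) q k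
          / qPoch q q k * q ^ k
          * (qPoch (a * b * q ^ k) q (n - k) * qPoch (a * c * q ^ k) q (n - k)
              * qPoch (a * d * q ^ k) q (n - k))) *
        ∏ i ∈ Finset.range k, (1 - C (2 * a * q ^ i) * X + C (a ^ 2 * q ^ (2 * i)))

/-! ### The functional `L₀` -/

/-- The nodes `μ_j(α) = (α q^j + α⁻¹ q^{-j}) / 2`. -/
def node (q : ℂ) (j : ℕ) (α : ℂ) : ℂ := (α * q ^ j + (α * q ^ j)⁻¹) / 2

/-- The weights `A_j(α)` (with `α b = q^{-N+1}`).
For `M = 0` the factor `1/(1-α²)`, which does not depend on `j`, is left out: at `α² = 1` it would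
cancel the common zero of the weights. -/
def weight (q c d : ℂ) (N M j : ℕ) (α : ℂ) : ℂ :=
  (qPoch (q ^ (1 - (N : ℤ))) q j * qPoch (α * c) q j * qPoch (α * d) q j * qPoch (α ^ 2) q j)
    / (qPoch q q j * qPoch (α ^ 2 * q ^ N) q j * qPoch (α * c⁻¹ * q) q j
        * qPoch (α * d⁻¹ * q) q j)
    * ((1 - α ^ 2 * q ^ (2 * j))
      / ((c * d * q ^ (-(N : ℤ))) ^ j * (if M = 0 then 1 else 1 - α ^ 2)))

/-- The functional `L₀^α(p) = ∑_{j<N} A_j(α) p(μ_j(α))`. -/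
def racahFunctional (q c d : ℂ) (N M : ℕ) (α : ℂ) (p : ℂ[X]) : ℂ :=
  ∑ j ∈ Finset.range N, weight q c d N M j α * p.eval (node q j α)

/-- The functional `L₀` for `a² = q^{-M}`, involving `p` and `p'`. The first sum is over
`0 ≤ j < M/2`, and the last summand, with `j = M/2`, is present only for even `M`. -/
def limitFunctional (q a c d : ℂ) (N M : ℕ) (p : ℂ[X]) : ℂ :=
  ∑ j ∈ Finset.range ((M + 1) / 2),
      ((deriv (weight q c d N M j) a + deriv (weight q c d N M (M - j)) a)
          * p.eval (node q j a)
        + weight q c d N M j a * (q ^ j - q ^ (M - j)) * p.derivative.eval (node q j a))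
    + ∑ j ∈ Finset.Ico (M + 1) N, deriv (weight q c d N M j) a * p.eval (node q j a)
    + (if Even M then deriv (weight q c d N M (M / 2)) a * p.eval (node q (M / 2) a) else 0)

/-! ### The Askey–Wilson divided difference operator -/

/-- `x(z) = (z + z⁻¹) / 2`. -/
def xOf (z : ℂ) : ℂ := (z + z⁻¹) / 2

/-- The pair `(𝒜 xⁿ, 𝒟 xⁿ)`, where, for `s = q^{1/2}` and `x = x(z)`,
`(𝒜 f)(x) = (f(x(sz)) + f(x(z/s))) / 2` and
`(𝒟 f)(x) = (f(x(sz)) - f(x(z/s))) / (x(sz) - x(z/s))`; see `eval_awDiff`. -/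
def awPair (s : ℂ) : ℕ → ℂ[X] × ℂ[X]
  | 0 => (1, 0)
  | n + 1 =>
    (C (xOf s) * X * (awPair s n).1 + C (xOf s ^ 2 - 1) * (X ^ 2 - 1) * (awPair s n).2,
      C (xOf s) * X * (awPair s n).2 + (awPair s n).1)

/-- The divided difference operator `𝒟_q = Δ/Δx(s)` on the lattice `x = (z + z⁻¹)/2`, with
`s = q^{1/2}`: the polynomial `𝒟_q f` satisfies
`(𝒟_q f)(x(z)) = (f(x(sz)) - f(x(z/s))) / (x(sz) - x(z/s))`, as proved in `eval_awDiff`. -/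
def awDiff (s : ℂ) (f : ℂ[X]) : ℂ[X] := f.sum fun n t => C t * (awPair s n).2

theorem awPair_spec {s z : ℂ} (hs : s ≠ 0) (hz : z ≠ 0) (n : ℕ) :
    xOf (s * z) ^ n = (awPair s n).1.eval (xOf z)
        + (s - s⁻¹) / 2 * ((z - z⁻¹) / 2) * (awPair s n).2.eval (xOf z) ∧
      xOf (z / s) ^ n = (awPair s n).1.eval (xOf z)
        - (s - s⁻¹) / 2 * ((z - z⁻¹) / 2) * (awPair s n).2.eval (xOf z) := by
  induction n with
  | zero => simp [awPair]
  | succ n ih =>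
    obtain ⟨h1, h2⟩ := ih
    have e1 : xOf (s * z) = xOf s * xOf z + (s - s⁻¹) / 2 * ((z - z⁻¹) / 2) := by
      unfold xOf; field_simp; ring
    have e2 : xOf (z / s) = xOf s * xOf z - (s - s⁻¹) / 2 * ((z - z⁻¹) / 2) := by
      unfold xOf; field_simp; ring
    have e3 : xOf s ^ 2 - 1 = ((s - s⁻¹) / 2) ^ 2 := by
      unfold xOf; field_simp; ring
    have e4 : xOf z ^ 2 - 1 = ((z - z⁻¹) / 2) ^ 2 := by
      unfold xOf; field_simp; ring
    rw [pow_succ, pow_succ, h1, h2, e1, e2]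
    simp only [awPair, eval_add, eval_mul, eval_C, eval_X, eval_sub, eval_pow, eval_one, e3, e4]
    constructor <;> ring

theorem eval_awDiff {s z : ℂ} (hs : s ≠ 0) (hz : z ≠ 0) (f : ℂ[X]) :
    (xOf (s * z) - xOf (z / s)) * (awDiff s f).eval (xOf z)
      = f.eval (xOf (s * z)) - f.eval (xOf (z / s)) := by
  have e : xOf (s * z) - xOf (z / s) = 2 * ((s - s⁻¹) / 2 * ((z - z⁻¹) / 2)) := by
    unfold xOf; field_simp; ring
  rw [eval_eq_sum (x := xOf (s * z)), eval_eq_sum (x := xOf (z / s)), awDiff, Polynomial.sum,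
    Polynomial.sum, Polynomial.sum, eval_finsetSum, Finset.mul_sum, ← Finset.sum_sub_distrib]
  refine Finset.sum_congr rfl fun n _ => ?_
  obtain ⟨h1, h2⟩ := awPair_spec hs hz n
  rw [h1, h2, e, eval_mul, eval_C]
  ring

/-! ### Contours and the functional `L_N` -/

/-- `∫_Γ f(z) dz` for a contour `Γ` made of finitely many closed curves `[0,1] → ℂ`. -/
def contourIntegral (Γ : List (ℝ → ℂ)) (f : ℂ → ℂ) : ℂ :=
  (Γ.map fun γ => ∫ t in (0 : ℝ)..1, f (γ t) * deriv γ t).sum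

/-- The number of times that `Γ` encircles `w`. -/
def windingNumber (Γ : List (ℝ → ℂ)) (w : ℂ) : ℂ :=
  (2 * Real.pi * Complex.I)⁻¹ * contourIntegral Γ fun z => (z - w)⁻¹

/-- `Γ` consists of closed `C¹` curves that avoid the set `S`.
(The derivative of a curve may vanish, so corners are allowed.) -/
def IsContourAvoiding (Γ : List (ℝ → ℂ)) (S : Set ℂ) : Prop :=
  ∀ γ ∈ Γ, ContDiffOn ℝ 1 γ (Set.Icc 0 1) ∧ γ 0 = γ 1 ∧ ∀ t ∈ Set.Icc (0 : ℝ) 1, γ t ∉ S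

/-- `h(x,α) = ∏_{k ≥ 0} (1 - 2 α x q^k + α² q^{2k})`. -/
def hProd (q x α : ℂ) : ℂ := ∏' k : ℕ, (1 - 2 * α * x * q ^ k + α ^ 2 * q ^ (2 * k))

/-- The Askey–Wilson weight `w(x; a, b, c, d; q)`, with `s = q^{1/2}`. -/
def awWeight (q s a b c d x : ℂ) : ℂ :=
  hProd q x 1 * hProd q x (-1) * hProd q x s * hProd q x (-s)
    / (hProd q x a * hProd q x b * hProd q x c * hProd q x d)

/-- The convergent poles `α q^k`, `α ∈ {a, b, c, d}`, `k ≥ 0`. -/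
def convPoles (q a b c d : ℂ) : Set ℂ :=
  {z | ∃ α ∈ ({a, b, c, d} : Set ℂ), ∃ k : ℕ, z = α * q ^ k}

/-- The divergent poles `α⁻¹ q^{-k}`, `α ∈ {a, b, c, d}`, `k ≥ 0`. -/
def divPoles (q a b c d : ℂ) : Set ℂ :=
  {z | ∃ α ∈ ({a, b, c, d} : Set ℂ), ∃ k : ℕ, z = (α * q ^ k)⁻¹}

/-- The contours `Γ₁` and `Γ₂` separate the convergent from the divergent poles, encircling the
former once, except for the set `Z` of poles that are both convergent and divergent: these lie
between the two contours, outside `Γ₁` and inside `Γ₂`. -/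
structure Separates (q a b c d : ℂ) (Γ₁ Γ₂ : List (ℝ → ℂ)) : Prop where
  avoid₁ : IsContourAvoiding Γ₁ ({0} ∪ convPoles q a b c d ∪ divPoles q a b c d)
  avoid₂ : IsContourAvoiding Γ₂ ({0} ∪ convPoles q a b c d ∪ divPoles q a b c d)
  conv₁ : ∀ w ∈ convPoles q a b c d \ divPoles q a b c d, windingNumber Γ₁ w = 1
  div₁ : ∀ w ∈ divPoles q a b c d, windingNumber Γ₁ w = 0
  conv₂ : ∀ w ∈ convPoles q a b c d, windingNumber Γ₂ w = 1
  div₂ : ∀ w ∈ divPoles q a b c d \ convPoles q a b c d, windingNumber Γ₂ w = 0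

/-- The functional
`p ↦ ∫_{Γ₁ ∪ Γ₂} p((z+z⁻¹)/2) z⁻¹ w((z+z⁻¹)/2; a, b, c, d; q) dz`. -/
def contourFunctional (q s a b c d : ℂ) (Γ₁ Γ₂ : List (ℝ → ℂ)) (p : ℂ[X]) : ℂ :=
  contourIntegral (Γ₁ ++ Γ₂) fun z => p.eval (xOf z) * (z⁻¹ * awWeight q s a b c d (xOf z))

/-! ### Orthogonality -/

/-- The Sobolev form `⟨f, g⟩ = L₀(f g) + L_N(𝒟_q^N f · 𝒟_q^N g)`, where `L_N` is the contour
functional with parameters `a q^{N/2}`, `b q^{N/2}`, `c q^{N/2}`, `d q^{N/2}`. -/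
def sobolevForm (q s a b c d : ℂ) (N M : ℕ) (Γ₁ Γ₂ : List (ℝ → ℂ)) (f g : ℂ[X]) : ℂ :=
  limitFunctional q a c d N M (f * g)
    + contourFunctional q s (a * s ^ N) (b * s ^ N) (c * s ^ N) (d * s ^ N) Γ₁ Γ₂
        ((awDiff s)^[N] f * (awDiff s)^[N] g)

/-- The sequence is monic with `deg (P n) = n` for all `n ∈ S`. -/
def IsMonicSeqOn (P : ℕ → ℂ[X]) (S : Set ℕ) : Prop :=
  ∀ n ∈ S, (P n).Monic ∧ (P n).natDegree = n

end AskeyWilson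

end

open Polynomial Filter Topology

noncomputable section

namespace AskeyWilson

/-! ### `q`-Pochhammer symbols -/

/-! Everything rests on one property of a linear functional L, `IsAWFunctional`: it kills
(az,a/z;q)_k (bz,b/z;q)_m times a linear polynomial, for all k and m. This is the Pearson equation
of the Askey–Wilson weight. As abcd ∉ Ω(q), it determines all mixed moments from L(1)
(`IsAWFunctional.moment`, `IsAWFunctional.moment_awBasis`). With p_n expanded in the a-basis and
tested against the m-th element of the b-basis, there remains a sum of R(q^k) with the coefficients
(q^{-n};q)_k q^k/(q;q)_k. For m < n, R is a polynomial of degree n-1, and such sums vanish: this is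
orthogonality. For m = n ≥ 1, R has one simple pole and partial fractions evaluate the sum: the norm
is L(1) times explicit factors, among them (ab;q)_n.

Both functionals satisfy this equation. For L₀^α the sum telescopes (`racah_pearson`). At α = a the
nodes j and M-j coincide and carry opposite weights, while the other weights vanish; hence L₀^a = 0,
L₀ is the derivative of L₀^α at α = a, and the equation survives the limit. For L_N the integrand
has the form K(z) - q K(qz), so its integral compares Γ with qΓ. By the homology form of Cauchy's
theorem it vanishes, because K has only removable singularities wherever the winding numbers of Γ
and qΓ differ (`isRemovableAt_shiftKernel`). In both cases L(1) ≠ 0 follows by contradiction: L(1) =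
0 would force L = 0, which suitable test polynomials refute.

Since ab = q^{1-N}, every p_n with n ≥ N is divisible by (az,a/z;q)_N, which is p_N up to a
constant. L₀ kills the multiples of p_N, so it gives nonzero norms exactly for n < N. On the other
hand 𝒟_q^N kills p_n for n < N and sends p_{n+N} to a nonzero multiple of the n-th polynomial with
parameters multiplied by q^{N/2}. For these the product of the first two parameters is q ∉ Ω(q), so
L_N supplies all the missing norms. The multiplicities of the roots of p_N are read off from its
factorisation, where μ_i(a) = μ_j(a) exactly if i = j or i + j = M. -/

theorem qPoch_zero (a q : ℂ) : qPoch a q 0 = 1 := by simp [qPoch]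

theorem qPoch_succ (a q : ℂ) (n : ℕ) : qPoch a q (n + 1) = qPoch a q n * (1 - a * q ^ n) := by
  simp [qPoch, Finset.prod_range_succ]

theorem qPoch_succ_left (a q : ℂ) (n : ℕ) :
    qPoch a q (n + 1) = (1 - a) * qPoch (a * q) q n := by
  simp only [qPoch, Finset.prod_range_succ', pow_zero, mul_one]
  rw [mul_comm]
  congr 1
  exact Finset.prod_congr rfl fun i _ => by ring

theorem qPoch_add (a q : ℂ) (m n : ℕ) :
    qPoch a q (m + n) = qPoch a q m * qPoch (a * q ^ m) q n := by
  simp only [qPoch, Finset.prod_range_add]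
  congr 1
  exact Finset.prod_congr rfl fun i _ => by ring

theorem qPoch_ne_zero {a q : ℂ} {n : ℕ} (h : ∀ i < n, a * q ^ i ≠ 1) : qPoch a q n ≠ 0 :=
  Finset.prod_ne_zero_iff.2 fun i hi => sub_ne_zero.2 (h i (Finset.mem_range.1 hi)).symm

theorem qPoch_eq_zero {a q : ℂ} {n i : ℕ} (hi : i < n) (h : a * q ^ i = 1) : qPoch a q n = 0 :=
  Finset.prod_eq_zero (Finset.mem_range.2 hi) (by rw [h, sub_self])

/-- Formally both sides are (u;q)_{m+k} (u;q)_n / ((u;q)_m (u;q)_k), symmetric in k and m. Products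
are split rather than divided, because these denominators may vanish for u = ab = q^{1-N}. -/
theorem qPoch_mul_qPoch_comm (u q : ℂ) {k m n : ℕ} (hk : k ≤ n) (hm : m ≤ n) :
    qPoch (u * q ^ m) q k * qPoch (u * q ^ k) q (n - k)
      = qPoch (u * q ^ k) q m * qPoch (u * q ^ m) q (n - m) := by
  rcases le_total (m + k) n with h | h
  · obtain ⟨r, rfl⟩ := Nat.exists_eq_add_of_le h
    rw [show m + k + r - k = m + r by omega, show m + k + r - m = k + r by omega,
      qPoch_add, qPoch_add, mul_assoc, mul_assoc, ← pow_add, ← pow_add, add_comm k m]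
    ring
  · obtain ⟨r, hr⟩ := Nat.exists_eq_add_of_le h
    obtain ⟨i, rfl⟩ := Nat.exists_eq_add_of_le hk
    obtain rfl : m = i + r := by omega
    rw [show k + i - (i + r) = k - r by omega, show k + i - k = i by omega]
    obtain ⟨j, rfl⟩ := Nat.exists_eq_add_of_le (show r ≤ k by omega)
    rw [show r + j - r = j by omega, add_comm r j, qPoch_add _ _ j r, qPoch_add _ _ i r,
      mul_assoc u, mul_assoc u, ← pow_add, ← pow_add,
      show i + r + j = j + r + i by omega]
    ring

theorem mem_Omega_of_mul_pow {u q : ℂ} {i : ℕ} (h : u * q ^ i = 1) : u ∈ Omega q :=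
  ⟨i, by rw [zpow_neg, zpow_natCast]; exact eq_inv_of_mul_eq_one_left h⟩

theorem qPoch_ne_zero_of_notMem {u q : ℂ} (hu : u ∉ Omega q) (m n : ℕ) :
    qPoch (u * q ^ m) q n ≠ 0 :=
  qPoch_ne_zero fun i _ h => hu (mem_Omega_of_mul_pow (i := m + i) (by
    rw [pow_add, ← mul_assoc, h]))

theorem qPoch_ne_zero_of_notMem' {u q : ℂ} (hu : u ∉ Omega q) (n : ℕ) :
    qPoch u q n ≠ 0 := by simpa using qPoch_ne_zero_of_notMem hu 0 n

theorem zpow_eq_one_iff_of_norm_lt {q : ℂ} (hq1 : ‖q‖ < 1) {k : ℤ} :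
    q ^ k = 1 ↔ k = 0 := by
  refine ⟨fun h => ?_, fun h => by simp [h]⟩
  have h1 : ‖q‖ ^ k = 1 := by rw [← norm_zpow, h, norm_one]
  exact (zpow_eq_one_iff_right₀ (norm_nonneg q) hq1.ne).1 h1

theorem zpow_inj_of_norm_lt {q : ℂ} (hq0 : q ≠ 0) (hq1 : ‖q‖ < 1) {k l : ℤ} :
    q ^ k = q ^ l ↔ k = l := by
  rw [← sub_eq_zero (a := k), ← zpow_eq_one_iff_of_norm_lt hq1, zpow_sub₀ hq0,
    div_eq_one_iff_eq (zpow_ne_zero _ hq0)]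

theorem pow_ne_one_of_norm_lt {q : ℂ} (hq1 : ‖q‖ < 1) {k : ℕ} (hk : k ≠ 0) :
    q ^ k ≠ 1 := fun h => hk <| by
  have := (zpow_eq_one_iff_of_norm_lt hq1 (k := k)).1 (by simpa using h)
  exact_mod_cast this

theorem qPoch_self_ne_zero {q : ℂ} (hq1 : ‖q‖ < 1) (n : ℕ) : qPoch q q n ≠ 0 :=
  qPoch_ne_zero fun i _ h => pow_ne_one_of_norm_lt hq1 (Nat.succ_ne_zero i) (by
    rw [pow_succ', h])

/-! ### The alternating `q`-binomial sum -/

/-- The coefficient `(q^{-n};q)_j q^j / (q;q)_j`. -/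
def qBinomCoeff (q : ℂ) (n j : ℕ) : ℂ := qPoch (q ^ (-(n : ℤ))) q j / qPoch q q j * q ^ j

theorem qBinomCoeff_self_succ {q : ℂ} (hq : q ≠ 0) (n : ℕ) : qBinomCoeff q n (n + 1) = 0 := by
  rw [qBinomCoeff, qPoch_eq_zero (Nat.lt_succ_self n)]
  · simp
  · rw [zpow_neg, zpow_natCast, inv_mul_cancel₀ (pow_ne_zero _ hq)]

/-- The q-Pascal rule. -/
theorem qBinomCoeff_succ_succ {q : ℂ} (hq0 : q ≠ 0) (hq1 : ‖q‖ < 1) (n j : ℕ) :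
    qBinomCoeff q (n + 1) (j + 1)
      = qBinomCoeff q n (j + 1) - (q ^ n)⁻¹ * qBinomCoeff q n j := by
  have e : q ^ (-((n + 1 : ℕ) : ℤ)) * q = q ^ (-(n : ℤ)) := by
    rw [← zpow_add_one₀ hq0]; congr 1; push_cast; ring
  have h1 := qPoch_self_ne_zero hq1 j
  have h2 : (1 - q * q ^ j) ≠ 0 := by
    rw [← pow_succ']; exact sub_ne_zero.2 (pow_ne_one_of_norm_lt hq1 (Nat.succ_ne_zero j)).symm
  unfold qBinomCoeff
  rw [qPoch_succ_left (q ^ (-((n + 1 : ℕ) : ℤ))), e, qPoch_succ (q ^ (-(n : ℤ))), qPoch_succ q]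
  have e2 : q ^ (-((n + 1 : ℕ) : ℤ)) = (q ^ n)⁻¹ * q⁻¹ := by
    rw [zpow_neg, zpow_natCast, pow_succ, mul_inv]
  rw [e2, zpow_neg, zpow_natCast]
  have h3 := pow_ne_zero n hq0
  have h4 := pow_ne_zero j hq0
  rw [pow_succ]
  generalize q ^ n = u at *
  generalize qPoch u⁻¹ q j = P
  generalize q ^ j = v at *
  generalize qPoch q q j = w at *
  have h5 : P / w = (1 - q * v) * (P / (w * (1 - q * v))) := by
    rw [mul_div_assoc', mul_comm (1 - q * v), mul_div_mul_right _ _ h2]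
  rw [mul_div_assoc, mul_div_right_comm P, h5]
  linear_combination (-u⁻¹ * (P / (w * (1 - q * v))) * v) * mul_inv_cancel₀ hq0

/-- By the q-Pascal rule the sum of order n+1 is a q-difference of two sums of order n. The offset k
is kept so that inductions on n close. -/
theorem sum_qBinomCoeff_succ {q : ℂ} (hq0 : q ≠ 0) (hq1 : ‖q‖ < 1) (n k : ℕ) (f : ℕ → ℂ) :
    ∑ j ∈ Finset.range (n + 2), qBinomCoeff q (n + 1) j * f (k + j)
      = ∑ j ∈ Finset.range (n + 1), qBinomCoeff q n j * f (k + j)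
        - (q ^ n)⁻¹ * ∑ j ∈ Finset.range (n + 1), qBinomCoeff q n j * f (k + 1 + j) := by
  rw [Finset.sum_range_succ']
  have h0 : ∀ n, qBinomCoeff q n 0 = 1 := fun n => by simp [qBinomCoeff, qPoch_zero]
  have h : ∑ j ∈ Finset.range (n + 1), qBinomCoeff q n j * f (k + j)
      = ∑ j ∈ Finset.range (n + 1), qBinomCoeff q n (j + 1) * f (k + (j + 1))
        + qBinomCoeff q n 0 * f (k + 0) := by
    rw [← Finset.sum_range_succ' (fun j => qBinomCoeff q n j * f (k + j)),
      Finset.sum_range_succ _ (n + 1), qBinomCoeff_self_succ hq0]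
    simp
  rw [h, Finset.mul_sum, h0, h0]
  simp only [qBinomCoeff_succ_succ hq0 hq1, sub_mul, Finset.sum_sub_distrib]
  have : ∀ j, f (k + (j + 1)) = f (k + 1 + j) := fun j => by congr 1; ring
  simp only [this, mul_assoc]
  ring

theorem sum_qBinomCoeff_pow {q : ℂ} (hq0 : q ≠ 0) (hq1 : ‖q‖ < 1) (n k i : ℕ) :
    ∑ j ∈ Finset.range (n + 1), qBinomCoeff q n j * (q ^ (k + j)) ^ i
      = (q ^ k) ^ i * ∏ l ∈ Finset.range n, (1 - q ^ i * (q ^ l)⁻¹) := by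
  induction n generalizing k with
  | zero => simp [qBinomCoeff, qPoch_zero]
  | succ n ih =>
    rw [sum_qBinomCoeff_succ hq0 hq1 n k (fun m => (q ^ m) ^ i), ih, ih, Finset.prod_range_succ]
    ring

/-- The sum acts as an n-th order q-difference: for i < n the product in `sum_qBinomCoeff_pow`
contains 1 - q^i q^{-i}, so each monomial of degree below n is killed. -/
theorem sum_qBinomCoeff_eval {q : ℂ} (hq0 : q ≠ 0) (hq1 : ‖q‖ < 1) {n : ℕ} (P : ℂ[X])
    (hP : P.natDegree < n) :
    ∑ j ∈ Finset.range (n + 1), qBinomCoeff q n j * P.eval (q ^ j) = 0 := by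
  simp only [eval_eq_sum_range, Finset.mul_sum]
  rw [Finset.sum_comm]
  refine Finset.sum_eq_zero fun i hi => ?_
  have h := sum_qBinomCoeff_pow hq0 hq1 n 0 i
  rw [Finset.prod_eq_zero (i := i)] at h
  · simp only [zero_add, mul_zero] at h
    rw [← mul_zero (P.coeff i), ← h, Finset.mul_sum]
    exact Finset.sum_congr rfl fun j _ => by ring
  · have := Finset.mem_range.1 hi
    exact Finset.mem_range.2 (by omega)
  · rw [mul_inv_cancel₀ (pow_ne_zero _ hq0), sub_self]

/-- Read from right to left, a partial fraction expansion of a multiple of 1/(yq^k;q)_{n+1}. -/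
theorem sum_qBinomCoeff_inv {q : ℂ} (hq0 : q ≠ 0) (hq1 : ‖q‖ < 1) (y : ℂ) (n k : ℕ)
    (hy : ∀ i, y * q ^ i ≠ 1) :
    ∑ j ∈ Finset.range (n + 1), qBinomCoeff q n j * (1 - y * q ^ (k + j))⁻¹
      = (y * q ^ k) ^ n * qPoch q q n / qPoch (y * q ^ k) q (n + 1) := by
  induction n generalizing k with
  | zero => simp [qBinomCoeff, qPoch_zero, qPoch_succ]
  | succ n ih =>
    rw [sum_qBinomCoeff_succ hq0 hq1 n k (fun m => (1 - y * q ^ m)⁻¹), ih, ih,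
      qPoch_succ (y * q ^ k) q (n + 1), qPoch_succ q q n, qPoch_succ (y * q ^ (k + 1)) q n,
      qPoch_succ_left (y * q ^ k) q n]
    have e : y * q ^ k * q = y * q ^ (k + 1) := by ring
    have h1 : (1 - y * q ^ k) ≠ 0 := sub_ne_zero.2 (hy k).symm
    have h2 : (1 - y * q ^ k * q ^ (n + 1)) ≠ 0 := by
      rw [mul_assoc, ← pow_add]; exact sub_ne_zero.2 (hy _).symm
    have h4 : (1 - y * q ^ (k + 1) * q ^ n) = (1 - y * q ^ k * q ^ (n + 1)) := by ring
    have h3 : qPoch (y * q ^ (k + 1)) q n ≠ 0 := qPoch_ne_zero fun i _ h => hy (k + 1 + i) (by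
      rw [← h]; ring)
    rw [e, h4]
    have := pow_ne_zero n hq0
    field_simp
    ring

/-- Modulo 1 - yX the polynomial (uX;q)_n reduces to its value (u/y;q)_n at X = 1/y. The quotient
has degree below n and is annihilated, and the remainder is summed by `sum_qBinomCoeff_inv`. -/
theorem sum_qBinomCoeff_qPoch_div {q : ℂ} (hq0 : q ≠ 0) (hq1 : ‖q‖ < 1) {y : ℂ} (u : ℂ)
    (hy0 : y ≠ 0) (hy : ∀ i, y * q ^ i ≠ 1) (n : ℕ) :
    ∑ j ∈ Finset.range (n + 1),
        qBinomCoeff q n j * (qPoch (u * q ^ j) q n * (1 - y * q ^ j)⁻¹)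
      = qPoch (u * y⁻¹) q n * (y ^ n * qPoch q q n / qPoch y q (n + 1)) := by
  -- The factors of (uX;q)_n are reduced one at a time, so the length m of the symbol is separated
  -- from the order n of the sum.
  suffices h : ∀ m ≤ n, ∑ j ∈ Finset.range (n + 1),
        qBinomCoeff q n j * (qPoch (u * q ^ j) q m * (1 - y * q ^ j)⁻¹)
      = qPoch (u * y⁻¹) q m * (y ^ n * qPoch q q n / qPoch y q (n + 1)) from h n le_rfl
  intro m
  induction m with
  | zero =>
    intro _
    have := sum_qBinomCoeff_inv hq0 hq1 y n 0 hy
    simpa [qPoch_zero] using this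
  | succ m ih =>
    intro hm
    have h1 : ∀ j, qPoch (u * q ^ j) q (m + 1) * (1 - y * q ^ j)⁻¹
        = u * q ^ m * y⁻¹ * qPoch (u * q ^ j) q m
          + (1 - u * y⁻¹ * q ^ m) * (qPoch (u * q ^ j) q m * (1 - y * q ^ j)⁻¹) := by
      intro j
      have h2 : (1 - y * q ^ j) ≠ 0 := sub_ne_zero.2 (hy j).symm
      rw [qPoch_succ]
      have h3 := mul_inv_cancel₀ h2
      have h4 := mul_inv_cancel₀ hy0
      generalize (1 - y * q ^ j)⁻¹ = t at *
      linear_combination (qPoch (u * q ^ j) q m * u * q ^ m * y⁻¹) * h3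
        + qPoch (u * q ^ j) q m * u * q ^ m * q ^ j * t * h4
    have h3 : ∑ j ∈ Finset.range (n + 1), qBinomCoeff q n j * qPoch (u * q ^ j) q m = 0 := by
      have hd : (∏ i ∈ Finset.range m, (1 - C (u * q ^ i) * X : ℂ[X])).natDegree < n := by
        refine lt_of_le_of_lt (natDegree_prod_le _ _) (lt_of_le_of_lt
          (Finset.sum_le_card_nsmul _ _ 1 fun i _ => ?_) (by simpa using hm))
        compute_degree
      rw [← sum_qBinomCoeff_eval hq0 hq1 _ hd]
      refine Finset.sum_congr rfl fun j _ => ?_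
      rw [eval_prod, qPoch]
      congr 1
      refine Finset.prod_congr rfl fun i _ => ?_
      simp
      ring
    simp only [h1, mul_add, Finset.sum_add_distrib]
    have h4 := ih (by omega)
    calc _ = u * q ^ m * y⁻¹ * ∑ j ∈ Finset.range (n + 1),
            qBinomCoeff q n j * qPoch (u * q ^ j) q m
          + (1 - u * y⁻¹ * q ^ m) * ∑ j ∈ Finset.range (n + 1),
            qBinomCoeff q n j * (qPoch (u * q ^ j) q m * (1 - y * q ^ j)⁻¹) := by
          rw [Finset.mul_sum, Finset.mul_sum]
          congr 1 <;> exact Finset.sum_congr rfl fun j _ => by ring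
      _ = _ := by rw [h3, h4, qPoch_succ (u * y⁻¹) q m]; ring

/-! ### The basis `(az, a/z; q)_k` and monic sequences -/

/-- The polynomial `(az, a/z; q)_k` of `x = (z + z⁻¹)/2`. -/
def awBasis (q a : ℂ) (k : ℕ) : ℂ[X] :=
  ∏ i ∈ Finset.range k, (1 - C (2 * a * q ^ i) * X + C (a ^ 2 * q ^ (2 * i)))

theorem awBasis_zero (q a : ℂ) : awBasis q a 0 = 1 := by simp [awBasis]

theorem awBasis_succ (q a : ℂ) (k : ℕ) : awBasis q a (k + 1)
    = awBasis q a k * (1 - C (2 * a * q ^ k) * X + C (a ^ 2 * q ^ (2 * k))) := by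
  simp [awBasis, Finset.prod_range_succ]

theorem eval_awBasis (q a : ℂ) (k : ℕ) {z : ℂ} (hz : z ≠ 0) :
    (awBasis q a k).eval (xOf z) = qPoch (a * z) q k * qPoch (a / z) q k := by
  rw [awBasis, eval_prod, qPoch, qPoch, ← Finset.prod_mul_distrib]
  refine Finset.prod_congr rfl fun i _ => ?_
  simp only [eval_add, eval_sub, eval_one, eval_mul, eval_C, eval_X, xOf]
  field_simp
  ring

theorem natDegree_awBasis_le (q a : ℂ) (k : ℕ) : (awBasis q a k).natDegree ≤ k := by
  refine (natDegree_prod_le _ _).trans ((Finset.sum_le_card_nsmul _ _ 1 fun i _ => ?_).trans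
    (by simp))
  compute_degree

theorem coeff_awBasis_self (q a : ℂ) (k : ℕ) :
    (awBasis q a k).coeff k = ∏ i ∈ Finset.range k, (-(2 * a * q ^ i)) := by
  induction k with
  | zero => simp [awBasis_zero]
  | succ k ih =>
    have h1 : (1 - C (2 * a * q ^ k) * X + C (a ^ 2 * q ^ (2 * k)) : ℂ[X]).natDegree ≤ 1 := by
      compute_degree
    rw [awBasis_succ, coeff_mul_add_eq_of_natDegree_le (natDegree_awBasis_le q a k) h1, ih,
      Finset.prod_range_succ]
    congr 1
    rw [coeff_add, coeff_sub, coeff_C_mul, coeff_X_one, coeff_one, coeff_C]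
    simp

theorem coeff_awBasis_self_ne_zero {q a : ℂ} (hq : q ≠ 0) (ha : a ≠ 0) (k : ℕ) :
    (awBasis q a k).coeff k ≠ 0 := by
  rw [coeff_awBasis_self]
  exact Finset.prod_ne_zero_iff.2 fun i _ => neg_ne_zero.2
    (mul_ne_zero (mul_ne_zero two_ne_zero ha) (pow_ne_zero _ hq))

/-- A subspace that contains a polynomial of each degree `m < n` contains all polynomials of
degree less than `n`. -/
theorem mem_of_forall_coeff_ne_zero {n : ℕ} (S : Submodule ℂ ℂ[X]) (e : ℕ → ℂ[X])
    (he : ∀ m < n, (e m).natDegree ≤ m) (he' : ∀ m < n, (e m).coeff m ≠ 0)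
    (hS : ∀ m < n, e m ∈ S) {f : ℂ[X]} (hf : f.degree < n) : f ∈ S := by
  induction n generalizing f with
  | zero =>
    have : f = 0 := by rw [← degree_eq_bot]; simpa using hf
    rw [this]; exact S.zero_mem
  | succ n ih =>
    have h1 : f = (f - C (f.coeff n / (e n).coeff n) * e n)
        + (f.coeff n / (e n).coeff n) • e n := by
      rw [smul_eq_C_mul]; ring
    rw [h1]
    refine S.add_mem (ih (fun m hm => he m (by omega)) (fun m hm => he' m (by omega))
      (fun m hm => hS m (by omega)) ?_) (S.smul_mem _ (hS n (by omega)))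
    rw [degree_lt_iff_coeff_zero]
    intro m hm
    rw [coeff_sub, coeff_C_mul]
    rcases hm.eq_or_lt with rfl | hm
    · rw [div_mul_cancel₀ _ (he' n (by omega)), sub_self]
    · rw [coeff_eq_zero_of_natDegree_lt ((he n (by omega)).trans_lt hm),
        (degree_lt_iff_coeff_zero _ _).1 hf m (by exact_mod_cast hm)]
      simp

theorem degree_sub_lt_of_monic {f g : ℂ[X]} {n : ℕ} (hf : f.Monic ∧ f.natDegree = n)
    (hg : g.Monic ∧ g.natDegree = n) : (f - g).degree < n := by
  rw [degree_lt_iff_coeff_zero]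
  intro m hm
  rw [coeff_sub]
  rcases hm.eq_or_lt with rfl | hm
  · have h1 := hf.1.coeff_natDegree
    have h2 := hg.1.coeff_natDegree
    rw [hf.2] at h1
    rw [hg.2] at h2
    rw [h1, h2, sub_self]
  · rw [coeff_eq_zero_of_natDegree_lt (by omega), coeff_eq_zero_of_natDegree_lt (by omega),
      sub_zero]

/-- Monic orthogonal polynomials are unique, as long as the squared norms do not vanish. -/
theorem monic_orthogonal_unique (B : ℂ[X] →ₗ[ℂ] ℂ[X] →ₗ[ℂ] ℂ) (p P : ℕ → ℂ[X]) (N : ℕ)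
    (hp : ∀ n ≤ N, (p n).Monic ∧ (p n).natDegree = n)
    (hP : ∀ n ≤ N, (P n).Monic ∧ (P n).natDegree = n)
    (hpo : ∀ n m, m < n → n ≤ N → B (p n) (p m) = 0)
    (hpn : ∀ n < N, B (p n) (p n) ≠ 0)
    (hPo : ∀ n m, m < n → n ≤ N → B (P n) (P m) = 0) (hsymm : ∀ f g, B f g = B g f) :
    ∀ n ≤ N, P n = p n := by
  intro n
  induction n using Nat.strong_induction_on with
  | _ n ih =>
  intro hn
  have key : ∀ m < n, B (P n - p n) (p m) = 0 := by
    intro m hm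
    rw [map_sub, LinearMap.sub_apply, hpo n m hm hn, ← ih m hm (by omega), hPo n m hm hn, sub_zero]
  have hd := degree_sub_lt_of_monic (hP n hn) (hp n hn)
  -- The degree bound on the difference is lowered one unit at a time. Pairing with p_r shows that
  -- the coefficient of x^r times ⟨p_r, p_r⟩ vanishes; only r < n ≤ N occur, so the norm of p_N is
  -- never needed.
  suffices h : ∀ m ≤ n, (P n - p n).degree < ((n - m : ℕ) : WithBot ℕ) by
    have := h n le_rfl
    rw [Nat.sub_self] at this
    rw [← sub_eq_zero, ← degree_eq_bot]
    simpa using this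
  intro m
  induction m with
  | zero => intro _; simpa using hd
  | succ m ihm =>
    intro hm
    have h1 := ihm (by omega)
    set r := n - (m + 1) with hr
    rw [show n - m = r + 1 by omega] at h1
    set f := P n - p n with hfdef
    have hrp := hp r (by omega)
    have h2 : (f - C (f.coeff r) * p r).degree < (r : WithBot ℕ) := by
      rw [degree_lt_iff_coeff_zero]
      intro l hl
      rw [coeff_sub, coeff_C_mul]
      have h3 := hrp.1.coeff_natDegree
      rw [hrp.2] at h3
      rcases hl.eq_or_lt with rfl | hl
      · rw [h3]; ring
      · rw [(degree_lt_iff_coeff_zero _ _).1 h1 l (by exact_mod_cast hl),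
          coeff_eq_zero_of_natDegree_lt (p := p r) (by omega)]
        ring
    have h3 : B (p r) (f - C (f.coeff r) * p r) = 0 := by
      refine LinearMap.mem_ker.1 (mem_of_forall_coeff_ne_zero (n := r) (LinearMap.ker (B (p r))) p
        (fun l hl => (hp l (by omega)).2.le) (fun l hl => ?_) (fun l hl => ?_) h2)
      · have h4 := hp l (by omega)
        have h5 := h4.1.coeff_natDegree
        rw [h4.2] at h5
        rw [h5]; exact one_ne_zero
      · exact LinearMap.mem_ker.2 (hpo r l hl (by omega))
    rw [map_sub, ← smul_eq_C_mul, map_smul, hsymm (p r) f, key r (by omega), zero_sub,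
      neg_eq_zero, smul_eq_mul] at h3
    have h4 : f.coeff r = 0 := (mul_eq_zero.1 h3).resolve_right (hpn r (by omega))
    rwa [h4, C_0, zero_mul, sub_zero] at h2

/-! ### Functionals of Askey–Wilson type -/

/-- The linear factor `2(1 - abcd)x - (e₁ - e₃)` where `eᵢ` are the elementary symmetric
functions of `a, b, c, d`. -/
def pearsonFactor (a b c d : ℂ) : ℂ[X] :=
  C (2 * (1 - a * b * c * d)) * X
    - C (a + b + c + d - (a * b * c + a * b * d + a * c * d + b * c * d))

/-- The functionals that satisfy the Pearson equation of the Askey–Wilson weight. -/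
def IsAWFunctional (q a b c d : ℂ) (L : ℂ[X] →ₗ[ℂ] ℂ) : Prop :=
  ∀ k m : ℕ, L (awBasis q a k * awBasis q b m * pearsonFactor (a * q ^ k) (b * q ^ m) c d) = 0

variable {q a b c d : ℂ} {L : ℂ[X] →ₗ[ℂ] ℂ}

theorem map_C_mul (L : ℂ[X] →ₗ[ℂ] ℂ) (x : ℂ) (f : ℂ[X]) : L (C x * f) = x * L f := by
  rw [← smul_eq_C_mul, map_smul, smul_eq_mul]

/-- The underlying identity is (1-abcd)(1-2ax+a²) - (1-ab)(1-ac)(1-ad) = -a · `pearsonFactor a b c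
d`, applied with a, b replaced by aq^k, bq^m. -/
theorem IsAWFunctional.moment_left (hL : IsAWFunctional q a b c d L) (k m : ℕ) :
    (1 - a * b * c * d * q ^ (k + m)) * L (awBasis q a (k + 1) * awBasis q b m)
      = (1 - a * b * q ^ (k + m)) * (1 - a * c * q ^ k) * (1 - a * d * q ^ k)
        * L (awBasis q a k * awBasis q b m) := by
  have h := hL k m
  rw [← map_C_mul, ← map_C_mul, ← sub_eq_zero, ← map_sub]
  have e : C (1 - a * b * c * d * q ^ (k + m)) * (awBasis q a (k + 1) * awBasis q b m)
      - C ((1 - a * b * q ^ (k + m)) * (1 - a * c * q ^ k) * (1 - a * d * q ^ k))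
        * (awBasis q a k * awBasis q b m)
      = (-(a * q ^ k)) • (awBasis q a k * awBasis q b m
          * pearsonFactor (a * q ^ k) (b * q ^ m) c d) := by
    rw [awBasis_succ, pearsonFactor, smul_eq_C_mul]
    simp only [map_sub, map_add, map_mul, map_pow, map_one, map_neg, pow_add]
    rw [show (C (2 : ℂ) : ℂ[X]) = 2 from rfl]
    ring
  rw [e, map_smul, h, smul_zero]

/-- The linear factor is symmetric in its four parameters, so the same equation, with k = 0, also
gives a recursion in the b-basis. -/
theorem IsAWFunctional.moment_right (hL : IsAWFunctional q a b c d L) (m : ℕ) :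
    (1 - a * b * c * d * q ^ m) * L (awBasis q b (m + 1))
      = (1 - a * b * q ^ m) * (1 - b * c * q ^ m) * (1 - b * d * q ^ m)
        * L (awBasis q b m) := by
  have h := hL 0 m
  rw [← map_C_mul, ← map_C_mul, ← sub_eq_zero, ← map_sub]
  have e : C (1 - a * b * c * d * q ^ m) * (awBasis q b (m + 1))
      - C ((1 - a * b * q ^ m) * (1 - b * c * q ^ m) * (1 - b * d * q ^ m))
        * (awBasis q b m)
      = (-(b * q ^ m)) • (awBasis q a 0 * awBasis q b m
          * pearsonFactor (a * q ^ 0) (b * q ^ m) c d) := by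
    rw [awBasis_succ, awBasis_zero, pearsonFactor, smul_eq_C_mul]
    simp only [map_sub, map_add, map_mul, map_pow, map_one, map_neg, pow_zero]
    rw [show (C (2 : ℂ) : ℂ[X]) = 2 from rfl]
    ring
  rw [e, map_smul, h, smul_zero]

theorem IsAWFunctional.moment (hL : IsAWFunctional q a b c d L) (k m : ℕ) :
    qPoch (a * b * c * d * q ^ m) q k * L (awBasis q a k * awBasis q b m)
      = qPoch (a * b * q ^ m) q k * qPoch (a * c) q k * qPoch (a * d) q k
        * L (awBasis q b m) := by
  induction k with
  | zero => simp [qPoch_zero, awBasis_zero]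
  | succ k ih =>
    have h := hL.moment_left k m
    simp only [qPoch_succ]
    have e1 : a * b * c * d * q ^ m * q ^ k = a * b * c * d * q ^ (k + m) := by ring
    have e2 : a * b * q ^ m * q ^ k = a * b * q ^ (k + m) := by ring
    rw [e1, e2, mul_assoc, h]
    linear_combination (1 - a * b * q ^ (k + m)) * (1 - a * c * q ^ k) * (1 - a * d * q ^ k) * ih

theorem IsAWFunctional.moment_awBasis (hL : IsAWFunctional q a b c d L) (m : ℕ) :
    qPoch (a * b * c * d) q m * L (awBasis q b m)
      = qPoch (a * b) q m * qPoch (b * c) q m * qPoch (b * d) q m * L 1 := by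
  induction m with
  | zero => simp [qPoch_zero, awBasis_zero]
  | succ m ih =>
    have h := hL.moment_right m
    simp only [qPoch_succ]
    rw [mul_assoc, h]
    linear_combination (1 - a * b * q ^ m) * (1 - b * c * q ^ m) * (1 - b * d * q ^ m) * ih

theorem awPoly_eq (q a b c d : ℂ) (n : ℕ) : awPoly q a b c d n =
    C (1 / ((2 * a) ^ n * qPoch (a * b * c * d * q ^ ((n : ℤ) - 1)) q n)) *
    ∑ k ∈ Finset.range (n + 1),
      C (qBinomCoeff q n k * (qPoch (a * b * c * d * q ^ ((n : ℤ) - 1)) q k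
          * (qPoch (a * b * q ^ k) q (n - k) * qPoch (a * c * q ^ k) q (n - k)
              * qPoch (a * d * q ^ k) q (n - k)))) * awBasis q a k := by
  rw [awPoly]
  congr 1
  refine Finset.sum_congr rfl fun k _ => ?_
  rw [awBasis]
  congr 2
  rw [qBinomCoeff]
  ring

theorem awPoly_zero (q a b c d : ℂ) : awPoly q a b c d 0 = 1 := by
  simp [awPoly, qPoch_zero]

theorem mul_zpow_sub_one {B q : ℂ} {n : ℕ} :
    B * q ^ (((n + 1 : ℕ) : ℤ) - 1) = B * q ^ n := by
  rw [← zpow_natCast]; congr 2; push_cast; ring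

theorem qPoch_mul_zpow_ne_zero {B q : ℂ} (hB : B ∉ Omega q) (n k : ℕ) (hn : n ≠ 0) :
    qPoch (B * q ^ ((n : ℤ) - 1)) q k ≠ 0 := by
  obtain ⟨n, rfl⟩ := Nat.exists_eq_succ_of_ne_zero hn
  rw [Nat.succ_eq_add_one, mul_zpow_sub_one]
  exact qPoch_ne_zero_of_notMem hB n k

theorem isMonicSeqOn_awPoly (hq0 : q ≠ 0) (hq1 : ‖q‖ < 1) (ha : a ≠ 0)
    (hB : a * b * c * d ∉ Omega q) : IsMonicSeqOn (awPoly q a b c d) Set.univ := by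
  intro n _
  suffices h : (awPoly q a b c d n).natDegree ≤ n ∧ (awPoly q a b c d n).coeff n = 1 from
    ⟨monic_of_natDegree_le_of_coeff_eq_one n h.1 h.2,
      natDegree_eq_of_le_of_coeff_ne_zero h.1 (by rw [h.2]; exact one_ne_zero)⟩
  constructor
  · rw [awPoly_eq]
    refine (natDegree_C_mul_le _ _).trans (natDegree_sum_le_of_forall_le _ _ fun k hk => ?_)
    refine (natDegree_C_mul_le _ _).trans ((natDegree_awBasis_le _ _ _).trans ?_)
    have := Finset.mem_range.1 hk
    omega
  · rw [awPoly_eq, coeff_C_mul, finsetSum_coeff, Finset.sum_range_succ, Finset.sum_eq_zero]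
    · rw [coeff_C_mul, coeff_awBasis_self, Nat.sub_self, zero_add]
      simp only [qPoch_zero, mul_one]
      rcases Nat.eq_zero_or_pos n with rfl | hn
      · simp [qPoch_zero, qBinomCoeff]
      have h1 := qPoch_mul_zpow_ne_zero hB n n hn.ne'
      have h2 := qPoch_self_ne_zero hq1 n
      -- Only the summand k = n reaches degree n; this product is what its leading coefficient
      -- contributes, and it matches the normalising factor of p_n.
      have h3 : qPoch (q ^ (-(n : ℤ))) q n * q ^ n * ∏ i ∈ Finset.range n, (-(2 * a * q ^ i))
          = (2 * a) ^ n * qPoch q q n := by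
        have e1 : ∏ i ∈ Finset.range n, (-(2 * a * q ^ i))
            = (2 * a) ^ n * ∏ i ∈ Finset.range n, (-q ^ i) := by
          have := Finset.prod_const (2 * a) (s := Finset.range n)
          rw [Finset.card_range] at this
          rw [← this, ← Finset.prod_mul_distrib]
          exact Finset.prod_congr rfl fun i _ => by ring
        have e2 : q ^ n * ∏ i ∈ Finset.range n, (-q ^ i) = ∏ i ∈ Finset.range n, (-q ^ (i + 1)) := by
          have := Finset.prod_const q (s := Finset.range n)
          rw [Finset.card_range] at this
          rw [← this, ← Finset.prod_mul_distrib]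
          exact Finset.prod_congr rfl fun i _ => by ring
        have e3 : qPoch (q ^ (-(n : ℤ))) q n = ∏ i ∈ Finset.range n, (1 - (q ^ (i + 1))⁻¹) := by
          rw [qPoch, ← Finset.prod_range_reflect]
          refine Finset.prod_congr rfl fun i hi => ?_
          have hi := Finset.mem_range.1 hi
          rw [← zpow_natCast, ← zpow_natCast, ← zpow_neg, ← zpow_add₀ hq0]
          congr 2
          omega
        have e4 : qPoch q q n = ∏ i ∈ Finset.range n, ((1 - (q ^ (i + 1))⁻¹) * (-q ^ (i + 1))) := by
          refine Finset.prod_congr rfl fun i _ => ?_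
          have := pow_ne_zero (i + 1) hq0
          field_simp
          ring
        rw [e1, e3, e4, Finset.prod_mul_distrib, ← e2]
        ring
      have h4 : (2 * a) ^ n ≠ 0 := pow_ne_zero _ (mul_ne_zero two_ne_zero ha)
      rw [qBinomCoeff, one_div]
      generalize qPoch (a * b * c * d * q ^ ((n : ℤ) - 1)) q n = Q at *
      calc _ = (Q⁻¹ * Q) * ((2 * a) ^ n)⁻¹ * (qPoch q q n)⁻¹ * (qPoch (q ^ (-(n : ℤ))) q n * q ^ n
            * ∏ i ∈ Finset.range n, (-(2 * a * q ^ i))) := by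
            rw [mul_inv]; ring
        _ = _ := by rw [h3]; field_simp
    · intro k hk
      rw [coeff_C_mul, coeff_eq_zero_of_natDegree_lt, mul_zero]
      exact (natDegree_awBasis_le _ _ _).trans_lt (Finset.mem_range.1 hk)

/-- After insertion of the moments the factors with ac and ad recombine to (ac,ad;q)_n, independent
of k. `qPoch_mul_qPoch_comm` leaves (abq^k;q)_m, a polynomial in q^k, as the only dependence of the
ab-factors on k. -/
theorem IsAWFunctional.apply_awPoly_mul_awBasis (hL : IsAWFunctional q a b c d L)
    (hB : a * b * c * d ∉ Omega q) {m n : ℕ} (hmn : m ≤ n) :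
    L (awPoly q a b c d n * awBasis q b m)
      = 1 / ((2 * a) ^ n * qPoch (a * b * c * d * q ^ ((n : ℤ) - 1)) q n)
        * (qPoch (a * c) q n * qPoch (a * d) q n * qPoch (a * b * q ^ m) q (n - m)
          * L (awBasis q b m)) * ∑ k ∈ Finset.range (n + 1), qBinomCoeff q n k
            * (qPoch (a * b * q ^ k) q m * (qPoch (a * b * c * d * q ^ ((n : ℤ) - 1)) q k
              / qPoch (a * b * c * d * q ^ m) q k)) := by
  rw [awPoly_eq]
  generalize a * b * c * d * q ^ ((n : ℤ) - 1) = Y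
  rw [mul_assoc (C _), map_C_mul, Finset.sum_mul, map_sum, mul_assoc (1 / _)]
  congr 1
  rw [Finset.mul_sum]
  refine Finset.sum_congr rfl fun k hk => ?_
  have hk : k ≤ n := Nat.lt_succ_iff.1 (Finset.mem_range.1 hk)
  rw [mul_assoc, map_C_mul]
  have h1 := hL.moment k m
  have h2 := qPoch_ne_zero_of_notMem hB m k
  have h3 := qPoch_mul_qPoch_comm (a * b) q hk hmn
  have h4 : qPoch (a * c) q n = qPoch (a * c) q k * qPoch (a * c * q ^ k) q (n - k) := by
    rw [← qPoch_add, Nat.add_sub_cancel' hk]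
  have h5 : qPoch (a * d) q n = qPoch (a * d) q k * qPoch (a * d * q ^ k) q (n - k) := by
    rw [← qPoch_add, Nat.add_sub_cancel' hk]
  rw [h4, h5]
  rw [mul_comm, ← eq_div_iff h2] at h1
  rw [h1]
  linear_combination qBinomCoeff q n k * qPoch Y q k
    * qPoch (a * c * q ^ k) q (n - k) * qPoch (a * d * q ^ k) q (n - k) * qPoch (a * c) q k
    * qPoch (a * d) q k * L (awBasis q b m) / qPoch (a * b * c * d * q ^ m) q k * h3

theorem natDegree_prod_one_sub_C_mul_X_le (u : ℕ → ℂ) (m : ℕ) :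
    (∏ i ∈ Finset.range m, (1 - C (u i) * X : ℂ[X])).natDegree ≤ m := by
  refine (natDegree_prod_le _ _).trans ((Finset.sum_le_card_nsmul _ _ 1 fun i _ => ?_).trans
    (by simp))
  compute_degree

theorem eval_prod_one_sub_C_mul_X (u q K : ℂ) (m : ℕ) :
    (∏ i ∈ Finset.range m, (1 - C (u * q ^ i) * X : ℂ[X])).eval K = qPoch (u * K) q m := by
  rw [eval_prod, qPoch]
  refine Finset.prod_congr rfl fun i _ => ?_
  simp
  ring

/-- With n = m + r + 1 the quotient (abcdq^{m+r};q)_k/(abcdq^m;q)_k equals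
(abcdq^{m+k};q)_r/(abcdq^m;q)_r. Together with (abq^k;q)_m this is a polynomial in q^k of degree at
most m + r < n. -/
theorem IsAWFunctional.apply_awPoly_mul_awBasis_eq_zero (hL : IsAWFunctional q a b c d L)
    (hq0 : q ≠ 0) (hq1 : ‖q‖ < 1) (hB : a * b * c * d ∉ Omega q) {m n : ℕ} (hmn : m < n) :
    L (awPoly q a b c d n * awBasis q b m) = 0 := by
  rw [hL.apply_awPoly_mul_awBasis hB hmn.le]
  obtain ⟨r, rfl⟩ := Nat.exists_eq_add_of_lt hmn
  rw [mul_zpow_sub_one]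
  have h1 := qPoch_ne_zero_of_notMem hB m r
  have key : ∀ k, qPoch (a * b * q ^ k) q m * (qPoch (a * b * c * d * q ^ (m + r)) q k
      / qPoch (a * b * c * d * q ^ m) q k)
      = (C (qPoch (a * b * c * d * q ^ m) q r)⁻¹
        * ((∏ i ∈ Finset.range m, (1 - C (a * b * q ^ i) * X))
          * ∏ i ∈ Finset.range r, (1 - C (a * b * c * d * q ^ m * q ^ i) * X))).eval (q ^ k) := by
    intro k
    have h2 := qPoch_ne_zero_of_notMem hB m k
    rw [eval_mul, eval_mul, eval_C, eval_prod_one_sub_C_mul_X, eval_prod_one_sub_C_mul_X]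
    have h3 := qPoch_add (a * b * c * d * q ^ m) q k r
    rw [add_comm, qPoch_add, mul_assoc (a * b * c * d) (q ^ m) (q ^ r), ← pow_add] at h3
    generalize qPoch (a * b * c * d * q ^ m * q ^ k) q r = T at *
    field_simp
    linear_combination qPoch (a * b * q ^ k) q m * h3
  simp only [key]
  rw [sum_qBinomCoeff_eval hq0 hq1, mul_zero]
  refine (natDegree_C_mul_le _ _).trans_lt (natDegree_mul_le.trans_lt ?_)
  have h3 := natDegree_prod_one_sub_C_mul_X_le (fun i => a * b * q ^ i) m
  have h4 := natDegree_prod_one_sub_C_mul_X_le (fun i => a * b * c * d * q ^ m * q ^ i) r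
  omega

theorem IsAWFunctional.apply_awPoly_mul_eq_zero (hL : IsAWFunctional q a b c d L)
    (hq0 : q ≠ 0) (hq1 : ‖q‖ < 1) (hb : b ≠ 0) (hB : a * b * c * d ∉ Omega q) {n : ℕ}
    {f : ℂ[X]} (hf : f.degree < n) : L (awPoly q a b c d n * f) = 0 := by
  refine LinearMap.mem_ker.1 (mem_of_forall_coeff_ne_zero (n := n)
    (LinearMap.ker (L ∘ₗ LinearMap.mulLeft ℂ (awPoly q a b c d n))) (awBasis q b)
    (fun m _ => natDegree_awBasis_le q b m) (fun m _ => coeff_awBasis_self_ne_zero hq0 hb m)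
    (fun m hm => LinearMap.mem_ker.2 ?_) hf)
  exact hL.apply_awPoly_mul_awBasis_eq_zero hq0 hq1 hB hm

theorem IsAWFunctional.orthogonal (hL : IsAWFunctional q a b c d L)
    (hq0 : q ≠ 0) (hq1 : ‖q‖ < 1) (ha : a ≠ 0) (hb : b ≠ 0) (hB : a * b * c * d ∉ Omega q)
    {m n : ℕ} (hmn : m < n) : L (awPoly q a b c d n * awPoly q a b c d m) = 0 := by
  refine hL.apply_awPoly_mul_eq_zero hq0 hq1 hb hB (degree_le_natDegree.trans_lt ?_)
  rw [(isMonicSeqOn_awPoly hq0 hq1 ha hB m trivial).2]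
  exact_mod_cast hmn

/-- By orthogonality the second p_n may be replaced by a multiple of the n-th element of the
b-basis. For n ≥ 1 the quotient of Pochhammer symbols is then (1-y)/(1-yq^k) with y = abcdq^{n-1},
and `sum_qBinomCoeff_qPoch_div` gives a closed product. The factor (ab;q)_n is the reason for
restricting `hab` to i < n. -/
theorem IsAWFunctional.norm_ne_zero (hL : IsAWFunctional q a b c d L)
    (hq0 : q ≠ 0) (hq1 : ‖q‖ < 1) (ha : a ≠ 0) (hb : b ≠ 0) (hc : c ≠ 0) (hd : d ≠ 0)
    (hB : a * b * c * d ∉ Omega q) (hac : a * c ∉ Omega q) (had : a * d ∉ Omega q)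
    (hbc : b * c ∉ Omega q) (hbd : b * d ∉ Omega q) (hcd : c * d ∉ Omega q) {n : ℕ}
    (hab : ∀ i < n, a * b * q ^ i ≠ 1) (h1 : L 1 ≠ 0) :
    L (awPoly q a b c d n * awPoly q a b c d n) ≠ 0 := by
  have hm := isMonicSeqOn_awPoly hq0 hq1 ha hB n trivial
  have hlead := coeff_awBasis_self_ne_zero hq0 hb n
  have hdeg : (awPoly q a b c d n - C ((awBasis q b n).coeff n)⁻¹ * awBasis q b n).degree < n := by
    rw [degree_lt_iff_coeff_zero]
    intro l hl
    rw [coeff_sub, coeff_C_mul]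
    rcases hl.eq_or_lt with rfl | hl
    · have h3 := hm.1.coeff_natDegree
      rw [hm.2] at h3
      rw [h3, inv_mul_cancel₀ hlead, sub_self]
    · rw [coeff_eq_zero_of_natDegree_lt (by omega),
        coeff_eq_zero_of_natDegree_lt ((natDegree_awBasis_le q b n).trans_lt hl)]
      ring
  have h2 := hL.apply_awPoly_mul_eq_zero hq0 hq1 hb hB hdeg
  rw [mul_sub, map_sub, sub_eq_zero, mul_left_comm, ← smul_eq_C_mul, map_smul] at h2
  rw [h2]
  refine smul_ne_zero (inv_ne_zero hlead) ?_
  rcases Nat.eq_zero_or_pos n with rfl | hn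
  · simpa [awPoly_zero, awBasis_zero] using h1
  obtain ⟨n, rfl⟩ := Nat.exists_eq_succ_of_ne_zero hn.ne'
  rw [Nat.succ_eq_add_one] at *
  rw [hL.apply_awPoly_mul_awBasis hB le_rfl, mul_zpow_sub_one]
  set y := a * b * c * d * q ^ n with hy
  have hy0 : y ≠ 0 := by positivity
  have hyi : ∀ i, y * q ^ i ≠ 1 := fun i h => hB (mem_Omega_of_mul_pow (i := n + i) (by
    rw [pow_add, ← mul_assoc, h]))
  have key : ∀ k, qPoch y q k / qPoch (a * b * c * d * q ^ (n + 1)) q k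
      = (1 - y) * (1 - y * q ^ k)⁻¹ := by
    intro k
    have h3 := qPoch_ne_zero_of_notMem hB (n + 1) k
    have h4 : (1 - y * q ^ k) ≠ 0 := sub_ne_zero.2 (hyi k).symm
    have h5 := qPoch_succ y q k
    rw [qPoch_succ_left, hy, mul_assoc (a * b * c * d) (q ^ n) q, ← pow_succ, ← hy] at h5
    rw [div_eq_iff h3, mul_right_comm, h5]
    field_simp
  have hsum : ∑ k ∈ Finset.range (n + 1 + 1), qBinomCoeff q (n + 1) k
            * (qPoch (a * b * q ^ k) q (n + 1) * (qPoch y q k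
              / qPoch (a * b * c * d * q ^ (n + 1)) q k))
      = (1 - y) * (qPoch (a * b * y⁻¹) q (n + 1)
        * (y ^ (n + 1) * qPoch q q (n + 1) / qPoch y q (n + 1 + 1))) := by
    rw [← sum_qBinomCoeff_qPoch_div hq0 hq1 (a * b) hy0 hyi (n + 1), Finset.mul_sum]
    refine Finset.sum_congr rfl fun k _ => ?_
    rw [key]
    ring
  rw [hsum]
  have hP : ∀ k, qPoch y q k ≠ 0 := fun k => qPoch_ne_zero fun i _ => hyi i
  have h3 : L (awBasis q b (n + 1)) ≠ 0 := by
    intro h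
    have h4 := hL.moment_awBasis (n + 1)
    rw [h, mul_zero] at h4
    exact mul_ne_zero (mul_ne_zero (mul_ne_zero (qPoch_ne_zero hab)
      (qPoch_ne_zero_of_notMem' hbc _)) (qPoch_ne_zero_of_notMem' hbd _)) h1 h4.symm
  -- Here ab/y = 1/(cdq^n), so a vanishing factor would mean cd·q^{n-i} = 1.
  have h5 : qPoch (a * b * y⁻¹) q (n + 1) ≠ 0 := qPoch_ne_zero fun i hi h => hcd
    (mem_Omega_of_mul_pow (i := n - i) (by
      have e : q ^ n = q ^ (n - i) * q ^ i := by rw [← pow_add]; congr 1; omega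
      rw [hy, e] at h
      have hqi := pow_ne_zero i hq0
      have hqi' := pow_ne_zero (n - i) hq0
      field_simp at h
      rw [← h]))
  have h6 : (1 - y) ≠ 0 := sub_ne_zero.2 fun h => hyi 0 (by rw [← h, one_mul, pow_zero])
  refine mul_ne_zero (mul_ne_zero (one_div_ne_zero (mul_ne_zero (pow_ne_zero _
    (mul_ne_zero two_ne_zero ha)) (hP _))) (mul_ne_zero (mul_ne_zero (mul_ne_zero
    (qPoch_ne_zero_of_notMem' hac _) (qPoch_ne_zero_of_notMem' had _)) ?_) h3))
    (mul_ne_zero h6 (mul_ne_zero h5 (div_ne_zero (mul_ne_zero (pow_ne_zero _ hy0)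
      (qPoch_self_ne_zero hq1 _)) (hP _))))
  rw [Nat.sub_self, qPoch_zero]
  exact one_ne_zero

/-- All moments in the b-basis are multiples of L(1). This reduces L(1) ≠ 0 to exhibiting a
polynomial that L does not kill. -/
theorem IsAWFunctional.eq_zero (hL : IsAWFunctional q a b c d L) (hq0 : q ≠ 0) (hb : b ≠ 0)
    (hB : a * b * c * d ∉ Omega q) (h1 : L 1 = 0) (f : ℂ[X]) : L f = 0 := by
  refine LinearMap.mem_ker.1 (mem_of_forall_coeff_ne_zero (n := f.natDegree + 1)
    (LinearMap.ker L) (awBasis q b)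
    (fun m _ => natDegree_awBasis_le q b m) (fun m _ => coeff_awBasis_self_ne_zero hq0 hb m)
    (fun m hm => LinearMap.mem_ker.2 ?_) (degree_le_natDegree.trans_lt
      (by exact_mod_cast Nat.lt_succ_self _)))
  have h := hL.moment_awBasis m
  rw [h1, mul_zero] at h
  exact (mul_eq_zero.1 h).resolve_left (qPoch_ne_zero_of_notMem' hB m)

/-! ### The divided difference operator on the Askey–Wilson polynomials -/

theorem exists_xOf_eq (x : ℂ) : ∃ z : ℂ, z ≠ 0 ∧ xOf z = x := by
  obtain ⟨w, rfl⟩ := Complex.cos_surjective x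
  refine ⟨Complex.exp (w * Complex.I), Complex.exp_ne_zero _, ?_⟩
  rw [xOf, ← Complex.exp_neg, Complex.cos, neg_mul]

/-- The difference x(sz) - x(z/s) vanishes only at z = ±1, so the identity fixes the values of g at
every x other than ±1, and infinitely many values determine a polynomial. -/
theorem eq_awDiff {q s : ℂ} (hs0 : s ≠ 0) (hq : s ^ 2 = q) (hq1 : ‖q‖ < 1) {f g : ℂ[X]}
    (h : ∀ z : ℂ, z ≠ 0 → (xOf (s * z) - xOf (z / s)) * g.eval (xOf z)
      = f.eval (xOf (s * z)) - f.eval (xOf (z / s))) : g = awDiff s f := by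
  refine eq_of_infinite_eval_eq _ _ (Set.Infinite.mono (s := {1, -1}ᶜ) (fun x hx => ?_)
    (Set.Finite.infinite_compl (Set.toFinite _)))
  obtain ⟨z, hz, rfl⟩ := exists_xOf_eq x
  have h1 := h z hz
  rw [← eval_awDiff hs0 hz] at h1
  refine mul_left_cancel₀ ?_ h1
  have e : xOf (s * z) - xOf (z / s) = (s ^ 2 - 1) * (z - 1) * (z + 1) / (2 * s * z) := by
    unfold xOf; field_simp; ring
  rw [e]
  have h2 : s ^ 2 - 1 ≠ 0 := by
    rw [hq]; intro h
    rw [sub_eq_zero.1 h] at hq1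
    simp at hq1
  simp only [Set.mem_compl_iff, Set.mem_insert_iff, Set.mem_singleton_iff, not_or] at hx
  have h3 : z - 1 ≠ 0 := fun h => hx.1 (by rw [sub_eq_zero.1 h]; norm_num [xOf])
  have h4 : z + 1 ≠ 0 := fun h => hx.2 (by rw [eq_neg_of_add_eq_zero_left h]; norm_num [xOf])
  exact div_ne_zero (mul_ne_zero (mul_ne_zero h2 h3) h4) (by simp [hs0, hz])

/-- The divided difference operator as a linear map. -/
def awDiffHom (s : ℂ) : ℂ[X] →ₗ[ℂ] ℂ[X] where
  toFun := awDiff s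
  map_add' f g := by
    simp only [awDiff]
    exact sum_add_index f g _ (fun i => by simp) fun i x y => by simp [add_mul]
  map_smul' r f := by
    simp only [awDiff]
    rw [sum_smul_index _ _ _ (fun i => by simp), Polynomial.sum, Polynomial.sum,
      RingHom.id_apply, smul_eq_C_mul, Finset.mul_sum]
    exact Finset.sum_congr rfl fun i _ => by rw [C_mul, mul_assoc]

theorem awDiffHom_apply (s : ℂ) (f : ℂ[X]) : awDiffHom s f = awDiff s f := rfl

theorem awDiffHom_C_mul (s x : ℂ) (f : ℂ[X]) :
    awDiffHom s (C x * f) = C x * awDiffHom s f := by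
  rw [← smul_eq_C_mul, map_smul, smul_eq_C_mul]

theorem awDiffHom_pow_apply (s : ℂ) (n : ℕ) (f : ℂ[X]) :
    (awDiffHom s ^ n) f = (awDiff s)^[n] f := by
  rw [Module.End.pow_apply]; rfl

theorem awDiff_one (s : ℂ) : awDiff s 1 = 0 := by
  rw [awDiff, ← C_1, sum_C_index (by simp)]
  simp [awPair]

/-- Both half-shifts of (az,a/z;q)_{k+1} contain (asz,as/z;q)_k. The difference of the two remaining
quadratic factors is a multiple of x(sz) - x(z/s). -/
theorem awDiff_awBasis_succ {q s : ℂ} (hs0 : s ≠ 0) (hq : s ^ 2 = q) (hq1 : ‖q‖ < 1)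
    (a : ℂ) (k : ℕ) :
    awDiff s (awBasis q a (k + 1))
      = C (-(2 * a) * (1 - q ^ (k + 1)) / (1 - q)) * awBasis q (a * s) k := by
  symm
  refine eq_awDiff hs0 hq hq1 fun z hz => ?_
  have h1 : (1 - q) ≠ 0 := sub_ne_zero.2 (by rintro rfl; simp at hq1)
  rw [eval_mul, eval_C, eval_awBasis _ _ _ hz, eval_awBasis _ _ _ (mul_ne_zero hs0 hz),
    eval_awBasis _ _ _ (div_ne_zero hz hs0)]
  rw [qPoch_succ (a * (s * z)), qPoch_succ_left (a / (s * z)), qPoch_succ_left (a * (z / s)),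
    qPoch_succ (a / (z / s))]
  have e1 : a * (s * z) = a * s * z := by ring
  have e2 : a / (s * z) * q = a * s / z := by rw [← hq]; field_simp
  have e3 : a * (z / s) * q = a * s * z := by rw [← hq]; field_simp
  have e4 : a / (z / s) = a * s / z := by field_simp
  rw [e1, e2, e3, e4]
  generalize qPoch (a * s * z) q k = P
  generalize qPoch (a * s / z) q k = Q
  unfold xOf
  rw [pow_succ q k]
  generalize q ^ k = K
  subst hq
  field_simp
  ring

/-- The operator acts term by term on the a-basis and removes the term k = 0. The coefficients match
after k is lowered by one, since mixed products such as ab become abq and abcdq^n becomes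
abcdq^{n+1}. -/
theorem awDiff_awPoly_succ {q s a b c d : ℂ} (hs0 : s ≠ 0) (hq : s ^ 2 = q) (hq1 : ‖q‖ < 1)
    (ha : a ≠ 0) (hB : a * b * c * d ∉ Omega q) (n : ℕ) :
    ∃ κ : ℂ, κ ≠ 0 ∧ awDiff s (awPoly q a b c d (n + 1))
      = C κ * awPoly q (a * s) (b * s) (c * s) (d * s) n := by
  have hq0 : q ≠ 0 := by rw [← hq]; exact pow_ne_zero _ hs0
  have hqn := fun k : ℕ => pow_ne_one_of_norm_lt hq1 (Nat.succ_ne_zero k)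
  have h1 : (1 - q) ≠ 0 := sub_ne_zero.2 (by rintro rfl; simp at hq1)
  have h2 : (1 - q ^ (-((n + 1 : ℕ) : ℤ))) ≠ 0 := by
    rw [zpow_neg, zpow_natCast]
    intro h
    exact hqn n (inv_eq_one.1 (sub_eq_zero.1 h).symm)
  refine ⟨(1 - q ^ (-((n + 1 : ℕ) : ℤ))) * (-q / (1 - q)) * s ^ n, mul_ne_zero (mul_ne_zero h2
    (div_ne_zero (neg_ne_zero.2 hq0) h1)) (pow_ne_zero _ hs0), ?_⟩
  rw [awPoly_eq, awPoly_eq, mul_zpow_sub_one, ← awDiffHom_apply, awDiffHom_C_mul,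
    map_sum, Finset.sum_range_succ']
  have eB : a * s * (b * s) * (c * s) * (d * s) * q ^ ((n : ℤ) - 1)
      = a * b * c * d * q ^ n * q := by
    rw [zpow_sub_one₀ hq0, zpow_natCast]
    field_simp
    rw [← hq]; ring
  rw [eB]
  have hy : a * b * c * d * q ^ n ≠ 1 := fun h => hB (mem_Omega_of_mul_pow h)
  rw [qPoch_succ_left _ q n]
  have hY := qPoch_ne_zero_of_notMem hB (n + 1) n
  rw [pow_succ, ← mul_assoc] at hY
  generalize hyy : a * b * c * d * q ^ n = y at *
  rw [awBasis_zero, awDiffHom_C_mul, awDiffHom_apply, awDiff_one, mul_zero, add_zero,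
    Finset.mul_sum, Finset.mul_sum, Finset.mul_sum]
  refine Finset.sum_congr rfl fun k hk => ?_
  rw [awDiffHom_C_mul, awDiffHom_apply, awDiff_awBasis_succ hs0 hq hq1]
  have e1 : a * s * (b * s) * q ^ k = a * b * q ^ (k + 1) := by rw [pow_succ, ← hq]; ring
  have e2 : a * s * (c * s) * q ^ k = a * c * q ^ (k + 1) := by rw [pow_succ, ← hq]; ring
  have e3 : a * s * (d * s) * q ^ k = a * d * q ^ (k + 1) := by rw [pow_succ, ← hq]; ring
  rw [e1, e2, e3, Nat.add_sub_add_right, qPoch_succ_left y q k]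
  have hbin : qBinomCoeff q (n + 1) (k + 1) * (1 - q ^ (k + 1))
      = (1 - q ^ (-((n + 1 : ℕ) : ℤ))) * q * qBinomCoeff q n k := by
    have e : q ^ (-((n + 1 : ℕ) : ℤ)) * q = q ^ (-(n : ℤ)) := by
      rw [← zpow_add_one₀ hq0]; congr 1; push_cast; ring
    have h3 := qPoch_self_ne_zero hq1 k
    have h4 : (1 - q ^ (k + 1)) ≠ 0 := sub_ne_zero.2 (hqn k).symm
    rw [qBinomCoeff, qBinomCoeff, qPoch_succ_left (q ^ (-((n + 1 : ℕ) : ℤ))), e, qPoch_succ q q k,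
      ← pow_succ' q k]
    field_simp
    ring
  have h5 : 1 - y ≠ 0 := sub_ne_zero.2 (Ne.symm hy)
  generalize qPoch (a * b * q ^ (k + 1)) q (n - k) = P1
  generalize qPoch (a * c * q ^ (k + 1)) q (n - k) = P2
  generalize qPoch (a * d * q ^ (k + 1)) q (n - k) = P3
  generalize qPoch (y * q) q k = P4
  generalize qPoch (y * q) q n = P5 at *
  generalize 1 - q ^ (-((n + 1 : ℕ) : ℤ)) = R at *
  rw [show (2 * (a * s)) ^ n = (2 * a) ^ n * s ^ n by rw [← mul_pow]; ring]
  simp only [← mul_assoc, ← C_mul]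
  congr 2
  calc _ = 1 / ((2 * a) ^ (n + 1) * ((1 - y) * P5)) * ((1 - y) * P4 * (P1 * P2 * P3))
        * (-(2 * a)) / (1 - q) * (qBinomCoeff q (n + 1) (k + 1) * (1 - q ^ (k + 1))) := by ring
    _ = _ := by
      rw [hbin]
      field_simp
      ring

theorem iterate_awDiff_awPoly {q s : ℂ} (hs0 : s ≠ 0) (hq : s ^ 2 = q) (hq1 : ‖q‖ < 1) (N : ℕ)
    {a b c d : ℂ} (ha : a ≠ 0) (hB : a * b * c * d ∉ Omega q) (n : ℕ) :
    ∃ κ : ℂ, κ ≠ 0 ∧ (awDiff s)^[N] (awPoly q a b c d (n + N))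
      = C κ * awPoly q (a * s ^ N) (b * s ^ N) (c * s ^ N) (d * s ^ N) n := by
  induction N generalizing a b c d with
  | zero => exact ⟨1, one_ne_zero, by simp⟩
  | succ N ih =>
    obtain ⟨κ, h1, h2⟩ := awDiff_awPoly_succ hs0 hq hq1 ha hB (n + N)
    have hB' : a * s * (b * s) * (c * s) * (d * s) ∉ Omega q := by
      rintro ⟨k, hk⟩
      refine hB (mem_Omega_of_mul_pow (i := 2 + k) ?_)
      have hq0 : q ≠ 0 := by rw [← hq]; exact pow_ne_zero _ hs0
      rw [zpow_neg, zpow_natCast, ← mul_eq_one_iff_eq_inv₀ (pow_ne_zero _ hq0)] at hk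
      rw [← hk, pow_add, ← hq]
      ring
    obtain ⟨κ', h3, h4⟩ := ih (mul_ne_zero ha hs0) hB'
    refine ⟨κ * κ', mul_ne_zero h1 h3, ?_⟩
    rw [Function.iterate_succ_apply, ← add_assoc, h2, ← awDiffHom_pow_apply, ← smul_eq_C_mul,
      map_smul, awDiffHom_pow_apply, h4, smul_eq_C_mul, ← mul_assoc, ← C_mul]
    congr 2 <;> ring

theorem iterate_awDiff_awPoly_of_lt {q s : ℂ} (hs0 : s ≠ 0) (hq : s ^ 2 = q) (hq1 : ‖q‖ < 1)
    {n N : ℕ} (hn : n < N) {a b c d : ℂ} (ha : a ≠ 0) (hB : a * b * c * d ∉ Omega q) :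
    (awDiff s)^[N] (awPoly q a b c d n) = 0 := by
  obtain ⟨r, rfl⟩ := Nat.exists_eq_add_of_lt hn
  obtain ⟨κ, -, h⟩ := iterate_awDiff_awPoly hs0 hq hq1 n ha hB 0
  rw [zero_add, awPoly_zero, mul_one] at h
  rw [show n + r + 1 = r + 1 + n by ring, Function.iterate_add_apply, h, ← awDiffHom_pow_apply,
    pow_succ, Module.End.mul_apply, awDiffHom_apply, ← mul_one (C κ), ← awDiffHom_apply,
    ← smul_eq_C_mul, map_smul, awDiffHom_apply, awDiff_one, smul_zero, map_zero]

/-! ### The polynomials `p_n` with `n ≥ N` when `ab = q^{1-N}` -/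

theorem awBasis_dvd (q a : ℂ) {m n : ℕ} (h : m ≤ n) : awBasis q a m ∣ awBasis q a n :=
  Finset.prod_dvd_prod_of_subset _ _ _ (Finset.range_subset_range.2 h)

/-- The coefficient of each basis element with k < N contains (abq^k;q)_{n-k} and vanishes; the
basis elements with k ≥ N are multiples of the N-th one. -/
theorem awBasis_dvd_awPoly {q a b : ℂ} (c d : ℂ) {N n : ℕ} (hq0 : q ≠ 0)
    (hab : a * b = q ^ (1 - (N : ℤ))) (hn : N ≤ n) :
    awBasis q a N ∣ awPoly q a b c d n := by
  rw [awPoly_eq]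
  refine Dvd.dvd.mul_left (Finset.dvd_sum fun k hk => ?_) _
  rcases le_or_gt N k with h | h
  · exact (awBasis_dvd q a h).mul_left _
  -- The vanishing factor is 1 - q^{1-N} q^k q^{N-1-k}; its index N-1-k is below n-k because N ≤ n.
  · rw [qPoch_eq_zero (a := a * b * q ^ k) (i := N - 1 - k) (by omega)]
    · simp
    · rw [hab, mul_assoc, ← pow_add, ← zpow_natCast, ← zpow_add₀ hq0]
      convert zpow_zero q
      omega

theorem awPoly_eq_C_mul_awBasis {q a b c d : ℂ} {N : ℕ} (hq0 : q ≠ 0) (hq1 : ‖q‖ < 1)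
    (ha : a ≠ 0) (hB : a * b * c * d ∉ Omega q) (hab : a * b = q ^ (1 - (N : ℤ))) :
    ∃ κ : ℂ, κ ≠ 0 ∧ awPoly q a b c d N = C κ * awBasis q a N := by
  obtain ⟨g, hg⟩ := awBasis_dvd_awPoly c d hq0 hab le_rfl
  have hm := isMonicSeqOn_awPoly hq0 hq1 ha hB N trivial
  have h1 : awBasis q a N ≠ 0 := fun h => by
    rw [h, zero_mul] at hg
    exact hm.1.ne_zero hg
  have h2 : g ≠ 0 := fun h => by
    rw [h, mul_zero] at hg
    exact hm.1.ne_zero hg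
  have h3 : (awBasis q a N).natDegree = N :=
    natDegree_eq_of_le_of_coeff_ne_zero (natDegree_awBasis_le _ _ _)
      (coeff_awBasis_self_ne_zero hq0 ha N)
  have h4 := natDegree_mul h1 h2
  rw [← hg, hm.2, h3] at h4
  have h5 := eq_C_of_natDegree_eq_zero (show g.natDegree = 0 by omega)
  refine ⟨g.coeff 0, fun h => h2 (by rw [h5, h, C_0]), ?_⟩
  rw [hg, mul_comm]
  congr 1

theorem awBasis_eq_prod_node {q a : ℂ} (hq0 : q ≠ 0) (ha : a ≠ 0) (n : ℕ) :
    awBasis q a n = C ((awBasis q a n).coeff n)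
      * ∏ i ∈ Finset.range n, (X - C (node q i a)) := by
  rw [coeff_awBasis_self, map_prod, ← Finset.prod_mul_distrib, awBasis]
  refine Finset.prod_congr rfl fun i _ => ?_
  have h : 2 * a * q ^ i * node q i a = 1 + a ^ 2 * q ^ (2 * i) := by
    have := pow_ne_zero i hq0
    rw [node]; field_simp; ring
  have h' := congrArg (C : ℂ → ℂ[X]) h
  rw [C_add, C_1, C_mul] at h'
  rw [C_neg]
  linear_combination -h'

/-- Up to a nonzero factor the difference of two nodes is (q^i - q^j)(a²q^{i+j} - 1), so the only
coincidences come from the reflection j ↦ M - j. -/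
theorem node_eq_node_iff {q a : ℂ} {M : ℕ} (hq0 : q ≠ 0) (hq1 : ‖q‖ < 1)
    (ha : a ^ 2 = q ^ (-(M : ℤ))) {i j : ℕ} : node q i a = node q j a ↔ i = j ∨ i + j = M := by
  have ha0 : a ≠ 0 := by
    rintro rfl
    rw [zero_pow two_ne_zero] at ha
    exact zpow_ne_zero _ hq0 ha.symm
  have hi := pow_ne_zero i hq0
  have hj := pow_ne_zero j hq0
  have e : node q i a - node q j a
      = (q ^ i - q ^ j) * (a ^ 2 * q ^ (i + j) - 1) / (2 * a * q ^ i * q ^ j) := by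
    rw [node, node, pow_add]; field_simp; ring
  have e1 : (q ^ i - q ^ j) = 0 ↔ i = j := by
    rw [sub_eq_zero, ← zpow_natCast, ← zpow_natCast, zpow_inj_of_norm_lt hq0 hq1]
    exact Nat.cast_inj
  have e2 : a ^ 2 * q ^ (i + j) - 1 = 0 ↔ i + j = M := by
    rw [sub_eq_zero, ha, ← zpow_natCast, ← zpow_add₀ hq0, zpow_eq_one_iff_of_norm_lt hq1]
    omega
  rw [← sub_eq_zero, e, div_eq_zero_iff, mul_eq_zero, e1, e2]
  have : 2 * a * q ^ i * q ^ j ≠ 0 := by simp [ha0, hq0]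
  tauto

theorem rootMultiplicity_awPoly {q a b c d : ℂ} {N : ℕ} (hq0 : q ≠ 0) (hq1 : ‖q‖ < 1)
    (ha : a ≠ 0) (hB : a * b * c * d ∉ Omega q) (hab : a * b = q ^ (1 - (N : ℤ))) (x : ℂ) :
    (awPoly q a b c d N).rootMultiplicity x
      = ((Finset.range N).filter fun i => node q i a = x).card := by
  classical
  obtain ⟨κ, h1, h2⟩ := awPoly_eq_C_mul_awBasis hq0 hq1 ha hB hab
  rw [awBasis_eq_prod_node hq0 ha, ← mul_assoc, ← C_mul] at h2
  have h3 := mul_ne_zero h1 (coeff_awBasis_self_ne_zero hq0 ha N)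
  rw [h2, ← count_roots, roots_C_mul _ h3]
  have h4 := roots_multiset_prod_X_sub_C ((Finset.range N).val.map fun i => node q i a)
  rw [Multiset.map_map] at h4
  change (∏ i ∈ Finset.range N, (X - C (node q i a))).roots = _ at h4
  rw [h4, Multiset.count_map, Finset.card_def, Finset.filter_val]
  congr 1
  exact Multiset.filter_congr fun i _ => eq_comm

/-! ### The discrete functionals `L₀^α` and `L₀` -/

/-- No denominator of the weights `A_j(α)`, `j < N`, vanishes (apart from `1 - α²`). -/
def RegularAt (q c d : ℂ) (N : ℕ) (α : ℂ) : Prop :=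
  α ≠ 0 ∧ ∀ i < N, α ^ 2 * q ^ N * q ^ i ≠ 1 ∧
    (i + 1 < N → α * c⁻¹ * q * q ^ i ≠ 1 ∧ α * d⁻¹ * q * q ^ i ≠ 1)

/-- The weight `A_j(α)` without the factor `(1 - α² q^{2j}) / (1 - α²)`. -/
def coreWeight (q c d : ℂ) (N j : ℕ) (α : ℂ) : ℂ :=
  (qPoch (q ^ (1 - (N : ℤ))) q j * qPoch (α * c) q j * qPoch (α * d) q j * qPoch (α ^ 2) q j)
    / (qPoch q q j * qPoch (α ^ 2 * q ^ N) q j * qPoch (α * c⁻¹ * q) q j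
        * qPoch (α * d⁻¹ * q) q j) / (c * d * q ^ (-(N : ℤ))) ^ j

theorem weight_eq_coreWeight (q c d : ℂ) (N M j : ℕ) (α : ℂ) :
    weight q c d N M j α
      = (if M = 0 then 1 else 1 - α ^ 2)⁻¹ * (coreWeight q c d N j α * (1 - α ^ 2 * q ^ (2 * j))) := by
  rw [weight, coreWeight, div_eq_mul_inv (1 - α ^ 2 * q ^ (2 * j)), mul_inv]
  ring

/-! ### The Pearson equation of the discrete functional -/

section

variable {q c d α : ℂ} {N : ℕ}

theorem RegularAt.qPoch_ne_zero (h : RegularAt q c d N α) {j : ℕ} (hj : j < N) :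
    qPoch (α ^ 2 * q ^ N) q j ≠ 0 ∧ qPoch (α * c⁻¹ * q) q j ≠ 0
      ∧ qPoch (α * d⁻¹ * q) q j ≠ 0 :=
  ⟨AskeyWilson.qPoch_ne_zero fun i hi => (h.2 i (by omega)).1,
    AskeyWilson.qPoch_ne_zero fun i hi => ((h.2 i (by omega)).2 (by omega)).1,
    AskeyWilson.qPoch_ne_zero fun i hi => ((h.2 i (by omega)).2 (by omega)).2⟩

theorem coreWeight_succ (hq0 : q ≠ 0) (hq1 : ‖q‖ < 1) (hc : c ≠ 0) (hd : d ≠ 0)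
    (h : RegularAt q c d N α) {j : ℕ} (hj : j + 1 < N) :
    coreWeight q c d N (j + 1) α * ((1 - q * q ^ j) * (1 - α ^ 2 * q ^ N * q ^ j)
        * (1 - α * c⁻¹ * q * q ^ j) * (1 - α * d⁻¹ * q * q ^ j) * (c * d * q ^ (-(N : ℤ))))
      = coreWeight q c d N j α * ((1 - q ^ (1 - (N : ℤ)) * q ^ j) * (1 - α * c * q ^ j)
        * (1 - α * d * q ^ j) * (1 - α ^ 2 * q ^ j)) := by
  obtain ⟨h1, h2, h3⟩ := h.qPoch_ne_zero hj
  have h4 := qPoch_self_ne_zero hq1 (j + 1)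
  have h5 : c * d * q ^ (-(N : ℤ)) ≠ 0 := mul_ne_zero (mul_ne_zero hc hd) (zpow_ne_zero _ hq0)
  unfold coreWeight
  rw [qPoch_succ] at h1 h2 h3 h4
  have h1' := mul_ne_zero_iff.1 h1
  have h2' := mul_ne_zero_iff.1 h2
  have h3' := mul_ne_zero_iff.1 h3
  have h4' := mul_ne_zero_iff.1 h4
  simp only [qPoch_succ, pow_succ (c * d * q ^ (-(N : ℤ)))]
  generalize c * d * q ^ (-(N : ℤ)) = e at *
  generalize 1 - q * q ^ j = x1 at *
  generalize 1 - α ^ 2 * q ^ N * q ^ j = x2 at *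
  generalize 1 - α * c⁻¹ * q * q ^ j = x3 at *
  generalize 1 - α * d⁻¹ * q * q ^ j = x4 at *
  obtain ⟨_, _⟩ := h1'
  obtain ⟨_, _⟩ := h2'
  obtain ⟨_, _⟩ := h3'
  obtain ⟨_, _⟩ := h4'
  field_simp

/-- Summation by parts: at z = αq^j the summand is, up to a common factor, T1 j - T2 j, where T1 and
T2 are the two sides of a discrete Pearson identity. The ratio of consecutive weights gives T1 (j+1)
= T2 j, and both boundary terms vanish. The second parameter moves with α so that the product of the
first two stays q^{1-N}. -/
theorem racah_pearson (hq0 : q ≠ 0) (hq1 : ‖q‖ < 1) (hc : c ≠ 0) (hd : d ≠ 0)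
    (h : RegularAt q c d N α) (hN : N ≠ 0) (M k m : ℕ) :
    racahFunctional q c d N M α (awBasis q α k * awBasis q (q ^ (1 - (N : ℤ)) / α) m
      * pearsonFactor (α * q ^ k) (q ^ (1 - (N : ℤ)) / α * q ^ m) c d) = 0 := by
  have hα := h.1
  set b := q ^ (1 - (N : ℤ)) / α with hb
  have hbα : α * b = q ^ (1 - (N : ℤ)) := by rw [hb]; field_simp
  set T1 : ℕ → ℂ := fun j => -(α * q ^ j) ^ 3 * coreWeight q c d N j α * (1 - c / (α * q ^ j))
    * (1 - d / (α * q ^ j)) * (qPoch (α * (α * q ^ j)) q k * qPoch (α / (α * q ^ j)) q (k + 1))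
    * (qPoch (b * (α * q ^ j)) q m * qPoch (b / (α * q ^ j)) q (m + 1)) with hT1
  set T2 : ℕ → ℂ := fun j => -(α * q ^ j)⁻¹ * coreWeight q c d N j α * (1 - c * (α * q ^ j))
    * (1 - d * (α * q ^ j)) * (qPoch (α * (α * q ^ j)) q (k + 1) * qPoch (α / (α * q ^ j)) q k)
    * (qPoch (b * (α * q ^ j)) q (m + 1) * qPoch (b / (α * q ^ j)) q m) with hT2
  have hterm : ∀ j, weight q c d N M j α * (awBasis q α k * awBasis q b m
      * pearsonFactor (α * q ^ k) (b * q ^ m) c d).eval (node q j α)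
      = (if M = 0 then 1 else 1 - α ^ 2)⁻¹ * (T1 j - T2 j) := by
    intro j
    have hz : α * q ^ j ≠ 0 := mul_ne_zero hα (pow_ne_zero _ hq0)
    have hn : node q j α = xOf (α * q ^ j) := rfl
    rw [weight_eq_coreWeight, hn, eval_mul, eval_mul, eval_awBasis _ _ _ hz, eval_awBasis _ _ _ hz,
      mul_assoc, hT1, hT2]
    congr 1
    simp only [qPoch_succ]
    rw [show α ^ 2 * q ^ (2 * j) = (α * q ^ j) ^ 2 by ring, pearsonFactor]
    simp only [eval_sub, eval_mul, eval_C, eval_X, xOf]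
    generalize α * q ^ j = z at *
    generalize qPoch (α * z) q k = P1
    generalize qPoch (α / z) q k = P2
    generalize qPoch (b * z) q m = P3
    generalize qPoch (b / z) q m = P4
    generalize q ^ k = K
    generalize q ^ m = K'
    generalize coreWeight q c d N j α = W
    generalize b = b' at *
    field_simp
    ring
  have hstep : ∀ j, j + 1 < N → T1 (j + 1) = T2 j := by
    intro j hj
    have hz : α * q ^ j ≠ 0 := mul_ne_zero hα (pow_ne_zero _ hq0)
    have hw := coreWeight_succ hq0 hq1 hc hd h hj
    have e1 : α / (α * q ^ (j + 1)) * q = α / (α * q ^ j) := by rw [pow_succ]; field_simp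
    have e2 : b / (α * q ^ (j + 1)) * q = b / (α * q ^ j) := by rw [pow_succ]; field_simp
    have e3 : α * (α * q ^ j) * q = α * (α * q ^ (j + 1)) := by ring
    have e4 : b * (α * q ^ j) * q = b * (α * q ^ (j + 1)) := by ring
    simp only [hT1, hT2]
    rw [qPoch_succ_left (α / _), qPoch_succ_left (b / _), qPoch_succ_left (α * _),
      qPoch_succ_left (b * _), e1, e2, e3, e4]
    generalize qPoch (α * (α * q ^ (j + 1))) q k = P1
    generalize qPoch (α / (α * q ^ j)) q k = P2
    generalize qPoch (b * (α * q ^ (j + 1))) q m = P3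
    generalize qPoch (b / (α * q ^ j)) q m = P4
    have hqj := pow_ne_zero j hq0
    have hqN := pow_ne_zero N hq0
    have hk : coreWeight q c d N (j + 1) α * ((α * q ^ (j + 1)) ^ 3 * (1 - c / (α * q ^ (j + 1)))
        * (1 - d / (α * q ^ (j + 1))) * (1 - α / (α * q ^ (j + 1))) * (1 - b / (α * q ^ (j + 1))))
        = (α * q ^ j)⁻¹ * coreWeight q c d N j α * (1 - c * (α * q ^ j)) * (1 - d * (α * q ^ j))
          * (1 - α * (α * q ^ j)) * (1 - b * (α * q ^ j)) := by
      have f1 : (α * q ^ (j + 1)) ^ 3 * (1 - c / (α * q ^ (j + 1)))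
        * (1 - d / (α * q ^ (j + 1))) * (1 - α / (α * q ^ (j + 1))) * (1 - b / (α * q ^ (j + 1)))
        = (α * q ^ j)⁻¹ * ((1 - q * q ^ j) * (1 - α ^ 2 * q ^ N * q ^ j)
          * (1 - α * c⁻¹ * q * q ^ j) * (1 - α * d⁻¹ * q * q ^ j) * (c * d * q ^ (-(N : ℤ)))) := by
        rw [hb, zpow_sub₀ hq0, zpow_one, zpow_neg, zpow_natCast, pow_succ]
        field_simp
        ring
      have f2 : b * (α * q ^ j) = q ^ (1 - (N : ℤ)) * q ^ j := by rw [← hbα]; ring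
      rw [f1, f2, mul_left_comm, hw]
      ring
    linear_combination (-P1 * P2 * P3 * P4) * hk
  -- At j = 0 the symbol (α/z;q)_{k+1} begins with 1 - 1.
  have h0 : T1 0 = 0 := by
    simp only [hT1]
    rw [qPoch_eq_zero (a := α / (α * q ^ 0)) (Nat.succ_pos k) (by simp [hα])]
    ring
  -- At j = N-1 one has bz = αb·q^{N-1} = 1, so (bz;q)_{m+1} vanishes.
  have hlast : T2 (N - 1) = 0 := by
    simp only [hT2]
    rw [qPoch_eq_zero (a := b * (α * q ^ (N - 1))) (Nat.succ_pos m)]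
    · ring
    · rw [pow_zero, mul_one, ← mul_assoc, mul_comm b, hbα, ← zpow_natCast, ← zpow_add₀ hq0]
      convert zpow_zero q
      omega
  rw [racahFunctional, Finset.sum_congr rfl fun j _ => hterm j, ← Finset.mul_sum,
    Finset.sum_sub_distrib]
  obtain ⟨n, rfl⟩ := Nat.exists_eq_succ_of_ne_zero hN
  rw [Nat.succ_sub_one] at hlast
  rw [Nat.succ_eq_add_one, Finset.sum_range_succ', Finset.sum_range_succ, h0, hlast,
    Finset.sum_congr rfl fun j hj => hstep j (by have := Finset.mem_range.1 hj; omega)]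
  ring

end

theorem differentiable_qPoch {f : ℂ → ℂ} (hf : Differentiable ℂ f) (q : ℂ) (n : ℕ) :
    Differentiable ℂ fun α => qPoch (f α) q n := by
  unfold qPoch
  fun_prop

/-! ### Regularity and antisymmetry of the weights at a² = q^{-M} -/

section

variable {q a c d : ℂ} {N M : ℕ}

theorem one_sub_sq_ne_zero (hq1 : ‖q‖ < 1) (ha : a ^ 2 = q ^ (-(M : ℤ))) (hM : M ≠ 0) :
    1 - a ^ 2 ≠ 0 := by
  rw [ha, sub_ne_zero]
  intro h
  have := (zpow_eq_one_iff_of_norm_lt hq1).1 h.symm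
  omega

theorem differentiableAt_weight (hq0 : q ≠ 0) (hq1 : ‖q‖ < 1) (hc : c ≠ 0) (hd : d ≠ 0)
    (ha : a ^ 2 = q ^ (-(M : ℤ))) (h : RegularAt q c d N a) {j : ℕ} (hj : j < N) :
    DifferentiableAt ℂ (weight q c d N M j) a := by
  obtain ⟨h1, h2, h3⟩ := h.qPoch_ne_zero hj
  have h4 := qPoch_self_ne_zero hq1 j
  have h5 : (c * d * q ^ (-(N : ℤ))) ^ j ≠ 0 :=
    pow_ne_zero _ (mul_ne_zero (mul_ne_zero hc hd) (zpow_ne_zero _ hq0))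
  have h6 : (if M = 0 then 1 else 1 - a ^ 2) ≠ 0 := by
    split_ifs with hM
    · exact one_ne_zero
    · exact one_sub_sq_ne_zero hq1 ha hM
  have d1 := fun f hf => (differentiable_qPoch (f := f) hf q j).differentiableAt (x := a)
  unfold weight
  refine DifferentiableAt.mul (DifferentiableAt.div ?_ ?_ ?_) (DifferentiableAt.div ?_ ?_ ?_)
  · exact (((d1 _ (by fun_prop)).mul (d1 _ (by fun_prop))).mul (d1 _ (by fun_prop))).mul
      (d1 _ (by fun_prop))
  · exact (((d1 _ (by fun_prop)).mul (d1 _ (by fun_prop))).mul (d1 _ (by fun_prop))).mul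
      (d1 _ (by fun_prop))
  · exact mul_ne_zero (mul_ne_zero (mul_ne_zero h4 h1) h2) h3
  · fun_prop
  · by_cases hM : M = 0 <;> simp only [hM, if_true, if_false] <;> fun_prop
  · exact mul_ne_zero h5 h6

/-- The ratio W(j+1)/W(j) = U(j)/U(M-1-j) is inverted by j ↦ M-1-j, which forces W to be symmetric
about M/2. -/
theorem reflect_of_ratio {W U : ℕ → ℂ} {M : ℕ} (hU : ∀ j < M, U j ≠ 0)
    (h : ∀ j < M, W (j + 1) * U (M - 1 - j) = W j * U j) {j : ℕ} (hj : j ≤ M) :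
    W (M - j) = W j := by
  have h1 : ∀ j ≤ M, W j * ∏ i ∈ Finset.range j, U (M - 1 - i)
      = W 0 * ∏ i ∈ Finset.range j, U i := by
    intro j
    induction j with
    | zero => intro _; simp
    | succ j ih =>
      intro hj
      rw [Finset.prod_range_succ, Finset.prod_range_succ]
      linear_combination U j * ih (by omega)
        + (∏ i ∈ Finset.range j, U (M - 1 - i)) * h j (by omega)
  have h2 : ∀ j ≤ M, (∏ i ∈ Finset.range j, U i) * ∏ i ∈ Finset.range (M - j), U (M - 1 - i)
      = ∏ i ∈ Finset.range M, U i := by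
    intro j hj
    obtain ⟨r, rfl⟩ := Nat.exists_eq_add_of_le hj
    rw [Nat.add_sub_cancel_left, Finset.prod_range_add,
      ← Finset.prod_range_reflect (fun x => U (j + x))]
    congr 1
    refine Finset.prod_congr rfl fun i hi => ?_
    have := Finset.mem_range.1 hi
    congr 1
    omega
  have h3 : ∏ i ∈ Finset.range M, U i ≠ 0 :=
    Finset.prod_ne_zero_iff.2 fun i hi => hU i (Finset.mem_range.1 hi)
  have h4 := h2 (M - j) (by omega)
  rw [Nat.sub_sub_self hj] at h4
  refine mul_right_cancel₀ h3 ?_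
  nth_rw 1 [← h2 j hj]
  rw [← h4]
  linear_combination (∏ i ∈ Finset.range j, U i) * h1 (M - j) (by omega)
    - (∏ i ∈ Finset.range (M - j), U i) * h1 j hj

/-- The product of `coreWeight` and q^j is symmetric under j ↦ M-j, while the remaining factor
q^{-j}(1 - a²q^{2j}) = q^{-j} - q^{j-M} is antisymmetric. -/
theorem weight_reflect (hq0 : q ≠ 0) (hq1 : ‖q‖ < 1) (hc : c ≠ 0) (hd : d ≠ 0)
    (hMN : M + 2 ≤ N) (ha : a ^ 2 = q ^ (-(M : ℤ))) (h : RegularAt q c d N a)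
    (hac : a * c ∉ Omega q) (had : a * d ∉ Omega q) {j : ℕ} (hj : j ≤ M) :
    weight q c d N M (M - j) a = -weight q c d N M j a := by
  have ha0 := h.1
  have haM : a ^ 2 * q ^ M = 1 := by
    rw [ha, zpow_neg, zpow_natCast, inv_mul_cancel₀ (pow_ne_zero _ hq0)]
  -- U is the numerator of the ratio of consecutive core weights times q^{-2j}. Because a²q^M = 1,
  -- the denominator of that ratio is U(M-1-j) times q^{2j+1}; the powers of q are absorbed by the
  -- factor q^j in W.
  set U : ℕ → ℂ := fun j => (1 - q ^ (1 - (N : ℤ)) * q ^ j) * (1 - a * c * q ^ j)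
    * (1 - a * d * q ^ j) * (1 - a ^ 2 * q ^ j) * (q ^ (2 * j))⁻¹ with hUdef
  have hU : ∀ j < M, U j ≠ 0 := by
    intro j hj
    have h1 : q ^ (1 - (N : ℤ)) * q ^ j ≠ 1 := by
      rw [← zpow_natCast, ← zpow_add₀ hq0]
      intro h
      have := (zpow_eq_one_iff_of_norm_lt hq1).1 h
      omega
    have h2 : a ^ 2 * q ^ j ≠ 1 := by
      rw [ha, ← zpow_natCast, ← zpow_add₀ hq0]
      intro h
      have := (zpow_eq_one_iff_of_norm_lt hq1).1 h
      omega
    exact mul_ne_zero (mul_ne_zero (mul_ne_zero (mul_ne_zero (sub_ne_zero.2 h1.symm)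
      (sub_ne_zero.2 fun h => hac (mem_Omega_of_mul_pow h.symm)))
      (sub_ne_zero.2 fun h => had (mem_Omega_of_mul_pow h.symm))) (sub_ne_zero.2 h2.symm))
      (inv_ne_zero (pow_ne_zero _ hq0))
  have hW := reflect_of_ratio (W := fun j => coreWeight q c d N j a * q ^ j) hU (fun j hj => by
    have hw := coreWeight_succ hq0 hq1 hc hd h (show j + 1 < N by omega)
    have hqj := pow_ne_zero j hq0
    have hqN := pow_ne_zero N hq0
    obtain ⟨r, rfl⟩ := Nat.exists_eq_add_of_lt hj
    have hr := pow_ne_zero r hq0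
    have e : U (j + r + 1 - 1 - j) * (q * q ^ (2 * j)) = (1 - q * q ^ j) * (1 - a ^ 2 * q ^ N * q ^ j)
        * (1 - a * c⁻¹ * q * q ^ j) * (1 - a * d⁻¹ * q * q ^ j) * (c * d * q ^ (-(N : ℤ))) := by
      rw [show j + r + 1 - 1 - j = r by omega]
      have hr' : q ^ r = (a ^ 2 * (q * q ^ j))⁻¹ := by
        refine eq_inv_of_mul_eq_one_left ?_
        rw [← haM]; ring
      simp only [hUdef]
      rw [pow_mul', pow_mul', hr', zpow_sub₀ hq0, zpow_one, zpow_neg, zpow_natCast]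
      field_simp
      ring
    have h2j : q * q ^ (2 * j) ≠ 0 := by simp [hq0]
    refine mul_right_cancel₀ h2j ?_
    calc _ = coreWeight q c d N (j + 1) a
          * (U (j + r + 1 - 1 - j) * (q * q ^ (2 * j))) * q ^ (j + 1) := by ring
      _ = _ := by
        rw [e, hw]
        simp only [hUdef]
        field_simp
        ring) hj
  rw [weight_eq_coreWeight, weight_eq_coreWeight, ← mul_neg]
  congr 1
  obtain ⟨r, rfl⟩ := Nat.exists_eq_add_of_le hj
  rw [Nat.add_sub_cancel_left] at *
  have hqj := pow_ne_zero j hq0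
  have hr := pow_ne_zero r hq0
  rw [← mul_left_inj' hr, mul_right_comm, hW]
  rw [pow_add] at haM
  refine mul_left_cancel₀ hqj ?_
  linear_combination coreWeight q c d N j a * q ^ j * (-q ^ r - q ^ j) * haM

end

/-! ### The degenerate limit α → a -/

section

variable {q a c d : ℂ} {N M : ℕ}

theorem sum_range_succ_fold (f : ℕ → ℂ) (M : ℕ) :
    ∑ j ∈ Finset.range (M + 1), f j
      = ∑ j ∈ Finset.range ((M + 1) / 2), (f j + f (M - j))
        + if Even M then f (M / 2) else 0 := by
  rw [Finset.sum_add_distrib]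
  rcases Nat.even_or_odd' M with ⟨h, rfl | rfl⟩
  · rw [if_pos (even_two_mul h), show (2 * h + 1) / 2 = h by omega,
      show 2 * h / 2 = h by omega, show 2 * h + 1 = h + (h + 1) by ring, Finset.sum_range_add,
      Finset.sum_range_succ', add_zero, add_assoc]
    have : ∑ k ∈ Finset.range h, f (h + (k + 1)) = ∑ k ∈ Finset.range h, f (2 * h - k) := by
      rw [← Finset.sum_range_reflect]
      refine Finset.sum_congr rfl fun i hi => ?_
      have := Finset.mem_range.1 hi
      congr 1
      omega
    rw [this]
  · rw [if_neg (Nat.not_even_iff_odd.2 (odd_two_mul_add_one h)),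
      show (2 * h + 1 + 1) / 2 = h + 1 by omega,
      show 2 * h + 1 + 1 = (h + 1) + (h + 1) by ring, Finset.sum_range_add,
      ← Finset.sum_range_reflect (fun x => f (h + 1 + x)), add_zero]
    congr 1
    refine Finset.sum_congr rfl fun i hi => ?_
    have := Finset.mem_range.1 hi
    congr 1
    omega

theorem weight_eq_zero (hq0 : q ≠ 0) (ha : a ^ 2 = q ^ (-(M : ℤ))) {j : ℕ} (hj : M < j) :
    weight q c d N M j a = 0 := by
  rw [weight, qPoch_eq_zero (a := a ^ 2) hj]
  · simp
  · rw [ha, zpow_neg, zpow_natCast, inv_mul_cancel₀ (pow_ne_zero _ hq0)]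

theorem weight_half_eq_zero (hq0 : q ≠ 0) (ha : a ^ 2 = q ^ (-(M : ℤ))) {j : ℕ} (hj : 2 * j = M) :
    weight q c d N M j a = 0 := by
  rw [weight, hj, ha, zpow_neg, zpow_natCast, inv_mul_cancel₀ (pow_ne_zero _ hq0)]
  simp

theorem node_reflect (hq0 : q ≠ 0) (hq1 : ‖q‖ < 1) (ha : a ^ 2 = q ^ (-(M : ℤ))) {j : ℕ}
    (hj : j ≤ M) : node q (M - j) a = node q j a :=
  (node_eq_node_iff hq0 hq1 ha).2 (Or.inr (by omega))

/-- The terms j and M-j sit at the same node with opposite weights. The weight at j = M/2 contains 1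
- a²q^M, and those with j > M contain (a²;q)_j = 0. -/
theorem racahFunctional_eq_zero (hq0 : q ≠ 0) (hq1 : ‖q‖ < 1) (hc : c ≠ 0) (hd : d ≠ 0)
    (hMN : M + 2 ≤ N) (ha : a ^ 2 = q ^ (-(M : ℤ))) (h : RegularAt q c d N a)
    (hac : a * c ∉ Omega q) (had : a * d ∉ Omega q) (p : ℂ[X]) :
    racahFunctional q c d N M a p = 0 := by
  obtain ⟨r, rfl⟩ := Nat.exists_eq_add_of_le (show M + 1 ≤ N by omega)
  rw [racahFunctional, Finset.sum_range_add, sum_range_succ_fold, Finset.sum_eq_zero,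
    Finset.sum_eq_zero]
  · split_ifs with hM
    · rw [weight_half_eq_zero hq0 ha (Nat.two_mul_div_two_of_even hM)]; simp
    · simp
  · intro j _
    rw [weight_eq_zero hq0 ha (by omega), zero_mul]
  · intro j hj
    have hj := Finset.mem_range.1 hj
    rw [weight_reflect hq0 hq1 hc hd hMN ha h hac had (show j ≤ M by omega),
      node_reflect hq0 hq1 ha (by omega)]
    ring

theorem hasDerivAt_node (hq0 : q ≠ 0) (ha0 : a ≠ 0) (j : ℕ) :
    HasDerivAt (node q j) ((q ^ j - q ^ j / (a * q ^ j) ^ 2) / 2) a := by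
  have h1 : HasDerivAt (fun α : ℂ => α * q ^ j) (q ^ j) a := by
    simpa using (hasDerivAt_id a).mul_const (q ^ j)
  have h2 := h1.fun_inv (mul_ne_zero ha0 (pow_ne_zero j hq0))
  refine ((h1.add h2).div_const 2).congr_deriv ?_
  ring

/-- In the derivative of a pair j, M-j the weights A_j and -A_j multiply the two different
velocities of the coinciding nodes. Their difference is q^j - q^{M-j}, the source of the term with
p'. -/
theorem hasDerivAt_racahFunctional (hq0 : q ≠ 0) (hq1 : ‖q‖ < 1) (hc : c ≠ 0) (hd : d ≠ 0)
    (hMN : M + 2 ≤ N) (ha : a ^ 2 = q ^ (-(M : ℤ))) (h : RegularAt q c d N a)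
    (hac : a * c ∉ Omega q) (had : a * d ∉ Omega q) (p : ℂ[X]) :
    HasDerivAt (fun α => racahFunctional q c d N M α p) (limitFunctional q a c d N M p) a := by
  set f : ℕ → ℂ := fun j => deriv (weight q c d N M j) a * p.eval (node q j a)
    + weight q c d N M j a * (p.derivative.eval (node q j a)
      * ((q ^ j - q ^ j / (a * q ^ j) ^ 2) / 2)) with hf
  have h1 : HasDerivAt (fun α => racahFunctional q c d N M α p) (∑ j ∈ Finset.range N, f j) a := by
    refine HasDerivAt.fun_sum fun j hj => ?_
    have h2 := (differentiableAt_weight hq0 hq1 hc hd ha h (Finset.mem_range.1 hj)).hasDerivAt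
    exact h2.mul ((p.hasDerivAt (node q j a)).comp a (hasDerivAt_node hq0 h.1 j))
  convert h1 using 1
  obtain ⟨r, rfl⟩ := Nat.exists_eq_add_of_le (show M + 1 ≤ N by omega)
  rw [Finset.sum_range_add, sum_range_succ_fold, limitFunctional, Finset.sum_Ico_eq_sum_range,
    show M + 1 + r - (M + 1) = r by omega, add_right_comm]
  refine congrArg₂ (· + ·) (congrArg₂ (· + ·) ?_ ?_) ?_
  · refine Finset.sum_congr rfl fun j hj => ?_
    have hj := Finset.mem_range.1 hj
    have hjM : j ≤ M := by omega
    simp only [hf]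
    rw [weight_reflect hq0 hq1 hc hd hMN ha h hac had hjM, node_reflect hq0 hq1 ha hjM]
    -- By a²q^M = 1, the velocity of the node μ_j at a is (q^j - q^{M-j})/2.
    have e : ∀ j ≤ M, q ^ j / (a * q ^ j) ^ 2 = q ^ (M - j) := by
      intro j hj
      have hqj := pow_ne_zero j hq0
      have haM : a ^ 2 * q ^ M = 1 := by
        rw [ha, zpow_neg, zpow_natCast, inv_mul_cancel₀ (pow_ne_zero _ hq0)]
      rw [div_eq_iff (by simp [h.1, hq0])]
      calc q ^ j = q ^ j * (a ^ 2 * q ^ (M - j + j)) := by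
            rw [Nat.sub_add_cancel hj, haM, mul_one]
        _ = _ := by rw [pow_add]; ring
    rw [e j hjM, e (M - j) (by omega), Nat.sub_sub_self hjM]
    ring
  · split_ifs with hM
    · simp only [hf]
      rw [weight_half_eq_zero hq0 ha (Nat.two_mul_div_two_of_even hM)]
      ring
    · rfl
  · refine Finset.sum_congr rfl fun j _ => ?_
    simp only [hf]
    rw [weight_eq_zero hq0 ha (show M < M + 1 + j by omega)]
    ring

theorem tendsto_racahFunctional_div (hq0 : q ≠ 0) (hq1 : ‖q‖ < 1) (hc : c ≠ 0) (hd : d ≠ 0)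
    (hMN : M + 2 ≤ N) (ha : a ^ 2 = q ^ (-(M : ℤ))) (h : RegularAt q c d N a)
    (hac : a * c ∉ Omega q) (had : a * d ∉ Omega q) (p : ℂ[X]) :
    Tendsto (fun α => racahFunctional q c d N M α p / (α - a)) (𝓝[≠] a)
      (𝓝 (limitFunctional q a c d N M p)) := by
  have h1 := hasDerivAt_iff_tendsto_slope.1
    (hasDerivAt_racahFunctional hq0 hq1 hc hd hMN ha h hac had p)
  refine h1.congr fun α => ?_
  rw [slope_def_field, racahFunctional_eq_zero hq0 hq1 hc hd hMN ha h hac had, sub_zero]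

/-- The functional `L₀` as a linear map. -/
def limitHom (q a c d : ℂ) (N M : ℕ) : ℂ[X] →ₗ[ℂ] ℂ where
  toFun := limitFunctional q a c d N M
  map_add' f g := by
    simp only [limitFunctional, eval_add, derivative_add, mul_add, Finset.sum_add_distrib]
    split_ifs <;> ring
  map_smul' r f := by
    simp only [limitFunctional, eval_smul, derivative_smul, smul_eq_mul, RingHom.id_apply,
      mul_add, Finset.mul_sum]
    congr 1
    · congr 1
      · exact Finset.sum_congr rfl fun _ _ => by ring
      · exact Finset.sum_congr rfl fun _ _ => by ring
    · split_ifs <;> ring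

/-- The functional `L₀^α` as a linear map. -/
def racahHom (q c d : ℂ) (N M : ℕ) (α : ℂ) : ℂ[X] →ₗ[ℂ] ℂ where
  toFun := racahFunctional q c d N M α
  map_add' f g := by
    simp only [racahFunctional, eval_add, mul_add, Finset.sum_add_distrib]
  map_smul' r f := by
    simp only [racahFunctional, eval_smul, smul_eq_mul, RingHom.id_apply, Finset.mul_sum]
    exact Finset.sum_congr rfl fun _ _ => by ring

/-- Coefficientwise convergence of polynomials. -/
def CoeffTendsto (P : ℂ → ℂ[X]) (l : Filter ℂ) (Q : ℂ[X]) : Prop :=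
  ∀ i, Tendsto (fun α => (P α).coeff i) l (𝓝 (Q.coeff i))

theorem CoeffTendsto.mul {P P' : ℂ → ℂ[X]} {l : Filter ℂ} {Q Q' : ℂ[X]} (h : CoeffTendsto P l Q)
    (h' : CoeffTendsto P' l Q') : CoeffTendsto (fun α => P α * P' α) l (Q * Q') := by
  intro i
  simp only [coeff_mul]
  exact tendsto_finsetSum _ fun x _ => (h _).mul (h' _)

theorem CoeffTendsto.add {P P' : ℂ → ℂ[X]} {l : Filter ℂ} {Q Q' : ℂ[X]} (h : CoeffTendsto P l Q)
    (h' : CoeffTendsto P' l Q') : CoeffTendsto (fun α => P α + P' α) l (Q + Q') := by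
  intro i
  simp only [coeff_add]
  exact (h _).add (h' _)

theorem CoeffTendsto.sub {P P' : ℂ → ℂ[X]} {l : Filter ℂ} {Q Q' : ℂ[X]} (h : CoeffTendsto P l Q)
    (h' : CoeffTendsto P' l Q') : CoeffTendsto (fun α => P α - P' α) l (Q - Q') := by
  intro i
  simp only [coeff_sub]
  exact (h _).sub (h' _)

theorem coeffTendsto_const (Q : ℂ[X]) (l : Filter ℂ) : CoeffTendsto (fun _ => Q) l Q :=
  fun _ => tendsto_const_nhds

theorem coeffTendsto_C {f : ℂ → ℂ} {l : Filter ℂ} {x : ℂ} (h : Tendsto f l (𝓝 x)) :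
    CoeffTendsto (fun α => C (f α)) l (C x) := by
  intro i
  simp only [coeff_C]
  split_ifs
  · exact h
  · exact tendsto_const_nhds

theorem coeffTendsto_awBasis {f : ℂ → ℂ} {l : Filter ℂ} {x : ℂ} (h : Tendsto f l (𝓝 x)) (q : ℂ)
    (k : ℕ) : CoeffTendsto (fun α => awBasis q (f α) k) l (awBasis q x k) := by
  induction k with
  | zero => simp only [awBasis_zero]; exact coeffTendsto_const _ _
  | succ k ih =>
    simp only [awBasis_succ]
    refine ih.mul (((coeffTendsto_const _ _).sub (CoeffTendsto.mul (coeffTendsto_C ?_)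
      (coeffTendsto_const _ _))).add (coeffTendsto_C ?_))
    · exact (h.const_mul 2).mul_const _
    · exact (h.pow 2).mul_const _

/-- In the Pearson equation both the functional and the polynomial depend on α. A uniform degree
bound reduces the limit to finitely many monomials. -/
theorem CoeffTendsto.apply {P : ℂ → ℂ[X]} {l : Filter ℂ} {Q : ℂ[X]} (h : CoeffTendsto P l Q)
    {D : ℕ} (hP : ∀ α, (P α).natDegree < D) (hQ : Q.natDegree < D)
    {L : ℂ → ℂ[X] →ₗ[ℂ] ℂ} {L' : ℂ[X] →ₗ[ℂ] ℂ} (hL : ∀ p, Tendsto (fun α => L α p) l (𝓝 (L' p))) :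
    Tendsto (fun α => L α (P α)) l (𝓝 (L' Q)) := by
  have e : ∀ (L : ℂ[X] →ₗ[ℂ] ℂ) (p : ℂ[X]), p.natDegree < D →
      L p = ∑ i ∈ Finset.range D, p.coeff i * L (X ^ i) := by
    intro L p hp
    conv_lhs => rw [as_sum_range' p D hp]
    rw [map_sum]
    refine Finset.sum_congr rfl fun i _ => ?_
    rw [← C_mul_X_pow_eq_monomial, map_C_mul]
  rw [e L' Q hQ]
  simp only [fun α => e (L α) (P α) (hP α)]
  exact tendsto_finsetSum _ fun i _ => (h i).mul (hL _)

theorem eventually_regularAt (h : RegularAt q c d N a) : ∀ᶠ α in 𝓝 a, RegularAt q c d N α := by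
  refine (eventually_ne_nhds h.1).and ?_
  have h1 : ∀ᶠ α in 𝓝 a, ∀ i ∈ Finset.range N, α ^ 2 * q ^ N * q ^ i ≠ 1 ∧
    (i + 1 < N → α * c⁻¹ * q * q ^ i ≠ 1 ∧ α * d⁻¹ * q * q ^ i ≠ 1) := by
    rw [Filter.eventually_all_finset]
    intro i hi
    obtain ⟨h2, h3⟩ := h.2 i (Finset.mem_range.1 hi)
    refine Filter.Eventually.and ?_ ?_
    · exact ContinuousAt.eventually_ne (by fun_prop) h2
    · by_cases hi : i + 1 < N
      · have h4 : ∀ᶠ α in 𝓝 a, α * c⁻¹ * q * q ^ i ≠ 1 ∧ α * d⁻¹ * q * q ^ i ≠ 1 :=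
          (ContinuousAt.eventually_ne (g := fun α => α * c⁻¹ * q * q ^ i) (by fun_prop)
            (h3 hi).1).and (ContinuousAt.eventually_ne (g := fun α => α * d⁻¹ * q * q ^ i)
              (by fun_prop) (h3 hi).2)
        exact h4.mono fun _ hx _ => hx
      · exact Eventually.of_forall fun _ hx => absurd hx hi
  exact h1.mono fun α hα i hi => hα i (Finset.mem_range.2 hi)

theorem natDegree_pearsonFactor_le (a b c d : ℂ) : (pearsonFactor a b c d).natDegree ≤ 1 := by
  unfold pearsonFactor
  compute_degree

/-- The equation holds for L₀^α/(α-a) at all regular α near a, with second parameter q^{1-N}/α → b;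
the limit of zeros is zero. -/
theorem isAWFunctional_limitHom (hq0 : q ≠ 0) (hq1 : ‖q‖ < 1) (hc : c ≠ 0) (hd : d ≠ 0)
    (hMN : M + 2 ≤ N) (ha : a ^ 2 = q ^ (-(M : ℤ))) (h : RegularAt q c d N a)
    (hac : a * c ∉ Omega q) (had : a * d ∉ Omega q) {b : ℂ} (hab : a * b = q ^ (1 - (N : ℤ))) :
    IsAWFunctional q a b c d (limitHom q a c d N M) := by
  intro k m
  have hb : q ^ (1 - (N : ℤ)) / a = b := by rw [← hab]; field_simp [h.1]
  set f : ℂ → ℂ := fun α => q ^ (1 - (N : ℤ)) / α with hf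
  have hfa : Tendsto f (𝓝[≠] a) (𝓝 b) := by
    rw [← hb]
    refine Tendsto.mono_left ?_ nhdsWithin_le_nhds
    exact tendsto_const_nhds.div tendsto_id h.1
  have hid : Tendsto (fun α : ℂ => α) (𝓝[≠] a) (𝓝 a) := nhdsWithin_le_nhds
  have hdeg : ∀ a b a' b' : ℂ, (awBasis q a k * awBasis q b m
      * pearsonFactor a' b' c d).natDegree < k + m + 2 := by
    intro a b a' b'
    have h1 := natDegree_mul_le (p := awBasis q a k * awBasis q b m) (q := pearsonFactor a' b' c d)
    have h2 := natDegree_mul_le (p := awBasis q a k) (q := awBasis q b m)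
    have h3 := natDegree_awBasis_le q a k
    have h4 := natDegree_awBasis_le q b m
    have h5 := natDegree_pearsonFactor_le a' b' c d
    omega
  have hP : CoeffTendsto (fun α => awBasis q α k * awBasis q (f α) m
      * pearsonFactor (α * q ^ k) (f α * q ^ m) c d) (𝓝[≠] a)
      (awBasis q a k * awBasis q b m * pearsonFactor (a * q ^ k) (b * q ^ m) c d) := by
    refine ((coeffTendsto_awBasis hid q k).mul (coeffTendsto_awBasis hfa q m)).mul ?_
    have h1 := hid.mul_const (q ^ k)
    have h2 := hfa.mul_const (q ^ m)
    have hcc : Tendsto (fun _ : ℂ => c) (𝓝[≠] a) (𝓝 c) := tendsto_const_nhds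
    have hdd : Tendsto (fun _ : ℂ => d) (𝓝[≠] a) (𝓝 d) := tendsto_const_nhds
    refine ((coeffTendsto_C ?_).mul (coeffTendsto_const _ _)).sub (coeffTendsto_C ?_)
    · exact ((((h1.mul h2).mul hcc).mul hdd).const_sub 1).const_mul 2
    · exact ((((h1.add h2).add hcc).add hdd).sub (((((h1.mul h2).mul hcc).add
        ((h1.mul h2).mul hdd)).add ((h1.mul hcc).mul hdd)).add ((h2.mul hcc).mul hdd)))
  have hT := hP.apply (fun α => hdeg _ _ _ _) (hdeg _ _ _ _)
    (L := fun α => (α - a)⁻¹ • racahHom q c d N M α) (L' := limitHom q a c d N M) (fun p => by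
      refine (tendsto_racahFunctional_div hq0 hq1 hc hd hMN ha h hac had p).congr fun α => ?_
      rw [div_eq_inv_mul]; rfl)
  refine tendsto_nhds_unique hT (Tendsto.congr' ?_ tendsto_const_nhds)
  filter_upwards [nhdsWithin_le_nhds (eventually_regularAt h)] with α hα
  have := racah_pearson hq0 hq1 hc hd hα (show N ≠ 0 by omega) M k m
  change 0 = (α - a)⁻¹ * racahFunctional q c d N M α _
  rw [this, mul_zero]

/-- Since M < N-1, the symbol (α²;q)_{N-1} contains 1 - α²q^M exactly once, and no other factor
vanishes at a. The zero is simple, and the derivative is that of this factor times the nonzero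
cofactor g(a). -/
theorem deriv_weight_last_ne_zero (hq0 : q ≠ 0) (hq1 : ‖q‖ < 1) (hc : c ≠ 0) (hd : d ≠ 0)
    (hMN : M + 2 ≤ N) (ha : a ^ 2 = q ^ (-(M : ℤ))) (h : RegularAt q c d N a)
    (hac : a * c ∉ Omega q) (had : a * d ∉ Omega q) :
    deriv (weight q c d N M (N - 1)) a ≠ 0 := by
  set w := weight q c d N M (N - 1)
  set g : ℂ → ℂ := fun α => (qPoch (q ^ (1 - (N : ℤ))) q (N - 1) * qPoch (α * c) q (N - 1)
      * qPoch (α * d) q (N - 1) * ∏ i ∈ (Finset.range (N - 1)).erase M, (1 - α ^ 2 * q ^ i))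
    / (qPoch q q (N - 1) * qPoch (α ^ 2 * q ^ N) q (N - 1) * qPoch (α * c⁻¹ * q) q (N - 1)
        * qPoch (α * d⁻¹ * q) q (N - 1))
    * ((1 - α ^ 2 * q ^ (2 * (N - 1)))
      / ((c * d * q ^ (-(N : ℤ))) ^ (N - 1) * (if M = 0 then 1 else 1 - α ^ 2))) with hg
  have hw : w = fun α => (1 - α ^ 2 * q ^ M) * g α := by
    funext α
    simp only [w, weight, hg]
    have : qPoch (α ^ 2) q (N - 1) = (1 - α ^ 2 * q ^ M)
        * ∏ i ∈ (Finset.range (N - 1)).erase M, (1 - α ^ 2 * q ^ i) :=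
      (Finset.mul_prod_erase _ _ (Finset.mem_range.2 (by omega))).symm
    rw [this]
    ring
  obtain ⟨h1, h2, h3⟩ := h.qPoch_ne_zero (show N - 1 < N by omega)
  have h4 := qPoch_self_ne_zero hq1 (N - 1)
  have h5 : (c * d * q ^ (-(N : ℤ))) ^ (N - 1) ≠ 0 :=
    pow_ne_zero _ (mul_ne_zero (mul_ne_zero hc hd) (zpow_ne_zero _ hq0))
  have h6 : (if M = 0 then 1 else 1 - a ^ 2) ≠ 0 := by
    split_ifs with hM
    · exact one_ne_zero
    · exact one_sub_sq_ne_zero hq1 ha hM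
  have hz : ∀ (k : ℤ), k ≠ 0 → 1 - q ^ k ≠ 0 := fun k hk =>
    sub_ne_zero.2 fun h => hk ((zpow_eq_one_iff_of_norm_lt hq1).1 h.symm)
  have hga : g a ≠ 0 := by
    simp only [hg]
    refine mul_ne_zero (div_ne_zero (mul_ne_zero (mul_ne_zero (mul_ne_zero ?_ ?_) ?_) ?_)
      (mul_ne_zero (mul_ne_zero (mul_ne_zero h4 h1) h2) h3)) (div_ne_zero ?_ (mul_ne_zero h5 h6))
    · refine qPoch_ne_zero fun i hi hh => ?_
      rw [← zpow_natCast, ← zpow_add₀ hq0, zpow_eq_one_iff_of_norm_lt hq1] at hh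
      omega
    · exact qPoch_ne_zero_of_notMem' hac _
    · exact qPoch_ne_zero_of_notMem' had _
    · refine Finset.prod_ne_zero_iff.2 fun i hi => ?_
      rw [ha, ← zpow_natCast, ← zpow_add₀ hq0]
      have := (Finset.mem_erase.1 hi).1
      exact hz _ (by omega)
    · rw [ha, ← zpow_natCast, ← zpow_add₀ hq0]
      exact hz _ (by push_cast; omega)
  have d1 := fun f hf => (differentiable_qPoch (f := f) hf q (N - 1)).differentiableAt (x := a)
  have hgd : DifferentiableAt ℂ g a := by
    refine DifferentiableAt.mul (DifferentiableAt.div ?_ ?_ ?_) (DifferentiableAt.div ?_ ?_ ?_)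
    · refine (((d1 _ (by fun_prop)).mul (d1 _ (by fun_prop))).mul (d1 _ (by fun_prop))).mul ?_
      fun_prop
    · exact (((d1 _ (by fun_prop)).mul (d1 _ (by fun_prop))).mul (d1 _ (by fun_prop))).mul
        (d1 _ (by fun_prop))
    · exact mul_ne_zero (mul_ne_zero (mul_ne_zero h4 h1) h2) h3
    · fun_prop
    · by_cases hM : M = 0 <;> simp only [hM, if_true, if_false] <;> fun_prop
    · exact mul_ne_zero h5 h6
  have hu : HasDerivAt (fun α : ℂ => 1 - α ^ 2 * q ^ M) (-(2 * a * q ^ M)) a := by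
    have := ((hasDerivAt_pow 2 a).mul_const (q ^ M)).const_sub 1
    simpa using this
  have haM : a ^ 2 * q ^ M = 1 := by
    rw [ha, zpow_neg, zpow_natCast, inv_mul_cancel₀ (pow_ne_zero _ hq0)]
  rw [hw, (hu.fun_mul hgd.hasDerivAt).deriv, haM, sub_self, zero_mul, add_zero]
  exact mul_ne_zero (neg_ne_zero.2 (by simp [h.1, hq0])) hga

/-- If L₀(1) = 0 then L₀ = 0. The test polynomial (az,a/z;q)_{N-1} vanishes at all nodes but the
last, doubly at those with j < M/2, so only the derivative of the last weight survives. -/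
theorem limitHom_one_ne_zero (hq0 : q ≠ 0) (hq1 : ‖q‖ < 1) (hc : c ≠ 0) (hd : d ≠ 0)
    (hMN : M + 2 ≤ N) (ha : a ^ 2 = q ^ (-(M : ℤ))) (h : RegularAt q c d N a)
    (hac : a * c ∉ Omega q) (had : a * d ∉ Omega q) {b : ℂ} (hab : a * b = q ^ (1 - (N : ℤ)))
    (hB : a * b * c * d ∉ Omega q) : limitHom q a c d N M 1 ≠ 0 := by
  intro h1
  have hb : b ≠ 0 := by
    rintro rfl
    rw [mul_zero] at hab
    exact zpow_ne_zero _ hq0 hab.symm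
  have h2 := (isAWFunctional_limitHom hq0 hq1 hc hd hMN ha h hac had hab).eq_zero hq0 hb hB h1
    (awBasis q a (N - 1))
  have hprod := awBasis_eq_prod_node hq0 h.1 (N - 1)
  have hlead := coeff_awBasis_self_ne_zero hq0 h.1 (N - 1)
  have hev : ∀ j < N - 1, (awBasis q a (N - 1)).eval (node q j a) = 0 := by
    intro j hj
    rw [hprod, eval_mul, eval_prod, Finset.prod_eq_zero (Finset.mem_range.2 hj), mul_zero]
    simp
  -- Both indices j and M-j are below N-1, so the product contains the linear factor of this node
  -- twice.
  have hder : ∀ j, 2 * j < M → (awBasis q a (N - 1)).derivative.eval (node q j a) = 0 := by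
    intro j hj
    rw [hprod, ← Finset.mul_prod_erase _ _ (Finset.mem_range.2 (show j < N - 1 by omega)),
      ← Finset.mul_prod_erase _ _ (Finset.mem_erase.2 ⟨show M - j ≠ j by omega,
        Finset.mem_range.2 (show M - j < N - 1 by omega)⟩), node_reflect hq0 hq1 ha (by omega)]
    simp
  have hlast : (awBasis q a (N - 1)).eval (node q (N - 1) a) ≠ 0 := by
    rw [hprod, eval_mul, eval_C, eval_prod]
    refine mul_ne_zero hlead (Finset.prod_ne_zero_iff.2 fun i hi => ?_)
    have hi := Finset.mem_range.1 hi
    rw [eval_sub, eval_X, eval_C, sub_ne_zero, Ne, node_eq_node_iff hq0 hq1 ha]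
    omega
  change limitFunctional q a c d N M _ = 0 at h2
  rw [limitFunctional, Finset.sum_eq_zero, zero_add] at h2
  · rw [hev (M / 2) (by omega), mul_zero, ite_self, add_zero] at h2
    obtain ⟨n, rfl⟩ := Nat.exists_eq_succ_of_ne_zero (show N ≠ 0 by omega)
    rw [Nat.succ_eq_add_one, Nat.add_sub_cancel] at *
    rw [Finset.sum_Ico_succ_top (by omega), Finset.sum_eq_zero, zero_add] at h2
    · have := deriv_weight_last_ne_zero hq0 hq1 hc hd hMN ha h hac had
      rw [Nat.add_sub_cancel] at this
      exact mul_ne_zero this hlast h2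
    · intro j hj
      rw [hev j (Finset.mem_Ico.1 hj).2, mul_zero]
  · intro j hj
    have hj := Finset.mem_range.1 hj
    rw [hev j (by omega), hder j (by omega)]
    ring

end

/-! ### Integrals over closed curves -/

/-- `γ : [0,1] → ℂ` is a closed `C¹` curve. -/
def IsClosedCurve (γ : ℝ → ℂ) : Prop := ContDiffOn ℝ 1 γ (Set.Icc 0 1) ∧ γ 0 = γ 1

/-- `∫_γ f(z) dz`. -/
def curveIntegral (γ : ℝ → ℂ) (f : ℂ → ℂ) : ℂ := ∫ t in (0 : ℝ)..1, f (γ t) * deriv γ t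

theorem contourIntegral_eq_sum (Γ : List (ℝ → ℂ)) (f : ℂ → ℂ) :
    contourIntegral Γ f = (Γ.map fun γ => curveIntegral γ f).sum := rfl

theorem contourIntegral_nil (f : ℂ → ℂ) : contourIntegral [] f = 0 := rfl

theorem contourIntegral_cons (γ : ℝ → ℂ) (Γ : List (ℝ → ℂ)) (f : ℂ → ℂ) :
    contourIntegral (γ :: Γ) f = curveIntegral γ f + contourIntegral Γ f := by
  simp [contourIntegral_eq_sum]

theorem contourIntegral_append (Γ Γ' : List (ℝ → ℂ)) (f : ℂ → ℂ) :
    contourIntegral (Γ ++ Γ') f = contourIntegral Γ f + contourIntegral Γ' f := by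
  simp [contourIntegral_eq_sum]

section

variable {γ : ℝ → ℂ} {f g : ℂ → ℂ}

theorem IsClosedCurve.continuousOn (hγ : IsClosedCurve γ) : ContinuousOn γ (Set.Icc 0 1) :=
  hγ.1.continuousOn

theorem IsClosedCurve.continuousOn_derivWithin (hγ : IsClosedCurve γ) :
    ContinuousOn (derivWithin γ (Set.Icc 0 1)) (Set.Icc 0 1) :=
  hγ.1.continuousOn_derivWithin (uniqueDiffOn_Icc zero_lt_one) le_rfl

/-- At the endpoints the two-sided derivative may be the default value 0. The endpoints form a null
set, and the one-sided version is continuous on all of [0,1]. -/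
theorem curveIntegral_eq_derivWithin (γ : ℝ → ℂ) (f : ℂ → ℂ) :
    curveIntegral γ f = ∫ t in (0 : ℝ)..1, f (γ t) * derivWithin γ (Set.Icc 0 1) t :=
  intervalIntegral.integral_congr_Ioo_of_le zero_le_one fun t ht => by
    simp only [derivWithin_of_mem_nhds (Icc_mem_nhds ht.1 ht.2)]

theorem curveIntegral_congr (h : ∀ t ∈ Set.Icc (0 : ℝ) 1, f (γ t) = g (γ t)) :
    curveIntegral γ f = curveIntegral γ g :=
  intervalIntegral.integral_congr fun t ht => by
    rw [Set.uIcc_of_le zero_le_one] at ht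
    simp only [h t ht]

theorem contourIntegral_congr {Γ : List (ℝ → ℂ)}
    (h : ∀ γ ∈ Γ, ∀ t ∈ Set.Icc (0 : ℝ) 1, f (γ t) = g (γ t)) :
    contourIntegral Γ f = contourIntegral Γ g := by
  rw [contourIntegral_eq_sum, contourIntegral_eq_sum]
  congr 1
  exact List.map_congr_left fun γ hγ => curveIntegral_congr (h γ hγ)

theorem IsClosedCurve.intervalIntegrable (hγ : IsClosedCurve γ)
    (hf : ContinuousOn (fun t => f (γ t)) (Set.Icc 0 1)) :
    IntervalIntegrable (fun t => f (γ t) * derivWithin γ (Set.Icc 0 1) t)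
      MeasureTheory.volume 0 1 := by
  refine ContinuousOn.intervalIntegrable ?_
  rw [Set.uIcc_of_le zero_le_one]
  exact hf.mul hγ.continuousOn_derivWithin

theorem IsClosedCurve.curveIntegral_add (hγ : IsClosedCurve γ)
    (hf : ContinuousOn (fun t => f (γ t)) (Set.Icc 0 1))
    (hg : ContinuousOn (fun t => g (γ t)) (Set.Icc 0 1)) :
    curveIntegral γ (fun z => f z + g z) = curveIntegral γ f + curveIntegral γ g := by
  simp only [curveIntegral_eq_derivWithin, add_mul]
  exact intervalIntegral.integral_add (hγ.intervalIntegrable hf) (hγ.intervalIntegrable hg)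

theorem curveIntegral_const_mul (γ : ℝ → ℂ) (c : ℂ) (f : ℂ → ℂ) :
    curveIntegral γ (fun z => c * f z) = c * curveIntegral γ f := by
  simp only [curveIntegral, mul_assoc]
  exact intervalIntegral.integral_const_mul _ _

theorem contourIntegral_add {Γ : List (ℝ → ℂ)} (hΓ : ∀ γ ∈ Γ, IsClosedCurve γ)
    (hf : ∀ γ ∈ Γ, ContinuousOn (fun t => f (γ t)) (Set.Icc 0 1))
    (hg : ∀ γ ∈ Γ, ContinuousOn (fun t => g (γ t)) (Set.Icc 0 1)) :
    contourIntegral Γ (fun z => f z + g z) = contourIntegral Γ f + contourIntegral Γ g := by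
  induction Γ with
  | nil => simp [contourIntegral_nil]
  | cons γ Γ ih =>
    simp only [List.forall_mem_cons] at hΓ hf hg
    rw [contourIntegral_cons, contourIntegral_cons, contourIntegral_cons, ih hΓ.2 hf.2 hg.2,
      hΓ.1.curveIntegral_add hf.1 hg.1]
    ring

theorem contourIntegral_const_mul (Γ : List (ℝ → ℂ)) (c : ℂ) (f : ℂ → ℂ) :
    contourIntegral Γ (fun z => c * f z) = c * contourIntegral Γ f := by
  induction Γ with
  | nil => simp [contourIntegral_nil]
  | cons γ Γ ih =>
    rw [contourIntegral_cons, contourIntegral_cons, ih, curveIntegral_const_mul, mul_add]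

theorem IsClosedCurve.curveIntegral_eq_zero_of_hasDerivAt (hγ : IsClosedCurve γ) {F : ℂ → ℂ}
    (hF : ∀ t ∈ Set.Icc (0 : ℝ) 1, HasDerivAt F (f (γ t)) (γ t))
    (hf : ContinuousOn (fun t => f (γ t)) (Set.Icc 0 1)) : curveIntegral γ f = 0 := by
  rw [curveIntegral_eq_derivWithin, intervalIntegral.integral_eq_sub_of_hasDerivAt_of_le
    (f := fun t => F (γ t)) zero_le_one]
  · rw [hγ.2, sub_self]
  · exact ContinuousOn.comp (t := γ '' Set.Icc 0 1)
      (fun z hz => by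
        obtain ⟨t, ht, rfl⟩ := hz
        exact (hF t ht).continuousAt.continuousWithinAt) hγ.continuousOn
      (Set.mapsTo_image _ _)
  · intro t ht
    have h1 : HasDerivAt γ (derivWithin γ (Set.Icc 0 1) t) t := by
      have h2 := (hγ.1.differentiableOn one_ne_zero t (Set.Ioo_subset_Icc_self ht)).hasDerivWithinAt
      exact h2.hasDerivAt (Icc_mem_nhds ht.1 ht.2)
    exact HasDerivAt.comp t (hF t (Set.Ioo_subset_Icc_self ht)) h1
  · exact hγ.intervalIntegrable hf

end

/-! ### Integrals depending on a parameter -/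

/-- For a holomorphic kernel a bound on the kernel itself suffices: Cauchy's estimate on smaller
discs bounds the derivative, which dominates the difference quotients. -/
theorem hasDerivAt_integral_of_bounded {K : ℂ → ℝ → ℂ} {z₀ : ℂ} {r M : ℝ} (hr : 0 < r)
    (hK : ∀ z ∈ Metric.ball z₀ r, ContinuousOn (K z) (Set.Icc 0 1))
    (hd : ∀ t ∈ Set.Icc (0 : ℝ) 1, DifferentiableOn ℂ (fun z => K z t) (Metric.ball z₀ r))
    (hM : ∀ z ∈ Metric.ball z₀ r, ∀ t ∈ Set.Icc (0 : ℝ) 1, ‖K z t‖ ≤ M) :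
    HasDerivAt (fun z => ∫ t in (0 : ℝ)..1, K z t)
      (∫ t in (0 : ℝ)..1, deriv (fun z => K z t) z₀) z₀ := by
  have hsub : Set.uIoc (0 : ℝ) 1 ⊆ Set.Icc 0 1 := by
    rw [Set.uIoc_of_le zero_le_one]; exact Set.Ioc_subset_Icc_self
  have hmeas : ∀ z ∈ Metric.ball z₀ r, MeasureTheory.AEStronglyMeasurable (K z)
      (MeasureTheory.volume.restrict (Set.uIoc 0 1)) := fun z hz =>
    ((hK z hz).mono hsub).aestronglyMeasurable measurableSet_uIoc
  have hz₀ : z₀ ∈ Metric.ball z₀ r := Metric.mem_ball_self hr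
  have hdiff : ∀ t ∈ Set.Icc (0 : ℝ) 1, ∀ z ∈ Metric.ball z₀ r,
      HasDerivAt (fun z => K z t) (deriv (fun z => K z t) z) z := fun t ht z hz =>
    ((hd t ht).differentiableAt (Metric.isOpen_ball.mem_nhds hz)).hasDerivAt
  refine (intervalIntegral.hasDerivAt_integral_of_dominated_loc_of_deriv_le
    (F := K) (F' := fun z t => deriv (fun z => K z t) z) (s := Metric.ball z₀ (r / 2))
    (bound := fun _ => M / (r / 4)) (Metric.ball_mem_nhds _ (by linarith)) ?_ ?_ ?_ ?_ ?_ ?_).2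
  · filter_upwards [Metric.ball_mem_nhds z₀ hr] with z hz using hmeas z hz
  · refine ContinuousOn.intervalIntegrable ?_
    rw [Set.uIcc_of_le zero_le_one]
    exact hK z₀ hz₀
  -- The derivative is measurable in t as a pointwise limit of difference quotients along a sequence
  -- u n → 0 with z₀ + u n in the disc.
  · set u : ℕ → ℂ := fun n => ((r / 2 * (1 / ((n : ℝ) + 1)) : ℝ) : ℂ) with hu
    have hu0 : Tendsto u atTop (𝓝 0) := by
      have := (tendsto_one_div_add_atTop_nhds_zero_nat (𝕜 := ℝ)).const_mul (r / 2)
      rw [mul_zero] at this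
      exact (Complex.continuous_ofReal.tendsto' 0 0 Complex.ofReal_zero).comp this
    have hun : ∀ n, u n ≠ 0 := fun n => by
      simp only [hu]
      norm_cast
      positivity
    have hub : ∀ n, z₀ + u n ∈ Metric.ball z₀ r := fun n => by
      rw [Metric.mem_ball, dist_self_add_left, hu, Complex.norm_real, Real.norm_of_nonneg
        (by positivity)]
      have h1 : 1 / ((n : ℝ) + 1) ≤ 1 := by
        rw [div_le_one (by positivity)]
        have : (0 : ℝ) ≤ n := Nat.cast_nonneg n
        linarith
      nlinarith
    have hu' : Tendsto u atTop (𝓝[≠] 0) :=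
      tendsto_nhdsWithin_iff.2 ⟨hu0, Eventually.of_forall hun⟩
    refine aestronglyMeasurable_of_tendsto_ae atTop
      (f := fun n t => (u n)⁻¹ • (K (z₀ + u n) t - K z₀ t)) (fun n => ?_) ?_
    · exact ((hmeas _ (hub n)).sub (hmeas _ hz₀)).const_smul (u n)⁻¹
    · rw [MeasureTheory.ae_restrict_iff' measurableSet_uIoc]
      refine Eventually.of_forall fun t ht => ?_
      exact (hasDerivAt_iff_tendsto_slope_zero.1 (hdiff t (hsub ht) z₀ hz₀)).comp hu'
  · refine Eventually.of_forall fun t ht z hz => ?_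
    have hzb : Metric.closedBall z (r / 4) ⊆ Metric.ball z₀ r := by
      intro w hw
      rw [Metric.mem_closedBall] at hw
      rw [Metric.mem_ball] at hz ⊢
      linarith [dist_triangle w z z₀]
    refine Complex.norm_deriv_le_of_forall_mem_sphere_norm_le (by linarith)
      (DifferentiableOn.diffContOnCl_ball (hd t (hsub ht)) hzb) fun w hw =>
      hM w (hzb (Metric.sphere_subset_closedBall hw)) t (hsub ht)
  · exact intervalIntegrable_const
  · refine Eventually.of_forall fun t ht z hz => hdiff t (hsub ht) z ?_
    exact Metric.ball_subset_ball (by linarith) hz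

/-! ### Cauchy transforms and the inner integral of Dixon's proof -/

section

variable {γ : ℝ → ℂ} {f : ℂ → ℂ}

/-- The image of a curve. -/
def trace (γ : ℝ → ℂ) : Set ℂ := γ '' Set.Icc 0 1

theorem IsClosedCurve.isCompact_trace (hγ : IsClosedCurve γ) : IsCompact (trace γ) :=
  isCompact_Icc.image_of_continuousOn hγ.continuousOn

theorem IsClosedCurve.continuousOn_comp (hγ : IsClosedCurve γ) (hf : ContinuousOn f (trace γ)) :
    ContinuousOn (fun t => f (γ t)) (Set.Icc 0 1) :=
  hf.comp hγ.continuousOn (Set.mapsTo_image _ _)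

/-- The Cauchy transform `∫_γ f(w) / (w - z) dw` is holomorphic off the curve. -/
theorem IsClosedCurve.hasDerivAt_cauchyTransform (hγ : IsClosedCurve γ)
    (hf : ContinuousOn f (trace γ)) {z₀ : ℂ} (hz₀ : z₀ ∉ trace γ) :
    HasDerivAt (fun z => curveIntegral γ fun w => f w * (w - z)⁻¹)
      (curveIntegral γ fun w => f w * ((w - z₀)⁻¹) ^ 2) z₀ := by
  obtain ⟨r, hr, hball⟩ := Metric.isOpen_iff.1 hγ.isCompact_trace.isClosed.isOpen_compl z₀ hz₀
  have hdist : ∀ z ∈ Metric.ball z₀ (r / 2), ∀ t ∈ Set.Icc (0 : ℝ) 1, r / 2 ≤ ‖γ t - z‖ := by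
    intro z hz t ht
    by_contra! h
    rw [← dist_eq_norm] at h
    rw [Metric.mem_ball] at hz
    exact hball (show γ t ∈ Metric.ball z₀ r by
      rw [Metric.mem_ball]; linarith [dist_triangle (γ t) z z₀]) ⟨t, ht, rfl⟩
  have hne : ∀ z ∈ Metric.ball z₀ (r / 2), ∀ t ∈ Set.Icc (0 : ℝ) 1, γ t - z ≠ 0 :=
    fun z hz t ht => norm_pos_iff.1 ((by linarith : 0 < r / 2).trans_le (hdist z hz t ht))
  have hfc := hγ.continuousOn_comp hf
  obtain ⟨M, hM⟩ := isCompact_Icc.exists_bound_of_continuousOn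
    (hfc.mul hγ.continuousOn_derivWithin)
  have hM0 : 0 ≤ M := (norm_nonneg _).trans (hM 0 (by simp))
  have key := hasDerivAt_integral_of_bounded
    (K := fun z t => f (γ t) * (γ t - z)⁻¹ * derivWithin γ (Set.Icc 0 1) t) (z₀ := z₀)
    (r := r / 2) (M := M * (r / 2)⁻¹) (by linarith) (fun z hz =>
      (hfc.mul ((hγ.continuousOn.sub continuousOn_const).inv₀ (hne z hz))).mul
        hγ.continuousOn_derivWithin)
    (fun t ht => by
      have h1 : DifferentiableOn ℂ (fun z => (γ t - z)⁻¹) (Metric.ball z₀ (r / 2)) :=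
        ((differentiableOn_const _).sub differentiableOn_id).inv fun z hz => hne z hz t ht
      exact (h1.const_mul _).mul_const _)
    (fun z hz t ht => by
      rw [mul_right_comm, norm_mul, norm_inv]
      have := hdist z hz t ht
      gcongr
      exact hM t ht)
  simp only [curveIntegral_eq_derivWithin]
  convert key using 1
  refine intervalIntegral.integral_congr fun t ht => ?_
  rw [Set.uIcc_of_le zero_le_one] at ht
  have h1 : γ t - z₀ ≠ 0 := hne z₀ (Metric.mem_ball_self (by linarith)) t ht
  have h2 : HasDerivAt (fun z => (γ t - z)⁻¹) (((γ t - z₀)⁻¹) ^ 2) z₀ := by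
    have := ((hasDerivAt_id z₀).const_sub (γ t)).fun_inv h1
    simpa using this
  exact ((h2.const_mul _).mul_const _).deriv.symm

theorem IsClosedCurve.tendsto_cauchyTransform (hγ : IsClosedCurve γ)
    (hf : ContinuousOn f (trace γ)) :
    Tendsto (fun z => curveIntegral γ fun w => f w * (w - z)⁻¹) (cocompact ℂ) (𝓝 0) := by
  have hfc := hγ.continuousOn_comp hf
  obtain ⟨M, hM⟩ := isCompact_Icc.exists_bound_of_continuousOn
    (hfc.mul hγ.continuousOn_derivWithin)
  obtain ⟨R, hR⟩ := isCompact_Icc.exists_bound_of_continuousOn hγ.continuousOn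
  have hM0 : 0 ≤ M := (norm_nonneg _).trans (hM 0 (by simp))
  have h1 : Tendsto (fun z : ℂ => M * (‖z‖ - R)⁻¹) (cocompact ℂ) (𝓝 0) := by
    have h2 : Tendsto (fun z : ℂ => ‖z‖ - R) (cocompact ℂ) atTop :=
      tendsto_atTop_add_const_right _ _ (tendsto_norm_cocompact_atTop (E := ℂ))
    simpa using (tendsto_inv_atTop_zero.comp h2).const_mul M
  refine squeeze_zero_norm' ?_ h1
  filter_upwards [(tendsto_norm_cocompact_atTop (E := ℂ)).eventually_gt_atTop R] with z hz
  rw [curveIntegral_eq_derivWithin]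
  have h3 := intervalIntegral.norm_integral_le_of_norm_le_const (a := 0) (b := 1)
    (f := fun t => f (γ t) * (γ t - z)⁻¹ * derivWithin γ (Set.Icc 0 1) t)
    (C := M * (‖z‖ - R)⁻¹) (fun t ht => by
      rw [Set.uIoc_of_le zero_le_one] at ht
      have ht := Set.Ioc_subset_Icc_self ht
      rw [mul_right_comm, norm_mul, norm_inv]
      have h4 : ‖z‖ - R ≤ ‖γ t - z‖ := by
        have := norm_sub_norm_le z (γ t)
        rw [norm_sub_rev] at this
        linarith [hR t ht]
      have h5 : 0 < ‖z‖ - R := by linarith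
      gcongr
      exact hM t ht)
  simpa using h3

/-- If z lies outside a disc containing the curve, then 1/(w-z) is holomorphic in that disc and has
a primitive there. -/
theorem IsClosedCurve.eventually_curveIntegral_inv_eq_zero (hγ : IsClosedCurve γ) :
    ∀ᶠ z in cocompact ℂ, z ∉ trace γ ∧ curveIntegral γ (fun w => (w - z)⁻¹) = 0 := by
  obtain ⟨R, hR⟩ := isCompact_Icc.exists_bound_of_continuousOn hγ.continuousOn
  filter_upwards [(tendsto_norm_cocompact_atTop (E := ℂ)).eventually_gt_atTop (R + 1)] with z hz
  have hne : ∀ w ∈ Metric.ball (0 : ℂ) (R + 1), w - z ≠ 0 := by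
    intro w hw h
    rw [sub_eq_zero.1 h, mem_ball_zero_iff] at hw
    linarith
  have hmem : ∀ t ∈ Set.Icc (0 : ℝ) 1, γ t ∈ Metric.ball (0 : ℂ) (R + 1) := fun t ht => by
    rw [mem_ball_zero_iff]; linarith [hR t ht]
  have hd : DifferentiableOn ℂ (fun w => (w - z)⁻¹) (Metric.ball 0 (R + 1)) :=
    (differentiableOn_id.sub (differentiableOn_const _)).inv hne
  obtain ⟨F, hF⟩ := hd.isExactOn_ball
  refine ⟨?_, hγ.curveIntegral_eq_zero_of_hasDerivAt (fun t ht => hF _ (hmem t ht)) ?_⟩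
  · rintro ⟨t, ht, rfl⟩
    exact hne _ (hmem t ht) (sub_self _)
  · exact (hγ.continuousOn.sub continuousOn_const).inv₀ fun t ht => hne _ (hmem t ht)

/-- The point z₀ may lie on the curve. What is needed is a bound for the difference quotient
(f(w)-f(z))/(w-z), uniform for z near z₀ and w on the curve. -/
theorem IsClosedCurve.differentiableAt_curveIntegral_dslope (hγ : IsClosedCurve γ) {V : Set ℂ}
    (hV : IsOpen V) (hγV : trace γ ⊆ V) (hf : DifferentiableOn ℂ f V) {z₀ : ℂ} (hz₀ : z₀ ∈ V) :
    DifferentiableAt ℂ (fun z => curveIntegral γ (dslope f z)) z₀ := by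
  obtain ⟨ρ, hρ, hball⟩ := Metric.isOpen_iff.1 hV z₀ hz₀
  set r := ρ / 5 with hr
  have hcb : Metric.closedBall z₀ (4 * r) ⊆ V := fun w hw => hball (by
    rw [Metric.mem_closedBall] at hw; rw [Metric.mem_ball]; linarith)
  have hr0 : 0 < r := by positivity
  obtain ⟨M₁, hM₁⟩ := (isCompact_closedBall z₀ (4 * r)).exists_bound_of_continuousOn
    (hf.continuousOn.mono hcb)
  obtain ⟨M₂, hM₂⟩ := hγ.isCompact_trace.exists_bound_of_continuousOn (hf.continuousOn.mono hγV)
  obtain ⟨M₃, hM₃⟩ := isCompact_Icc.exists_bound_of_continuousOn hγ.continuousOn_derivWithin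
  have hM₁0 : 0 ≤ M₁ := (norm_nonneg _).trans (hM₁ z₀ (Metric.mem_closedBall_self (by linarith)))
  have hM₂0 : 0 ≤ M₂ := (norm_nonneg _).trans (hM₂ (γ 0) ⟨0, by simp, rfl⟩)
  have hderiv : ∀ w ∈ Metric.ball z₀ (2 * r), ‖deriv f w‖ ≤ M₁ / (2 * r) := by
    intro w hw
    have hsub : Metric.closedBall w (2 * r) ⊆ Metric.closedBall z₀ (4 * r) := by
      intro v hv
      rw [Metric.mem_closedBall] at hv ⊢
      rw [Metric.mem_ball] at hw
      linarith [dist_triangle v w z₀]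
    refine Complex.norm_deriv_le_of_forall_mem_sphere_norm_le (by linarith)
      (DifferentiableOn.diffContOnCl_ball hf (hsub.trans hcb)) fun v hv =>
      hM₁ v (hsub (Metric.sphere_subset_closedBall hv))
  -- For w close to z₀ the mean value inequality applies; otherwise |w-z| ≥ r and the bounds on f
  -- suffice.
  have hbound : ∀ z ∈ Metric.ball z₀ r, ∀ w ∈ trace γ,
      ‖dslope f z w‖ ≤ M₁ / (2 * r) + (M₁ + M₂) / r := by
    intro z hz w hw
    have hz2 : z ∈ Metric.ball z₀ (2 * r) := Metric.ball_subset_ball (by linarith) hz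
    have hp1 : 0 ≤ M₁ / (2 * r) := by positivity
    have hp2 : 0 ≤ (M₁ + M₂) / r := by positivity
    rcases eq_or_ne w z with rfl | hne
    · rw [dslope_same]
      linarith [hderiv w hz2]
    · rw [dslope_of_ne _ hne, slope_def_field, norm_div]
      have hpos : 0 < ‖w - z‖ := norm_pos_iff.2 (sub_ne_zero.2 hne)
      by_cases hw2 : w ∈ Metric.ball z₀ (2 * r)
      · have := Convex.norm_image_sub_le_of_norm_deriv_le (𝕜 := ℂ) (f := f)
          (fun x hx => (hf.differentiableAt (hV.mem_nhds (hcb (Metric.ball_subset_closedBall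
            (Metric.ball_subset_ball (by linarith) hx)))))) hderiv
          (convex_ball z₀ (2 * r)) hz2 hw2
        rw [div_le_iff₀ hpos]
        nlinarith
      · rw [Metric.mem_ball, not_lt] at hw2
        rw [Metric.mem_ball] at hz
        have h1 : r ≤ ‖w - z‖ := by
          rw [← dist_eq_norm]; linarith [dist_triangle w z z₀]
        have h2 : ‖f w - f z‖ ≤ M₁ + M₂ := by
          have := hM₁ z (Metric.mem_closedBall.2 (by linarith))
          linarith [norm_sub_le (f w) (f z), hM₂ w hw]
        have : ‖f w - f z‖ / ‖w - z‖ ≤ (M₁ + M₂) / r := by gcongr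
        linarith
  have hz₁ : ∀ z ∈ Metric.ball z₀ r, z ∈ V := fun z hz => hcb (Metric.ball_subset_closedBall
    (Metric.ball_subset_ball (by linarith) hz))
  have key := hasDerivAt_integral_of_bounded
    (K := fun z t => dslope f z (γ t) * derivWithin γ (Set.Icc 0 1) t) (z₀ := z₀)
    (r := r) (M := (M₁ / (2 * r) + (M₁ + M₂) / r) * M₃) hr0
    (fun z hz => by
      refine ContinuousOn.mul ?_ hγ.continuousOn_derivWithin
      refine hγ.continuousOn_comp (ContinuousOn.mono (s := V) ?_ hγV)
      rw [continuousOn_dslope (hV.mem_nhds (hz₁ z hz))]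
      exact ⟨hf.continuousOn, hf.differentiableAt (hV.mem_nhds (hz₁ z hz))⟩)
    (fun t ht => by
      refine DifferentiableOn.mul_const ?_ _
      have hw : γ t ∈ V := hγV ⟨t, ht, rfl⟩
      -- The difference quotient is symmetric in its two points, so it is holomorphic in the base
      -- point z as well.
      have h1 := (Complex.differentiableOn_dslope (f := f) (hV.mem_nhds hw)).2 hf
      refine (h1.mono hz₁).congr fun z hz => ?_
      rcases eq_or_ne (γ t) z with h | h
      · rw [h]
      · rw [dslope_of_ne _ h, dslope_of_ne _ h.symm, slope_comm])
    (fun z hz t ht => by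
      rw [norm_mul]
      gcongr
      · exact hbound z hz _ ⟨t, ht, rfl⟩
      · exact hM₃ t ht)
  simp only [curveIntegral_eq_derivWithin]
  exact key.differentiableAt

end

/-! ### Cauchy's theorem -/

section

variable {Γ : List (ℝ → ℂ)} {f : ℂ → ℂ}

theorem hasDerivAt_contourIntegral {K K' : ℂ → ℂ → ℂ} {z₀ : ℂ}
    (h : ∀ γ ∈ Γ, HasDerivAt (fun z => curveIntegral γ (K z)) (curveIntegral γ (K' z₀)) z₀) :
    HasDerivAt (fun z => contourIntegral Γ (K z)) (contourIntegral Γ (K' z₀)) z₀ := by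
  induction Γ with
  | nil => exact hasDerivAt_const _ _
  | cons γ Γ ih =>
    simp only [List.forall_mem_cons] at h
    simp only [contourIntegral_cons]
    exact h.1.add (ih h.2)

theorem differentiableAt_contourIntegral {K : ℂ → ℂ → ℂ} {z₀ : ℂ}
    (h : ∀ γ ∈ Γ, DifferentiableAt ℂ (fun z => curveIntegral γ (K z)) z₀) :
    DifferentiableAt ℂ (fun z => contourIntegral Γ (K z)) z₀ := by
  induction Γ with
  | nil => exact differentiableAt_const _
  | cons γ Γ ih =>
    simp only [List.forall_mem_cons] at h
    simp only [contourIntegral_cons]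
    exact h.1.add (ih h.2)

theorem tendsto_contourIntegral_zero {K : ℂ → ℂ → ℂ} {l : Filter ℂ}
    (h : ∀ γ ∈ Γ, Tendsto (fun z => curveIntegral γ (K z)) l (𝓝 0)) :
    Tendsto (fun z => contourIntegral Γ (K z)) l (𝓝 0) := by
  induction Γ with
  | nil => exact tendsto_const_nhds
  | cons γ Γ ih =>
    simp only [List.forall_mem_cons] at h
    simp only [contourIntegral_cons]
    simpa using h.1.add (ih h.2)

theorem contourIntegral_eq_zero_of_forall (h : ∀ γ ∈ Γ, curveIntegral γ f = 0) :
    contourIntegral Γ f = 0 := by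
  rw [contourIntegral_eq_sum]
  exact List.sum_eq_zero fun x hx => by
    obtain ⟨γ, hγ, rfl⟩ := List.mem_map.1 hx
    exact h γ hγ

/-- The union of the images of the curves. -/
def traces (Γ : List (ℝ → ℂ)) : Set ℂ := ⋃ γ ∈ {γ | γ ∈ Γ}, trace γ

theorem trace_subset_traces {γ : ℝ → ℂ} (hγ : γ ∈ Γ) : trace γ ⊆ traces Γ :=
  Set.subset_biUnion_of_mem (u := trace) (show γ ∈ {γ | γ ∈ Γ} from hγ)

theorem traces_subset_iff {S : Set ℂ} : traces Γ ⊆ S ↔ ∀ γ ∈ Γ, trace γ ⊆ S := by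
  simp [traces]

theorem isCompact_traces (hΓ : ∀ γ ∈ Γ, IsClosedCurve γ) : IsCompact (traces Γ) :=
  Γ.finite_toSet.isCompact_biUnion fun γ hγ => (hΓ γ hγ).isCompact_trace

/-- `∫_Γ (w - z)⁻¹ dw` is locally constant. -/
theorem contourIntegral_inv_eq_of_mem_ball (hΓ : ∀ γ ∈ Γ, IsClosedCurve γ) {z₀ z : ℂ} {r : ℝ}
    (hr : Metric.ball z₀ r ⊆ (traces Γ)ᶜ) (hz : z ∈ Metric.ball z₀ r) :
    contourIntegral Γ (fun w => (w - z)⁻¹) = contourIntegral Γ (fun w => (w - z₀)⁻¹) := by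
  have hderiv : ∀ z ∈ Metric.ball z₀ r,
      HasDerivAt (fun z => contourIntegral Γ fun w => (w - z)⁻¹) 0 z := by
    intro z hz
    have hne : ∀ γ ∈ Γ, ∀ t ∈ Set.Icc (0 : ℝ) 1, γ t - z ≠ 0 := fun γ hγ t ht h =>
      hr hz (trace_subset_traces hγ ⟨t, ht, sub_eq_zero.1 h⟩)
    have h1 : ∀ γ ∈ Γ, HasDerivAt (fun z => curveIntegral γ fun w => (w - z)⁻¹)
        (curveIntegral γ fun w => ((w - z)⁻¹) ^ 2) z := by
      intro γ hγ
      have := (hΓ γ hγ).hasDerivAt_cauchyTransform (f := fun _ => 1) continuousOn_const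
        (fun h => hr hz (trace_subset_traces hγ h))
      simpa using this
    have h2 := hasDerivAt_contourIntegral (K := fun z w => (w - z)⁻¹)
      (K' := fun z w => ((w - z)⁻¹) ^ 2) h1
    rwa [contourIntegral_eq_zero_of_forall] at h2
    intro γ hγ
    refine (hΓ γ hγ).curveIntegral_eq_zero_of_hasDerivAt (F := fun w => -(w - z)⁻¹) ?_ ?_
    · intro t ht
      have := (((hasDerivAt_id (γ t)).sub_const z).fun_inv (hne γ hγ t ht)).neg
      refine this.congr_deriv ?_
      simp [neg_div, inv_pow]
    · exact (((hΓ γ hγ).continuousOn.sub continuousOn_const).inv₀ (hne γ hγ)).pow 2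
  have h0 : z₀ ∈ Metric.ball z₀ r := Metric.mem_ball_self (dist_nonneg.trans_lt hz)
  exact IsOpen.is_const_of_deriv_eq_zero (f := fun z => contourIntegral Γ fun w => (w - z)⁻¹)
    Metric.isOpen_ball (convex_ball z₀ r).isPreconnected
    (fun x hx => (hderiv x hx).differentiableAt.differentiableWithinAt)
    (fun x hx => (hderiv x hx).deriv) hz h0

theorem contourIntegral_dslope (hΓ : ∀ γ ∈ Γ, IsClosedCurve γ) (hf : ContinuousOn f (traces Γ))
    {z : ℂ} (hz : z ∉ traces Γ) (hw : contourIntegral Γ (fun w => (w - z)⁻¹) = 0) :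
    contourIntegral Γ (dslope f z) = contourIntegral Γ (fun w => f w * (w - z)⁻¹) := by
  have hne : ∀ γ ∈ Γ, ∀ t ∈ Set.Icc (0 : ℝ) 1, γ t - z ≠ 0 := fun γ hγ t ht h =>
    hz (trace_subset_traces hγ ⟨t, ht, sub_eq_zero.1 h⟩)
  have hinv : ∀ γ ∈ Γ, ContinuousOn (fun t => (γ t - z)⁻¹) (Set.Icc 0 1) := fun γ hγ =>
    ((hΓ γ hγ).continuousOn.sub continuousOn_const).inv₀ (hne γ hγ)
  have h1 : contourIntegral Γ (dslope f z)
      = contourIntegral Γ (fun w => f w * (w - z)⁻¹ + (-f z) * (w - z)⁻¹) := by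
    refine contourIntegral_congr fun γ hγ t ht => ?_
    rw [dslope_of_ne _ (sub_ne_zero.1 (hne γ hγ t ht)), slope_def_field]
    ring
  rw [h1, contourIntegral_add hΓ, contourIntegral_const_mul, hw, mul_zero, add_zero]
  · exact fun γ hγ => ((hΓ γ hγ).continuousOn_comp (hf.mono (trace_subset_traces hγ))).mul
      (hinv γ hγ)
  · exact fun γ hγ => continuousOn_const.mul (hinv γ hγ)

/-- Cauchy's theorem in its homology version, by Dixon's proof. -/
theorem contourIntegral_eq_zero {V : Set ℂ} (hV : IsOpen V) (hΓ : ∀ γ ∈ Γ, IsClosedCurve γ)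
    (hΓV : traces Γ ⊆ V) (hw : ∀ z ∉ V, contourIntegral Γ (fun w => (w - z)⁻¹) = 0)
    (hf : DifferentiableOn ℂ f V) : contourIntegral Γ f = 0 := by
  classical
  have hfc : ContinuousOn f (traces Γ) := hf.continuousOn.mono hΓV
  have hcl := (isCompact_traces hΓ).isClosed
  -- The two formulas agree off the curves wherever the winding number is 0, in particular near each
  -- point outside V. Hence h is entire; it tends to 0 at infinity and vanishes by Liouville's
  -- theorem.
  set h : ℂ → ℂ := fun z => if z ∈ V then contourIntegral Γ (dslope f z)
    else contourIntegral Γ (fun w => f w * (w - z)⁻¹) with hh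
  have hcauchy : ∀ z, z ∉ traces Γ → contourIntegral Γ (fun w => (w - z)⁻¹) = 0 →
      h z = contourIntegral Γ (fun w => f w * (w - z)⁻¹) := by
    intro z hz hz'
    simp only [hh]
    split_ifs
    · exact contourIntegral_dslope hΓ hfc hz hz'
    · rfl
  have hdiff : Differentiable ℂ h := by
    intro z₀
    by_cases hz₀ : z₀ ∈ V
    · have h1 : DifferentiableAt ℂ (fun z => contourIntegral Γ (dslope f z)) z₀ :=
        differentiableAt_contourIntegral fun γ hγ =>
          (hΓ γ hγ).differentiableAt_curveIntegral_dslope hV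
            ((trace_subset_traces hγ).trans hΓV) hf hz₀
      refine h1.congr_of_eventuallyEq ?_
      filter_upwards [hV.mem_nhds hz₀] with z hz
      simp only [hh, if_pos hz]
    · have hz₀' : z₀ ∉ traces Γ := fun h => hz₀ (hΓV h)
      obtain ⟨r, hr, hball⟩ := Metric.isOpen_iff.1 hcl.isOpen_compl z₀ hz₀'
      have h1 : DifferentiableAt ℂ (fun z => contourIntegral Γ fun w => f w * (w - z)⁻¹) z₀ :=
        differentiableAt_contourIntegral fun γ hγ =>
          ((hΓ γ hγ).hasDerivAt_cauchyTransform (hfc.mono (trace_subset_traces hγ))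
            (fun h => hz₀' (trace_subset_traces hγ h))).differentiableAt
      refine h1.congr_of_eventuallyEq ?_
      filter_upwards [Metric.ball_mem_nhds z₀ hr] with z hz
      refine hcauchy z (hball hz) ?_
      rw [contourIntegral_inv_eq_of_mem_ball hΓ hball hz, hw z₀ hz₀]
  have hlarge : ∀ᶠ z in cocompact ℂ, h z = contourIntegral Γ (fun w => f w * (w - z)⁻¹)
      ∧ z ∉ traces Γ := by
    have h1 : ∀ᶠ z in cocompact ℂ, ∀ γ ∈ {γ | γ ∈ Γ},
        z ∉ trace γ ∧ curveIntegral γ (fun w => (w - z)⁻¹) = 0 :=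
      (eventually_all_finite Γ.finite_toSet).2 fun γ hγ =>
        (hΓ γ hγ).eventually_curveIntegral_inv_eq_zero
    filter_upwards [h1] with z hz
    have h2 : z ∉ traces Γ := by
      simp only [traces, Set.mem_iUnion, not_exists]
      exact fun γ hγ => (hz γ hγ).1
    exact ⟨hcauchy z h2 (contourIntegral_eq_zero_of_forall fun γ hγ => (hz γ hγ).2), h2⟩
  have hlim : Tendsto h (cocompact ℂ) (𝓝 0) := by
    have h1 : Tendsto (fun z => contourIntegral Γ (fun w => f w * (w - z)⁻¹)) (cocompact ℂ) (𝓝 0) :=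
      tendsto_contourIntegral_zero fun γ hγ =>
        (hΓ γ hγ).tendsto_cauchyTransform (hfc.mono (trace_subset_traces hγ))
    exact h1.congr' (hlarge.mono fun z hz => hz.1.symm)
  have hzero : ∀ z, h z = 0 := fun z => hdiff.apply_eq_of_tendsto_cocompact z hlim
  -- From wf(w)/(w-z) = f(w) + z f(w)/(w-z) and the vanishing of the transform of f for large z, the
  -- integral of f equals the transform of wf(w), which tends to 0.
  have h2 : Tendsto (fun z => contourIntegral Γ (fun w => w * f w * (w - z)⁻¹)) (cocompact ℂ)
      (𝓝 0) := tendsto_contourIntegral_zero fun γ hγ =>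
    (hΓ γ hγ).tendsto_cauchyTransform (f := fun w => w * f w)
      (continuousOn_id.mul (hfc.mono (trace_subset_traces hγ)))
  refine tendsto_nhds_unique (Tendsto.congr' ?_ (tendsto_const_nhds (f := cocompact ℂ))) h2
  filter_upwards [hlarge] with z hz
  have h3 : contourIntegral Γ (fun w => f w * (w - z)⁻¹) = 0 := by rw [← hz.1, hzero z]
  have hne : ∀ γ ∈ Γ, ∀ t ∈ Set.Icc (0 : ℝ) 1, γ t - z ≠ 0 := fun γ hγ t ht h =>
    hz.2 (trace_subset_traces hγ ⟨t, ht, sub_eq_zero.1 h⟩)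
  have h4 : contourIntegral Γ (fun w => w * f w * (w - z)⁻¹)
      = contourIntegral Γ (fun w => f w + z * (f w * (w - z)⁻¹)) := by
    refine contourIntegral_congr fun γ hγ t ht => ?_
    have := hne γ hγ t ht
    field_simp
    ring
  rw [h4, contourIntegral_add hΓ, contourIntegral_const_mul, h3, mul_zero, add_zero]
  · exact fun γ hγ => (hΓ γ hγ).continuousOn_comp (hfc.mono (trace_subset_traces hγ))
  · exact fun γ hγ => continuousOn_const.mul
      (((hΓ γ hγ).continuousOn_comp (hfc.mono (trace_subset_traces hγ))).mul
        (((hΓ γ hγ).continuousOn.sub continuousOn_const).inv₀ (hne γ hγ)))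

end

/-! ### Comparison of two contours -/

/-- The curve traversed backwards. -/
def reverse (γ : ℝ → ℂ) : ℝ → ℂ := fun t => γ (1 - t)

theorem IsClosedCurve.reverse {γ : ℝ → ℂ} (hγ : IsClosedCurve γ) :
    IsClosedCurve (reverse γ) := by
  refine ⟨hγ.1.comp (contDiff_const.sub contDiff_id).contDiffOn fun t ht => ?_, ?_⟩
  · exact ⟨by linarith [ht.2], by linarith [ht.1]⟩
  · simp [AskeyWilson.reverse, hγ.2]

theorem trace_reverse (γ : ℝ → ℂ) : trace (reverse γ) = trace γ := by
  ext z
  constructor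
  · rintro ⟨t, ht, rfl⟩
    exact ⟨1 - t, ⟨by linarith [ht.2], by linarith [ht.1]⟩, rfl⟩
  · rintro ⟨t, ht, rfl⟩
    exact ⟨1 - t, ⟨by linarith [ht.2], by linarith [ht.1]⟩, by simp [reverse]⟩

theorem curveIntegral_reverse (γ : ℝ → ℂ) (f : ℂ → ℂ) :
    curveIntegral (reverse γ) f = -curveIntegral γ f := by
  have h := intervalIntegral.integral_comp_sub_left (a := 0) (b := 1)
    (fun t => f (γ t) * deriv γ t) 1
  rw [sub_self, sub_zero] at h
  rw [curveIntegral, curveIntegral, ← h, ← intervalIntegral.integral_neg]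
  refine intervalIntegral.integral_congr fun t _ => ?_
  have hd : deriv (reverse γ) t = -deriv γ (1 - t) := deriv_comp_const_sub ..
  rw [hd, reverse]
  ring

theorem contourIntegral_map_reverse (Γ : List (ℝ → ℂ)) (f : ℂ → ℂ) :
    contourIntegral (Γ.map reverse) f = -contourIntegral Γ f := by
  induction Γ with
  | nil => simp [contourIntegral_nil]
  | cons γ Γ ih =>
    rw [List.map_cons, contourIntegral_cons, contourIntegral_cons, ih, curveIntegral_reverse]
    ring

theorem contourIntegral_inv_eq_iff {Γ Γ' : List (ℝ → ℂ)} {w : ℂ} :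
    contourIntegral Γ (fun z => (z - w)⁻¹) = contourIntegral Γ' (fun z => (z - w)⁻¹)
      ↔ windingNumber Γ w = windingNumber Γ' w := by
  have : (2 * Real.pi * Complex.I : ℂ)⁻¹ ≠ 0 := inv_ne_zero Complex.two_pi_I_ne_zero
  rw [windingNumber, windingNumber, mul_right_inj' this]

theorem windingNumber_append (Γ Γ' : List (ℝ → ℂ)) (w : ℂ) :
    windingNumber (Γ ++ Γ') w = windingNumber Γ w + windingNumber Γ' w := by
  rw [windingNumber, windingNumber, windingNumber, contourIntegral_append, mul_add]

/-- `f` coincides with a function analytic at `z` in a punctured neighbourhood of `z`. -/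
def IsRemovableAt (f : ℂ → ℂ) (z : ℂ) : Prop := ∃ g, AnalyticAt ℂ g z ∧ f =ᶠ[𝓝[≠] z] g

theorem isOpen_isRemovableAt (f : ℂ → ℂ) : IsOpen {z | IsRemovableAt f z} := by
  rw [isOpen_iff_eventually]
  rintro z ⟨g, hg, hfg⟩
  rw [Filter.EventuallyEq, eventually_nhdsWithin_iff] at hfg
  filter_upwards [hg.eventually_analyticAt, hfg.eventually_nhds] with y hy1 hy2
  by_cases hyz : y = z
  · subst hyz
    exact ⟨g, hg, by rw [Filter.EventuallyEq, eventually_nhdsWithin_iff]; exact hfg⟩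
  · refine ⟨g, hy1, Filter.EventuallyEq.filter_mono ?_ nhdsWithin_le_nhds⟩
    filter_upwards [hy2, isOpen_ne.mem_nhds hyz] with x hx hx' using hx hx'

/-- Limits through punctured neighbourhoods replace the values of f at removable singularities,
where division by zero gives a default value. -/
theorem differentiableOn_limUnder (f : ℂ → ℂ) :
    DifferentiableOn ℂ (fun z => limUnder (𝓝[≠] z) f) {z | IsRemovableAt f z} := by
  rintro z ⟨g, hg, hfg⟩
  have hlim : ∀ y g, AnalyticAt ℂ g y → f =ᶠ[𝓝[≠] y] g → limUnder (𝓝[≠] y) f = g y := by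
    intro y g hg hfg
    refine Tendsto.limUnder_eq (Tendsto.congr' hfg.symm ?_)
    exact hg.continuousAt.tendsto.mono_left nhdsWithin_le_nhds
  refine (hg.differentiableAt.congr_of_eventuallyEq ?_).differentiableWithinAt
  have hfg' := hfg
  rw [Filter.EventuallyEq, eventually_nhdsWithin_iff] at hfg
  filter_upwards [hg.eventually_analyticAt, hfg.eventually_nhds] with y hy1 hy2
  by_cases hyz : y = z
  · subst hyz
    exact hlim y g hg hfg'
  · refine hlim y g hy1 (Filter.EventuallyEq.filter_mono ?_ nhdsWithin_le_nhds)
    filter_upwards [hy2, isOpen_ne.mem_nhds hyz] with x hx hx' using hx hx'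

/-- Two contours give the same integral of `f` if their winding numbers agree at all points
where `f` has no removable singularity. -/
theorem contourIntegral_eq_of_windingNumber_eq {Γ Γ' : List (ℝ → ℂ)} {f : ℂ → ℂ}
    (hΓ : ∀ γ ∈ Γ, IsClosedCurve γ) (hΓ' : ∀ γ ∈ Γ', IsClosedCurve γ)
    (hf : ∀ z ∈ traces Γ, AnalyticAt ℂ f z) (hf' : ∀ z ∈ traces Γ', AnalyticAt ℂ f z)
    (hw : ∀ z, windingNumber Γ z ≠ windingNumber Γ' z → IsRemovableAt f z) :
    contourIntegral Γ f = contourIntegral Γ' f := by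
  have hrem : ∀ z, AnalyticAt ℂ f z → IsRemovableAt f z := fun z hz => ⟨f, hz, EventuallyEq.rfl⟩
  have hval : ∀ z, AnalyticAt ℂ f z → limUnder (𝓝[≠] z) f = f z := fun z hz =>
    Tendsto.limUnder_eq (hz.continuousAt.tendsto.mono_left nhdsWithin_le_nhds)
  -- Cauchy's theorem is applied to the cycle Γ - Γ' in the open set of removable points; outside it
  -- the two winding numbers agree.
  have h := contourIntegral_eq_zero (Γ := Γ ++ Γ'.map reverse) (isOpen_isRemovableAt f)
    (fun γ hγ => by
      rcases List.mem_append.1 hγ with h | h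
      · exact hΓ γ h
      · obtain ⟨γ', hγ', rfl⟩ := List.mem_map.1 h
        exact (hΓ' γ' hγ').reverse)
    (traces_subset_iff.2 fun γ hγ z hz => by
      rcases List.mem_append.1 hγ with h | h
      · exact hrem z (hf z (trace_subset_traces h hz))
      · obtain ⟨γ', hγ', rfl⟩ := List.mem_map.1 h
        rw [trace_reverse] at hz
        exact hrem z (hf' z (trace_subset_traces hγ' hz)))
    (fun z hz => by
      rw [contourIntegral_append, contourIntegral_map_reverse, ← sub_eq_add_neg, sub_eq_zero,
        contourIntegral_inv_eq_iff]
      by_contra hne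
      exact hz (hw z hne))
    (differentiableOn_limUnder f)
  rw [contourIntegral_append, contourIntegral_map_reverse, ← sub_eq_add_neg, sub_eq_zero] at h
  rw [contourIntegral_congr (g := f), contourIntegral_congr (Γ := Γ') (g := f)] at h
  · exact h
  · exact fun γ hγ t ht => hval _ (hf' _ (trace_subset_traces hγ ⟨t, ht, rfl⟩))
  · exact fun γ hγ t ht => hval _ (hf _ (trace_subset_traces hγ ⟨t, ht, rfl⟩))

/-! ### Dilated contours -/

theorem IsClosedCurve.const_mul {γ : ℝ → ℂ} (hγ : IsClosedCurve γ) (u : ℂ) :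
    IsClosedCurve fun t => u * γ t :=
  ⟨contDiffOn_const.mul hγ.1, by simp only [hγ.2]⟩

theorem contourIntegral_map_mul (Γ : List (ℝ → ℂ)) (u : ℂ) (f : ℂ → ℂ) :
    contourIntegral (Γ.map fun γ t => u * γ t) f = contourIntegral Γ fun z => u * f (u * z) := by
  induction Γ with
  | nil => rfl
  | cons γ Γ ih =>
    rw [List.map_cons, contourIntegral_cons, contourIntegral_cons, ih]
    congr 1
    refine intervalIntegral.integral_congr fun t _ => ?_
    simp only
    rw [deriv_const_mul_field]
    ring

theorem windingNumber_map_mul (Γ : List (ℝ → ℂ)) {u : ℂ} (hu : u ≠ 0) (w : ℂ) :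
    windingNumber (Γ.map fun γ t => u * γ t) w = windingNumber Γ (w / u) := by
  rw [windingNumber, windingNumber, contourIntegral_map_mul]
  congr 2
  funext z
  rw [show u * z - w = u * (z - w / u) by field_simp, mul_inv]
  field_simp

theorem traces_map_mul (Γ : List (ℝ → ℂ)) (u : ℂ) {z : ℂ}
    (hz : z ∈ traces (Γ.map fun γ t => u * γ t)) : ∃ w ∈ traces Γ, z = u * w := by
  simp only [traces, Set.mem_iUnion] at hz
  obtain ⟨γ, hγ, t, ht, rfl⟩ := hz
  obtain ⟨γ, hγ', rfl⟩ := List.mem_map.1 hγ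
  exact ⟨γ t, trace_subset_traces hγ' ⟨t, ht, rfl⟩, rfl⟩

/-! ### The infinite product `(u;q)_∞` -/

/-- The infinite `q`-Pochhammer symbol `(u;q)_∞`. -/
def qProd (q u : ℂ) : ℂ := ∏' k : ℕ, (1 - u * q ^ k)

section qProd

variable {q : ℂ}

theorem summable_norm_mul_pow (hq1 : ‖q‖ < 1) (u : ℂ) : Summable fun k : ℕ => ‖-(u * q ^ k)‖ := by
  simpa using (summable_geometric_of_lt_one (norm_nonneg _) hq1).mul_left ‖u‖

theorem multipliable_one_sub_mul_pow (hq1 : ‖q‖ < 1) (u : ℂ) :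
    Multipliable fun k : ℕ => 1 - u * q ^ k := by
  simpa only [sub_eq_add_neg] using multipliable_one_add_of_summable (summable_norm_mul_pow hq1 u)

theorem qProd_eq_qPoch_mul (hq1 : ‖q‖ < 1) (u : ℂ) (n : ℕ) :
    qProd q u = qPoch u q n * qProd q (u * q ^ n) := by
  have h : (fun k : ℕ => 1 - u * q ^ (k + n)) = fun k => 1 - u * q ^ n * q ^ k := by
    funext k; ring
  have := Multipliable.prod_mul_tprod_nat_mul' (f := fun k : ℕ => 1 - u * q ^ k) (k := n)
    (by rw [h]; exact multipliable_one_sub_mul_pow hq1 _)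
  rw [qProd, ← this, h]
  rfl

theorem qProd_eq_mul (hq1 : ‖q‖ < 1) (u : ℂ) : qProd q u = (1 - u) * qProd q (q * u) := by
  simpa [qPoch, mul_comm u] using qProd_eq_qPoch_mul hq1 u 1

theorem qProd_eq_zero_iff (hq0 : q ≠ 0) (hq1 : ‖q‖ < 1) {u : ℂ} :
    qProd q u = 0 ↔ u ∈ Omega q := by
  constructor
  · intro h
    by_contra hu
    refine tprod_one_add_ne_zero_of_summable (f := fun k : ℕ => -(u * q ^ k)) (fun i hi => ?_)
      (summable_norm_mul_pow hq1 u) (by simpa only [qProd, sub_eq_add_neg] using h)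
    exact hu (mem_Omega_of_mul_pow (i := i) (by linear_combination -hi))
  · rintro ⟨k, rfl⟩
    rw [qProd_eq_qPoch_mul hq1 _ (k + 1), qPoch_succ]
    simp [hq0]

theorem tendsto_qPoch (hq1 : ‖q‖ < 1) (u : ℂ) :
    Tendsto (fun n => qPoch u q n) atTop (𝓝 (qProd q u)) :=
  (multipliable_one_sub_mul_pow hq1 u).tendsto_prod_tprod_nat

/-- A bound uniform in n, needed for dominated convergence of the finite products. -/
theorem norm_qPoch_le (hq1 : ‖q‖ < 1) (u : ℂ) (n : ℕ) :
    ‖qPoch u q n‖ ≤ Real.exp (‖u‖ * (1 - ‖q‖)⁻¹) := by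
  calc ‖qPoch u q n‖ ≤ ∏ i ∈ Finset.range n, ‖1 - u * q ^ i‖ := Finset.norm_prod_le _ _
    _ ≤ ∏ i ∈ Finset.range n, (1 + ‖u‖ * ‖q‖ ^ i) := by
        refine Finset.prod_le_prod (fun _ _ => norm_nonneg _) fun i _ => ?_
        simpa using norm_sub_le (1 : ℂ) (u * q ^ i)
    _ ≤ Real.exp (∑ i ∈ Finset.range n, ‖u‖ * ‖q‖ ^ i) :=
        Real.prod_one_add_le_exp_sum _ fun i => by positivity
    _ ≤ _ := by
        rw [Real.exp_le_exp, ← Finset.mul_sum]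
        refine mul_le_mul_of_nonneg_left ?_ (norm_nonneg _)
        exact (tsum_geometric_of_lt_one (norm_nonneg q) hq1) ▸
          (summable_geometric_of_lt_one (norm_nonneg q) hq1).sum_le_tsum _
            fun _ _ => by positivity

theorem differentiable_qProd (hq1 : ‖q‖ < 1) : Differentiable ℂ (qProd q) := by
  have h : HasProdLocallyUniformlyOn (fun (k : ℕ) u => 1 + -(u * q ^ k))
      (fun u => ∏' k : ℕ, (1 + -(u * q ^ k))) Set.univ := by
    refine hasProdLocallyUniformlyOn_of_forall_compact isOpen_univ fun K _ hK => ?_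
    obtain ⟨R, hR⟩ := hK.isBounded.exists_norm_le
    refine ((summable_geometric_of_lt_one (norm_nonneg _) hq1).mul_left
      R).hasProdUniformlyOn_nat_one_add hK (.of_forall fun n x hx => ?_) fun n => by fun_prop
    rw [norm_neg, norm_mul, norm_pow]
    exact mul_le_mul_of_nonneg_right (hR x hx) (by positivity)
  have h2 := h.differentiableOn (.of_forall fun s => by
    simpa [Finset.prod_fn] using DifferentiableOn.finsetProd (fun _ _ => by fun_prop)) isOpen_univ
  rw [differentiableOn_univ] at h2
  simp only [← sub_eq_add_neg] at h2
  exact h2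

/-- All zeros of (u;q)_∞ are simple. The cofactor is obtained by deleting one factor from the
product, so it is entire and nonzero at the zero. -/
theorem exists_qProd_eq_sub_mul (hq0 : q ≠ 0) (hq1 : ‖q‖ < 1) {u₀ : ℂ} (h : qProd q u₀ = 0) :
    ∃ e : ℂ → ℂ, Differentiable ℂ e ∧ e u₀ ≠ 0 ∧ ∀ u, qProd q u = (u - u₀) * e u := by
  obtain ⟨k, rfl⟩ := (qProd_eq_zero_iff hq0 hq1).1 h
  have hq := differentiable_qProd hq1
  refine ⟨fun u => -q ^ k * (qPoch u q k * qProd q (u * q ^ (k + 1))), ?_, ?_, fun u => ?_⟩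
  · have := differentiable_qPoch differentiable_id q k
    exact (this.mul (hq.comp (differentiable_id.mul_const _))).const_mul _
  · refine mul_ne_zero (neg_ne_zero.2 (pow_ne_zero _ hq0)) (mul_ne_zero ?_ ?_)
    · refine qPoch_ne_zero fun i hi h => ?_
      rw [← zpow_natCast, ← zpow_add₀ hq0, zpow_eq_one_iff_of_norm_lt hq1] at h
      omega
    · rw [pow_succ, ← mul_assoc, zpow_neg, zpow_natCast, inv_mul_cancel₀ (pow_ne_zero _ hq0), one_mul,
        Ne, qProd_eq_zero_iff hq0 hq1]
      rintro ⟨j, hj⟩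
      have : q ^ ((j : ℤ) + 1) = 1 := by
        rw [zpow_add_one₀ hq0]
        nth_rw 2 [hj]
        rw [← zpow_add₀ hq0]; simp
      rw [zpow_eq_one_iff_of_norm_lt hq1] at this
      omega
  · rw [qProd_eq_qPoch_mul hq1 _ (k + 1), qPoch_succ, zpow_neg, zpow_natCast]
    field_simp
    ring

theorem hProd_xOf (hq1 : ‖q‖ < 1) {z : ℂ} (hz : z ≠ 0) (α : ℂ) :
    hProd q (xOf z) α = qProd q (α * z) * qProd q (α / z) := by
  rw [qProd, qProd, ← (multipliable_one_sub_mul_pow hq1 _).tprod_mul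
    (multipliable_one_sub_mul_pow hq1 _), hProd]
  refine tprod_congr fun k => ?_
  rw [xOf]
  field_simp
  ring

end qProd

/-- `(z, -z, q^{1/2} z, -q^{1/2} z; q)_∞ = (z²;q)_∞`. -/
theorem qProd_sq {q s : ℂ} (hq1 : ‖q‖ < 1) (hs : s ^ 2 = q) (z : ℂ) :
    qProd q z * qProd q (-z) * qProd q (s * z) * qProd q (-(s * z)) = qProd q (z ^ 2) := by
  have hm := multipliable_one_sub_mul_pow hq1
  have hq2 : ‖q ^ 2‖ < 1 := by
    rw [norm_pow]
    exact pow_lt_one₀ (norm_nonneg _) hq1 two_ne_zero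
  have h2 (w : ℂ) : qProd q w * qProd q (-w) = ∏' k : ℕ, (1 - w ^ 2 * (q ^ 2) ^ k) := by
    rw [qProd, qProd, ← (hm _).tprod_mul (hm _)]
    refine tprod_congr fun k => ?_
    ring
  have he (k : ℕ) : 1 - z ^ 2 * q ^ (2 * k) = 1 - z ^ 2 * (q ^ 2) ^ k := by ring
  have ho (k : ℕ) : 1 - z ^ 2 * q ^ (2 * k + 1) = 1 - (s * z) ^ 2 * (q ^ 2) ^ k := by
    rw [← hs]; ring
  have h := tprod_even_mul_odd (f := fun k : ℕ => 1 - z ^ 2 * q ^ k)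
    (by simpa only [he] using multipliable_one_sub_mul_pow hq2 _)
    (by simpa only [ho] using multipliable_one_sub_mul_pow hq2 _)
  simp only [he, ho] at h
  rw [mul_assoc, h2, h2, h, qProd]

theorem awWeight_xOf {q s : ℂ} (hq1 : ‖q‖ < 1) (hs : s ^ 2 = q) (a b c d : ℂ) {z : ℂ}
    (hz : z ≠ 0) :
    awWeight q s a b c d (xOf z) = qProd q (z ^ 2) * qProd q (z⁻¹ ^ 2)
      / ∏ i, (qProd q (![a, b, c, d] i * z) * qProd q (![a, b, c, d] i * z⁻¹)) := by
  simp only [awWeight, hProd_xOf hq1 hz, ← qProd_sq hq1 hs, Fin.prod_univ_four, div_eq_mul_inv,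
    Matrix.cons_val, neg_mul, one_mul]
  ring

/-! ### The poles of the weight -/

section Poles

variable {q : ℂ} {v : Fin 4 → ℂ} {z : ℂ}

theorem mem_convPoles_iff : z ∈ convPoles q (v 0) (v 1) (v 2) (v 3) ↔ ∃ i, ∃ k : ℕ, z = v i * q ^ k := by
  simp [convPoles, Fin.exists_fin_succ]

theorem mem_divPoles_iff :
    z ∈ divPoles q (v 0) (v 1) (v 2) (v 3) ↔ ∃ i, ∃ k : ℕ, z = (v i * q ^ k)⁻¹ := by
  simp [divPoles, Fin.exists_fin_succ]

theorem qProd_mul_eq_zero_iff (hq0 : q ≠ 0) (hq1 : ‖q‖ < 1) {u : ℂ} (hu : u ≠ 0) :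
    qProd q (u * z) = 0 ↔ ∃ k : ℕ, z = (u * q ^ k)⁻¹ := by
  rw [qProd_eq_zero_iff hq0 hq1]
  refine exists_congr fun k => ?_
  rw [zpow_neg, zpow_natCast]
  field_simp

theorem qProd_mul_inv_eq_zero_iff (hq0 : q ≠ 0) (hq1 : ‖q‖ < 1) {u : ℂ} (hu : u ≠ 0) :
    qProd q (u * z⁻¹) = 0 ↔ ∃ k : ℕ, z = u * q ^ k := by
  rw [qProd_mul_eq_zero_iff hq0 hq1 hu]
  simp only [inv_inj]

/-- The denominator of the weight. -/
def symmDen (q : ℂ) (v : Fin 4 → ℂ) (z : ℂ) : ℂ :=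
  ∏ i, (qProd q (v i * z) * qProd q (v i * z⁻¹))

theorem symmDen_ne_zero (hq0 : q ≠ 0) (hq1 : ‖q‖ < 1) (hv : ∀ i, v i ≠ 0)
    (hz : z ∉ {0} ∪ convPoles q (v 0) (v 1) (v 2) (v 3) ∪ divPoles q (v 0) (v 1) (v 2) (v 3)) :
    symmDen q v z ≠ 0 := by
  simp only [Set.mem_union, Set.mem_singleton_iff, not_or, mem_convPoles_iff,
    mem_divPoles_iff] at hz
  refine Finset.prod_ne_zero_iff.2 fun i _ => mul_ne_zero ?_ ?_
  · rw [Ne, qProd_mul_eq_zero_iff hq0 hq1 (hv i)]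
    exact fun h => hz.2 ⟨i, h⟩
  · rw [Ne, qProd_mul_inv_eq_zero_iff hq0 hq1 (hv i)]
    exact fun h => hz.1.2 ⟨i, h⟩

end Poles

/-! ### The Pearson equation of the weight -/

section Pearson

variable {q : ℂ} {v : Fin 4 → ℂ} {z : ℂ}

/-- The algebraic core of the Pearson equation: the products ∏(1-v/z) and ∏(1-vz) arise from moving
z by q in the denominator of the weight. -/
theorem pearsonFactor_identity (a b c d : ℂ) (hz : z ≠ 0) :
    (1 - z ^ 2) * ((1 - a * z⁻¹) * (1 - b * z⁻¹) * (1 - c * z⁻¹) * (1 - d * z⁻¹))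
      + z⁻¹ ^ 2 * (1 - z⁻¹ ^ 2) * ((1 - a * z) * (1 - b * z) * (1 - c * z) * (1 - d * z))
      = z⁻¹ * (1 - z ^ 2) * (1 - z⁻¹ ^ 2) * (pearsonFactor a b c d).eval (xOf z) := by
  simp only [pearsonFactor, eval_sub, eval_mul, eval_C, eval_X, xOf]
  field_simp
  ring

/-- The denominator of the weight after half a shift. -/
def shiftDen (q : ℂ) (v : Fin 4 → ℂ) (z : ℂ) : ℂ :=
  ∏ i, (qProd q (v i * z) * qProd q (q * v i * z⁻¹))

/-- The function whose `q`-difference is the left side of the Pearson equation. -/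
def shiftKernel (q : ℂ) (v : Fin 4 → ℂ) (g : ℂ → ℂ) (z : ℂ) : ℂ :=
  qProd q (z ^ 2) * qProd q (q * z⁻¹ ^ 2) * g z / shiftDen q v z

/-- `(az, qa/z; q)_k (bz, qb/z; q)_m`. -/
def shiftBasis (q a b : ℂ) (k m : ℕ) (z : ℂ) : ℂ :=
  qPoch (a * z) q k * qPoch (q * a * z⁻¹) q k * (qPoch (b * z) q m * qPoch (q * b * z⁻¹) q m)

theorem qPoch_mul_one_sub (u q : ℂ) (n : ℕ) :
    qPoch (q * u) q n * (1 - u) = qPoch u q n * (1 - u * q ^ n) := by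
  rw [← qPoch_succ, qPoch_succ_left, mul_comm, mul_comm q]

/-- U, V and Q factor the three denominators as UVQ, UQ and VQ. Once the common infinite products
are cleared, only `pearsonFactor_identity` with first two parameters shifted to v₀q^k, v₁q^m
remains. -/
theorem shiftKernel_sub (hq0 : q ≠ 0) (hq1 : ‖q‖ < 1) (hz : z ≠ 0) (hden : symmDen q v z ≠ 0)
    (k m : ℕ) :
    shiftKernel q v (shiftBasis q (v 0) (v 1) k m) z
        - q * shiftKernel q v (shiftBasis q (v 0) (v 1) k m) (q * z)
      = (awBasis q (v 0) k * awBasis q (v 1) m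
          * pearsonFactor (v 0 * q ^ k) (v 1 * q ^ m) (v 2) (v 3)).eval (xOf z)
        * (z⁻¹ * (qProd q (z ^ 2) * qProd q (z⁻¹ ^ 2) / symmDen q v z)) := by
  set Q := ∏ i, (qProd q (q * (v i * z)) * qProd q (q * (v i * z⁻¹))) with hQ
  set U := ∏ i, (1 - v i * z) with hU
  set V := ∏ i, (1 - v i * z⁻¹) with hV
  have e1 : symmDen q v z = U * V * Q := by
    rw [hQ, hU, hV, ← Finset.prod_mul_distrib, ← Finset.prod_mul_distrib]
    refine Finset.prod_congr rfl fun i _ => ?_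
    rw [qProd_eq_mul hq1 (v i * z), qProd_eq_mul hq1 (v i * z⁻¹)]
    ring
  have e2 : shiftDen q v z = U * Q := by
    rw [hQ, hU, ← Finset.prod_mul_distrib]
    refine Finset.prod_congr rfl fun i _ => ?_
    rw [qProd_eq_mul hq1 (v i * z)]
    ring_nf
  have hqz (u : ℂ) : q * u * (q * z)⁻¹ = u * z⁻¹ := by field_simp
  have e3 : shiftDen q v (q * z) = V * Q := by
    rw [hQ, hV, ← Finset.prod_mul_distrib]
    refine Finset.prod_congr rfl fun i _ => ?_
    rw [hqz, qProd_eq_mul hq1 (v i * z⁻¹)]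
    ring_nf
  rw [e1] at hden
  have hUV : U ≠ 0 ∧ V ≠ 0 ∧ Q ≠ 0 := by
    refine ⟨?_, ?_, ?_⟩ <;> rintro h <;> simp [h] at hden
  set T₁ := qProd q ((q * z) ^ 2) with hT₁
  set T₂ := qProd q (q * z⁻¹ ^ 2) with hT₂
  have e4 : qProd q (z ^ 2) = (1 - z ^ 2) * (1 - q * z ^ 2) * T₁ := by
    rw [qProd_eq_mul hq1, qProd_eq_mul hq1 (q * z ^ 2), hT₁]
    ring_nf
  have e5 : qProd q (z⁻¹ ^ 2) = (1 - z⁻¹ ^ 2) * T₂ := qProd_eq_mul hq1 _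
  have e6 : q * qProd q (q * (q * z)⁻¹ ^ 2)
      = -(z⁻¹ ^ 2 * (1 - q * z ^ 2) * (1 - z⁻¹ ^ 2) * T₂) := by
    rw [qProd_eq_mul hq1, show q * (q * (q * z)⁻¹ ^ 2) = z⁻¹ ^ 2 by field_simp, e5]
    field_simp
    ring
  have g1 : shiftBasis q (v 0) (v 1) k m z * V
      = (awBasis q (v 0) k * awBasis q (v 1) m).eval (xOf z)
        * ((1 - v 0 * q ^ k * z⁻¹) * (1 - v 1 * q ^ m * z⁻¹) * (1 - v 2 * z⁻¹)
          * (1 - v 3 * z⁻¹)) := by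
    have h0 := qPoch_mul_one_sub (v 0 * z⁻¹) q k
    have h1 := qPoch_mul_one_sub (v 1 * z⁻¹) q m
    rw [← mul_assoc] at h0 h1
    rw [eval_mul, eval_awBasis _ _ _ hz, eval_awBasis _ _ _ hz, hV, Fin.prod_univ_four, shiftBasis,
      div_eq_mul_inv, div_eq_mul_inv]
    linear_combination (qPoch (v 0 * z) q k * qPoch (v 1 * z) q m * (1 - v 2 * z⁻¹)
      * (1 - v 3 * z⁻¹)) * (h0 * (qPoch (q * v 1 * z⁻¹) q m * (1 - v 1 * z⁻¹))
        + (qPoch (v 0 * z⁻¹) q k * (1 - v 0 * z⁻¹ * q ^ k)) * h1)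
  have g2 : shiftBasis q (v 0) (v 1) k m (q * z) * U
      = (awBasis q (v 0) k * awBasis q (v 1) m).eval (xOf z)
        * ((1 - v 0 * q ^ k * z) * (1 - v 1 * q ^ m * z) * (1 - v 2 * z) * (1 - v 3 * z)) := by
    have h0 := qPoch_mul_one_sub (v 0 * z) q k
    have h1 := qPoch_mul_one_sub (v 1 * z) q m
    rw [show q * (v 0 * z) = v 0 * (q * z) by ring] at h0
    rw [show q * (v 1 * z) = v 1 * (q * z) by ring] at h1
    rw [eval_mul, eval_awBasis _ _ _ hz, eval_awBasis _ _ _ hz, hU, Fin.prod_univ_four, shiftBasis,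
      div_eq_mul_inv, div_eq_mul_inv, hqz, hqz]
    linear_combination (qPoch (v 0 * z⁻¹) q k * qPoch (v 1 * z⁻¹) q m * (1 - v 2 * z)
      * (1 - v 3 * z)) * (h0 * (qPoch (v 1 * (q * z)) q m * (1 - v 1 * z))
        + (qPoch (v 0 * z) q k * (1 - v 0 * z * q ^ k)) * h1)
  have key := pearsonFactor_identity (v 0 * q ^ k) (v 1 * q ^ m) (v 2) (v 3) hz
  have h7 : q * shiftKernel q v (shiftBasis q (v 0) (v 1) k m) (q * z)
      = -(z⁻¹ ^ 2 * (1 - q * z ^ 2) * (1 - z⁻¹ ^ 2) * T₁ * T₂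
        * (shiftBasis q (v 0) (v 1) k m (q * z) * U)) / (U * V * Q) := by
    rw [shiftKernel, e3, eq_div_iff hden, ← hT₁]
    obtain ⟨-, hV0, hQ0⟩ := hUV
    have : q * (T₁ * qProd q (q * (q * z)⁻¹ ^ 2) * shiftBasis q (v 0) (v 1) k m (q * z) / (V * Q))
        * (U * V * Q)
        = T₁ * (q * qProd q (q * (q * z)⁻¹ ^ 2)) * shiftBasis q (v 0) (v 1) k m (q * z) * U := by
      field_simp
    rw [this, e6]
    ring
  have h8 : shiftKernel q v (shiftBasis q (v 0) (v 1) k m) z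
      = (1 - z ^ 2) * (1 - q * z ^ 2) * T₁ * T₂
        * (shiftBasis q (v 0) (v 1) k m z * V) / (U * V * Q) := by
    obtain ⟨hU0, hV0, hQ0⟩ := hUV
    rw [shiftKernel, e2, e4, ← hT₂]
    field_simp
  rw [h7, h8, g1, g2, ← sub_div, e4, e5, eval_mul (q := pearsonFactor _ _ _ _), e1,
    show ∀ x y w u : ℂ, x * (y * (w / u)) = x * y * w / u by intros; ring]
  congr 1
  linear_combination ((1 - q * z ^ 2) * T₁ * T₂
    * (awBasis q (v 0) k * awBasis q (v 1) m).eval (xOf z)) * key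

/-- A zero of the numerator cancels a simple zero of the denominator, which comes from a single
factor D j. -/
theorem isRemovableAt_div_prod {ι : Type*} [Fintype ι] [DecidableEq ι] {n e : ℂ → ℂ}
    {D : ι → ℂ → ℂ} {p : ℂ} (j : ι) (hn : AnalyticAt ℂ n p) (hn0 : n p = 0)
    (hD : ∀ i, AnalyticAt ℂ (D i) p) (hi : ∀ i ≠ j, D i p ≠ 0) (he : AnalyticAt ℂ e p)
    (he0 : e p ≠ 0) (hj : ∀ᶠ z in 𝓝 p, D j z = (z - p) * e z) :
    IsRemovableAt (fun z => n z / ∏ i, D i z) p := by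
  obtain ⟨P, hP⟩ := hn
  have hR : AnalyticAt ℂ (fun z => ∏ i ∈ Finset.univ.erase j, D i z) p :=
    Finset.analyticAt_fun_prod _ fun i _ => hD i
  refine ⟨fun z => dslope n p z / (e z * ∏ i ∈ Finset.univ.erase j, D i z),
    (hP.has_fpower_series_dslope_fslope.analyticAt).div (he.mul hR) (mul_ne_zero he0
      (Finset.prod_ne_zero_iff.2 fun i h => hi i (Finset.ne_of_mem_erase h))), ?_⟩
  rw [Filter.EventuallyEq, eventually_nhdsWithin_iff]
  filter_upwards [hj] with z hz hzp
  have hzp' : z - p ≠ 0 := sub_ne_zero.2 hzp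
  have h1 : n z = (z - p) * dslope n p z := by
    have := sub_smul_dslope n p z
    rw [hn0, sub_zero, smul_eq_mul] at this
    exact this.symm
  rw [← Finset.mul_prod_erase _ _ (Finset.mem_univ j), hz, h1, mul_assoc,
    mul_div_mul_left _ _ hzp']

theorem analyticAt_qProd_comp (hq1 : ‖q‖ < 1) {f : ℂ → ℂ} (hf : AnalyticAt ℂ f z) :
    AnalyticAt ℂ (fun z => qProd q (f z)) z :=
  AnalyticAt.fun_comp (g := qProd q) ((differentiable_qProd hq1).analyticAt _) hf

theorem analyticAt_const_mul_inv (u : ℂ) (hz : z ≠ 0) : AnalyticAt ℂ (fun z => u * z⁻¹) z :=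
  analyticAt_const.mul (analyticAt_inv hz)

theorem analyticAt_qPoch_comp (q : ℂ) (n : ℕ) {f : ℂ → ℂ} (hf : AnalyticAt ℂ f z) :
    AnalyticAt ℂ (fun z => qPoch (f z) q n) z :=
  AnalyticAt.fun_comp (g := fun u => qPoch u q n)
    ((differentiable_qPoch differentiable_id q n).analyticAt _) hf

theorem analyticAt_shiftBasis (q a b : ℂ) (k m : ℕ) (hz : z ≠ 0) :
    AnalyticAt ℂ (shiftBasis q a b k m) z := by
  have h1 (u : ℂ) (n : ℕ) : AnalyticAt ℂ (fun z => qPoch (u * z) q n) z :=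
    analyticAt_qPoch_comp q n (analyticAt_const.mul analyticAt_id)
  have h2 (u : ℂ) (n : ℕ) : AnalyticAt ℂ (fun z => qPoch (u * z⁻¹) q n) z :=
    analyticAt_qPoch_comp q n (analyticAt_const_mul_inv u hz)
  exact ((h1 a k).mul (h2 (q * a) k)).mul ((h1 b m).mul (h2 (q * b) m))

theorem analyticAt_shiftNum (hq1 : ‖q‖ < 1) {g : ℂ → ℂ} (hg : AnalyticAt ℂ g z) (hz : z ≠ 0) :
    AnalyticAt ℂ (fun z => qProd q (z ^ 2) * qProd q (q * z⁻¹ ^ 2) * g z) z :=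
  ((analyticAt_qProd_comp hq1 (analyticAt_id.pow 2)).mul (analyticAt_qProd_comp hq1
    (analyticAt_const.mul ((analyticAt_inv hz).pow 2)))).mul hg

theorem analyticAt_shiftFactor (hq1 : ‖q‖ < 1) (u w : ℂ) (hz : z ≠ 0) :
    AnalyticAt ℂ (fun z => qProd q (u * z) * qProd q (w * z⁻¹)) z :=
  (analyticAt_qProd_comp hq1 (analyticAt_const.mul analyticAt_id)).mul
    (analyticAt_qProd_comp hq1 (analyticAt_const_mul_inv w hz))

theorem analyticAt_shiftKernel (hq1 : ‖q‖ < 1) {g : ℂ → ℂ} (hg : AnalyticAt ℂ g z) (hz : z ≠ 0)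
    (hden : shiftDen q v z ≠ 0) : AnalyticAt ℂ (shiftKernel q v g) z := by
  refine (analyticAt_shiftNum hq1 hg hz).div ?_ hden
  exact Finset.analyticAt_fun_prod _ fun i _ =>
    analyticAt_shiftFactor hq1 _ _ hz

end Pearson

section Separates

variable {q : ℂ} {v : Fin 4 → ℂ} {z : ℂ} {Γ₁ Γ₂ : List (ℝ → ℂ)}

theorem Separates.windingNumber_conv (h : Separates q (v 0) (v 1) (v 2) (v 3) Γ₁ Γ₂)
    (hz : z ∈ convPoles q (v 0) (v 1) (v 2) (v 3) \ divPoles q (v 0) (v 1) (v 2) (v 3)) :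
    windingNumber (Γ₁ ++ Γ₂) z = 2 := by
  rw [windingNumber_append, h.conv₁ z hz, h.conv₂ z hz.1]
  norm_num

theorem Separates.windingNumber_inter (h : Separates q (v 0) (v 1) (v 2) (v 3) Γ₁ Γ₂)
    (hc : z ∈ convPoles q (v 0) (v 1) (v 2) (v 3)) (hd : z ∈ divPoles q (v 0) (v 1) (v 2) (v 3)) :
    windingNumber (Γ₁ ++ Γ₂) z = 1 := by
  rw [windingNumber_append, h.div₁ z hd, h.conv₂ z hc, zero_add]

theorem Separates.windingNumber_div (h : Separates q (v 0) (v 1) (v 2) (v 3) Γ₁ Γ₂)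
    (hz : z ∈ divPoles q (v 0) (v 1) (v 2) (v 3) \ convPoles q (v 0) (v 1) (v 2) (v 3)) :
    windingNumber (Γ₁ ++ Γ₂) z = 0 := by
  rw [windingNumber_append, h.div₁ z hz.1, h.div₂ z hz, zero_add]

theorem Separates.isClosedCurve (h : Separates q (v 0) (v 1) (v 2) (v 3) Γ₁ Γ₂) :
    ∀ γ ∈ Γ₁ ++ Γ₂, IsClosedCurve γ := by
  intro γ hγ
  rcases List.mem_append.1 hγ with hγ | hγ
  · exact ⟨(h.avoid₁ γ hγ).1, (h.avoid₁ γ hγ).2.1⟩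
  · exact ⟨(h.avoid₂ γ hγ).1, (h.avoid₂ γ hγ).2.1⟩

theorem Separates.notMem_of_mem_traces (h : Separates q (v 0) (v 1) (v 2) (v 3) Γ₁ Γ₂)
    (hz : z ∈ traces (Γ₁ ++ Γ₂)) :
    z ∉ {0} ∪ convPoles q (v 0) (v 1) (v 2) (v 3) ∪ divPoles q (v 0) (v 1) (v 2) (v 3) := by
  simp only [traces, Set.mem_iUnion] at hz
  obtain ⟨γ, hγ, t, ht, rfl⟩ := hz
  rcases List.mem_append.1 hγ with hγ | hγ
  · exact (h.avoid₁ γ hγ).2.2 t ht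
  · exact (h.avoid₂ γ hγ).2.2 t ht

theorem mul_mem_convPoles (hz : z ∈ convPoles q (v 0) (v 1) (v 2) (v 3)) :
    q * z ∈ convPoles q (v 0) (v 1) (v 2) (v 3) := by
  obtain ⟨i, k, rfl⟩ := mem_convPoles_iff.1 hz
  exact mem_convPoles_iff.2 ⟨i, k + 1, by ring⟩

theorem div_mem_divPoles (hz : z ∈ divPoles q (v 0) (v 1) (v 2) (v 3)) :
    z / q ∈ divPoles q (v 0) (v 1) (v 2) (v 3) := by
  obtain ⟨i, k, rfl⟩ := mem_divPoles_iff.1 hz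
  exact mem_divPoles_iff.2 ⟨i, k + 1, by rw [pow_succ, ← mul_assoc, mul_inv _ q, div_eq_mul_inv]⟩

/-- A pole that is both `v i q^k` and `(v j q^l)⁻¹` has `i = j`, if the mixed products of the
parameters are not in `Ω(q)`. -/
theorem eq_of_mul_pow_eq_inv (hprod : ∀ i j, i ≠ j → v i * v j ∉ Omega q) {i j : Fin 4} {k l : ℕ}
    (hj : v j * q ^ l ≠ 0) (h : v i * q ^ k = (v j * q ^ l)⁻¹) : i = j := by
  by_contra hij
  refine hprod i j hij (mem_Omega_of_mul_pow (i := k + l) ?_)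
  rw [← mul_eq_one_iff_eq_inv₀ hj] at h
  rw [← h]
  ring

/-- The winding number of qΓ about z is that of Γ about z/q. The denominator of the kernel vanishes
at the divergent poles and at q times the convergent ones. About a pole the combined winding number
is 2, 1 or 0, according to whether the pole is only convergent, both, or only divergent; so it can
change from z/q to z only at an end of a chain in Z. There a factor of the numerator vanishes. -/
theorem isRemovableAt_shiftKernel (hq0 : q ≠ 0) (hq1 : ‖q‖ < 1) (hv : ∀ i, v i ≠ 0)
    (hprod : ∀ i j, i ≠ j → v i * v j ∉ Omega q)
    (h : Separates q (v 0) (v 1) (v 2) (v 3) Γ₁ Γ₂) {g : ℂ → ℂ}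
    (hg : z ≠ 0 → AnalyticAt ℂ g z)
    (hw : windingNumber (Γ₁ ++ Γ₂) z ≠ windingNumber (Γ₁ ++ Γ₂) (z / q)) :
    IsRemovableAt (shiftKernel q v g) z := by
  have hz : z ≠ 0 := by
    rintro rfl
    simp at hw
  specialize hg hz
  have hvk (i : Fin 4) (k : ℕ) : v i * q ^ k ≠ 0 := mul_ne_zero (hv i) (pow_ne_zero _ hq0)
  by_cases hd : z ∈ divPoles q (v 0) (v 1) (v 2) (v 3)
  · have hdq := div_mem_divPoles hd
    by_cases hcq : z / q ∈ convPoles q (v 0) (v 1) (v 2) (v 3)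
    · have hc := mul_mem_convPoles hcq
      rw [mul_div_cancel₀ z hq0] at hc
      rw [h.windingNumber_inter hc hd, h.windingNumber_inter hcq hdq] at hw
      exact absurd rfl hw
    rw [h.windingNumber_div ⟨hdq, hcq⟩] at hw
    have hc : z ∈ convPoles q (v 0) (v 1) (v 2) (v 3) := by
      by_contra hc
      exact hw (h.windingNumber_div ⟨hd, hc⟩)
    have hcq' : ∀ i, ∀ k : ℕ, z ≠ q * v i * q ^ k := by
      intro i k hik
      refine hcq (mem_convPoles_iff.2 ⟨i, k, ?_⟩)
      rw [hik]
      field_simp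
    obtain ⟨i, k, hik⟩ := mem_convPoles_iff.1 hc
    obtain ⟨j, l, hjl⟩ := mem_divPoles_iff.1 hd
    -- Since z/q is not convergent, z is the first point v i of a chain of convergent poles.
    obtain rfl : k = 0 := by
      rcases k with _ | k
      · rfl
      · exact absurd (by rw [hik]; ring) (hcq' i k)
    obtain rfl := eq_of_mul_pow_eq_inv hprod (hvk j l) (hik.symm.trans hjl)
    have h0 : qProd q (v i * z) = 0 := (qProd_mul_eq_zero_iff hq0 hq1 (hv i)).2 ⟨l, hjl⟩
    have hne (m : Fin 4) : qProd q (q * v m * z⁻¹) ≠ 0 := by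
      rw [Ne, qProd_mul_inv_eq_zero_iff hq0 hq1 (mul_ne_zero hq0 (hv m))]
      exact fun ⟨k, hk⟩ => hcq' m k hk
    obtain ⟨e, he, he0, hE⟩ := exists_qProd_eq_sub_mul hq0 hq1 h0
    refine isRemovableAt_div_prod (e := fun y => v i * e (v i * y) * qProd q (q * v i * y⁻¹)) i
      (analyticAt_shiftNum hq1 hg hz) ?_ (fun m => analyticAt_shiftFactor hq1 _ _ hz) ?_ ?_ ?_ ?_
    -- Here z = v i and z = (v i q^l)^{-1} give z² = q^{-l}.
    · have : qProd q (z ^ 2) = 0 := by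
        rw [qProd_eq_zero_iff hq0 hq1]
        refine mem_Omega_of_mul_pow (i := l) ?_
        rw [← mul_eq_one_iff_eq_inv₀ (hvk i l)] at hjl
        rw [← hjl, sq, mul_assoc]
        nth_rw 2 [hik]
        ring
      rw [this]; ring
    · intro m hm
      refine mul_ne_zero ?_ (hne m)
      rw [Ne, qProd_mul_eq_zero_iff hq0 hq1 (hv m)]
      rintro ⟨k, hk⟩
      exact hm (eq_of_mul_pow_eq_inv hprod (hvk m k) (hik.symm.trans hk)).symm
    · exact (analyticAt_const.mul (AnalyticAt.fun_comp (g := e) (he.analyticAt _)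
        (analyticAt_const.mul analyticAt_id))).mul
        (analyticAt_qProd_comp hq1 (analyticAt_const_mul_inv _ hz))
    · exact mul_ne_zero (mul_ne_zero (hv i) he0) (hne i)
    · refine .of_forall fun y => ?_
      rw [hE]
      ring
  · have hne (m : Fin 4) : qProd q (v m * z) ≠ 0 := by
      rw [Ne, qProd_mul_eq_zero_iff hq0 hq1 (hv m)]
      exact fun ⟨k, hk⟩ => hd (mem_divPoles_iff.2 ⟨m, k, hk⟩)
    by_cases hex : ∃ i, ∃ k : ℕ, z = q * v i * q ^ k
    · obtain ⟨i, k, hik⟩ := hex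
      have hzq : z / q = v i * q ^ k := by rw [hik]; field_simp
      have hcq : z / q ∈ convPoles q (v 0) (v 1) (v 2) (v 3) := mem_convPoles_iff.2 ⟨i, k, hzq⟩
      have hc := mul_mem_convPoles hcq
      rw [mul_div_cancel₀ z hq0] at hc
      rw [h.windingNumber_conv ⟨hc, hd⟩] at hw
      have hdq : z / q ∈ divPoles q (v 0) (v 1) (v 2) (v 3) := by
        by_contra hdq
        exact hw (h.windingNumber_conv ⟨hcq, hdq⟩).symm
      obtain ⟨j, l, hjl⟩ := mem_divPoles_iff.1 hdq
      -- Otherwise z itself would be divergent. Hence z/q = 1/v i, the last point of its chain in Z.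
      obtain rfl : l = 0 := by
        rcases l with _ | l
        · rfl
        · refine absurd (mem_divPoles_iff.2 ⟨j, l, ?_⟩) hd
          rw [div_eq_iff hq0] at hjl
          rw [hjl, pow_succ]
          have := hv j
          field_simp
      have hij := eq_of_mul_pow_eq_inv hprod (hvk j 0) (hzq.symm.trans hjl)
      subst hij
      have h0 : qProd q (q * v i * z⁻¹) = 0 :=
        (qProd_mul_inv_eq_zero_iff hq0 hq1 (mul_ne_zero hq0 (hv i))).2 ⟨k, hik⟩
      obtain ⟨e, he, he0, hE⟩ := exists_qProd_eq_sub_mul hq0 hq1 h0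
      refine isRemovableAt_div_prod
        (e := fun y => qProd q (v i * y) * (-(q * v i * z⁻¹) * y⁻¹ * e (q * v i * y⁻¹))) i
        (analyticAt_shiftNum hq1 hg hz) ?_ (fun m => analyticAt_shiftFactor hq1 _ _ hz) ?_ ?_ ?_ ?_
      -- Here z/q = v i q^k = 1/v i gives z² = q^{k+2}, so q/z² = q^{-(k+1)}.
      · have : qProd q (q * z⁻¹ ^ 2) = 0 := by
          rw [qProd_eq_zero_iff hq0 hq1]
          refine mem_Omega_of_mul_pow (i := k + 1) ?_
          rw [← mul_eq_one_iff_eq_inv₀ (hvk i 0)] at hjl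
          have h3 : z * z = q * q ^ (k + 1) := by
            calc z * z = z * v i * q ^ (k + 1) := by nth_rw 2 [hik]; ring
              _ = q * (z / q * (v i * q ^ 0)) * q ^ (k + 1) := by field_simp
              _ = _ := by rw [hjl]; ring
          field_simp
          rw [← h3]
          ring
        rw [this]; ring
      · intro m hm
        refine mul_ne_zero (hne m) ?_
        rw [Ne, qProd_mul_inv_eq_zero_iff hq0 hq1 (mul_ne_zero hq0 (hv m))]
        rintro ⟨l, hl⟩
        have hzm : z / q = v m * q ^ l := by rw [hl]; field_simp
        exact hm (eq_of_mul_pow_eq_inv hprod (hvk i 0) (hzm.symm.trans hjl))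
      · exact (analyticAt_qProd_comp hq1 (analyticAt_const.mul analyticAt_id)).mul
          ((analyticAt_const_mul_inv _ hz).mul (AnalyticAt.fun_comp (g := e) (he.analyticAt _)
            (analyticAt_const_mul_inv _ hz)))
      · refine mul_ne_zero (hne i) (mul_ne_zero (mul_ne_zero (neg_ne_zero.2 (mul_ne_zero
          (mul_ne_zero hq0 (hv i)) (inv_ne_zero hz))) (inv_ne_zero hz)) he0)
      · filter_upwards [isOpen_ne.mem_nhds hz] with y hy
        have hy : y ≠ 0 := hy
        rw [hE (q * v i * y⁻¹)]
        field_simp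
        ring
    · refine ⟨_, analyticAt_shiftKernel hq1 hg hz ?_, EventuallyEq.rfl⟩
      refine Finset.prod_ne_zero_iff.2 fun m _ => mul_ne_zero (hne m) ?_
      rw [Ne, qProd_mul_inv_eq_zero_iff hq0 hq1 (mul_ne_zero hq0 (hv m))]
      exact fun ⟨k, hk⟩ => hex ⟨m, k, hk⟩

/-- The right side is the integral over the dilated contour qΓ, and the two contours are compared by
winding numbers. The kernel is analytic on both, since its poles and their images under division by
q are poles of the weight. -/
theorem Separates.contourIntegral_shiftKernel_sub (hq0 : q ≠ 0) (hq1 : ‖q‖ < 1) (hv : ∀ i, v i ≠ 0)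
    (hprod : ∀ i j, i ≠ j → v i * v j ∉ Omega q)
    (h : Separates q (v 0) (v 1) (v 2) (v 3) Γ₁ Γ₂) {g : ℂ → ℂ}
    (hg : ∀ z, z ≠ 0 → AnalyticAt ℂ g z) :
    contourIntegral (Γ₁ ++ Γ₂) (shiftKernel q v g)
      = contourIntegral (Γ₁ ++ Γ₂) fun z => q * shiftKernel q v g (q * z) := by
  have hana : ∀ z ≠ 0, (∀ i, qProd q (v i * z) ≠ 0 ∧ qProd q (q * v i * z⁻¹) ≠ 0) →
      AnalyticAt ℂ (shiftKernel q v g) z := fun z hz hi =>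
    analyticAt_shiftKernel hq1 (hg z hz) hz
      (Finset.prod_ne_zero_iff.2 fun m _ => mul_ne_zero (hi m).1 (hi m).2)
  have hqv (i : Fin 4) : q * v i ≠ 0 := mul_ne_zero hq0 (hv i)
  rw [← contourIntegral_map_mul]
  refine contourIntegral_eq_of_windingNumber_eq h.isClosedCurve ?_ ?_ ?_ ?_
  · intro γ hγ
    obtain ⟨γ', hγ', rfl⟩ := List.mem_map.1 hγ
    exact (h.isClosedCurve γ' hγ').const_mul q
  · intro z hz
    have h1 := h.notMem_of_mem_traces hz
    simp only [Set.mem_union, Set.mem_singleton_iff, not_or, mem_convPoles_iff,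
      mem_divPoles_iff] at h1
    refine hana z h1.1.1 fun i => ⟨?_, ?_⟩
    · rw [Ne, qProd_mul_eq_zero_iff hq0 hq1 (hv i)]
      exact fun h => h1.2 ⟨i, h⟩
    · rw [Ne, qProd_mul_inv_eq_zero_iff hq0 hq1 (hqv i)]
      exact fun ⟨k, hk⟩ => h1.1.2 ⟨i, k + 1, by rw [hk]; ring⟩
  · intro z hz
    obtain ⟨w, hw, rfl⟩ := traces_map_mul _ _ hz
    have h1 := h.notMem_of_mem_traces hw
    simp only [Set.mem_union, Set.mem_singleton_iff, not_or, mem_convPoles_iff,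
      mem_divPoles_iff] at h1
    refine hana _ (mul_ne_zero hq0 h1.1.1) fun i => ⟨?_, ?_⟩
    · rw [← mul_assoc, Ne, qProd_mul_eq_zero_iff hq0 hq1 (mul_ne_zero (hv i) hq0)]
      exact fun ⟨k, hk⟩ => h1.2 ⟨i, k + 1, by rw [hk]; ring⟩
    · rw [Ne, qProd_mul_inv_eq_zero_iff hq0 hq1 (hqv i)]
      exact fun ⟨k, hk⟩ => h1.1.2 ⟨i, k, mul_left_cancel₀ hq0 (by rw [hk]; ring)⟩
  · intro z hz
    rw [windingNumber_map_mul _ hq0] at hz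
    exact isRemovableAt_shiftKernel hq0 hq1 hv hprod h (hg z) hz

end Separates

/-! ### The functional defined by the contours -/

section ContourHom

variable {q s : ℂ} {v : Fin 4 → ℂ} {Γ₁ Γ₂ : List (ℝ → ℂ)}

theorem contourFunctional_eq (hq1 : ‖q‖ < 1) (hs : s ^ 2 = q)
    (h : Separates q (v 0) (v 1) (v 2) (v 3) Γ₁ Γ₂) (p : ℂ[X]) :
    contourFunctional q s (v 0) (v 1) (v 2) (v 3) Γ₁ Γ₂ p
      = contourIntegral (Γ₁ ++ Γ₂) fun z => p.eval (xOf z)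
          * (z⁻¹ * (qProd q (z ^ 2) * qProd q (z⁻¹ ^ 2) / symmDen q v z)) := by
  refine contourIntegral_congr fun γ hγ t ht => ?_
  have hz := h.notMem_of_mem_traces (trace_subset_traces hγ ⟨t, ht, rfl⟩)
  simp only [Set.mem_union, Set.mem_singleton_iff, not_or] at hz
  rw [awWeight_xOf hq1 hs _ _ _ _ hz.1.1]
  have : ![v 0, v 1, v 2, v 3] = v := by
    ext i; fin_cases i <;> rfl
  rw [this, symmDen]

theorem continuousOn_eval_xOf (p : ℂ[X]) {S : Set ℂ} (hS : (0 : ℂ) ∉ S) :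
    ContinuousOn (fun z => p.eval (xOf z)) S := by
  have h0 : ∀ z ∈ S, z ≠ 0 := fun z hz h => hS (h ▸ hz)
  unfold xOf
  exact p.continuous.comp_continuousOn
    ((continuousOn_id.add (continuousOn_id.inv₀ h0)).div_const 2)

theorem continuousOn_weight (hq0 : q ≠ 0) (hq1 : ‖q‖ < 1) (hv : ∀ i, v i ≠ 0)
    {S : Set ℂ} (hS : ∀ z ∈ S, z ∉ {0} ∪ convPoles q (v 0) (v 1) (v 2) (v 3)
      ∪ divPoles q (v 0) (v 1) (v 2) (v 3)) :
    ContinuousOn (fun z => z⁻¹ * (qProd q (z ^ 2) * qProd q (z⁻¹ ^ 2) / symmDen q v z)) S := by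
  have h0 : ∀ z ∈ S, z ≠ 0 := fun z hz h => hS z hz (by simp [h])
  intro z hz
  refine AnalyticAt.continuousAt (𝕜 := ℂ) ?_ |>.continuousWithinAt
  refine (analyticAt_inv (h0 z hz)).mul (AnalyticAt.div ((analyticAt_qProd_comp hq1
    (analyticAt_id.pow 2)).mul (analyticAt_qProd_comp hq1 ((analyticAt_inv (h0 z hz)).pow 2)))
    ?_ (symmDen_ne_zero hq0 hq1 hv (hS z hz)))
  exact Finset.analyticAt_fun_prod _ fun i _ => analyticAt_shiftFactor hq1 _ _ (h0 z hz)

/-- The contour functional as a linear map. -/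
def contourHom (hq0 : q ≠ 0) (hq1 : ‖q‖ < 1) (hs : s ^ 2 = q) (hv : ∀ i, v i ≠ 0)
    (h : Separates q (v 0) (v 1) (v 2) (v 3) Γ₁ Γ₂) : ℂ[X] →ₗ[ℂ] ℂ where
  toFun := contourFunctional q s (v 0) (v 1) (v 2) (v 3) Γ₁ Γ₂
  map_add' p r := by
    rw [contourFunctional_eq hq1 hs h, contourFunctional_eq hq1 hs h,
      contourFunctional_eq hq1 hs h, ← contourIntegral_add h.isClosedCurve]
    · simp only [eval_add, add_mul]
    all_goals
      intro γ hγ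
      have hS : ∀ z ∈ trace γ, _ := fun z hz => h.notMem_of_mem_traces (trace_subset_traces hγ hz)
      exact (h.isClosedCurve γ hγ).continuousOn_comp ((continuousOn_eval_xOf _ fun h0 =>
        hS 0 h0 (by simp)).mul (continuousOn_weight hq0 hq1 hv hS))
  map_smul' c p := by
    rw [contourFunctional, contourFunctional, RingHom.id_apply, smul_eq_mul,
      ← contourIntegral_const_mul]
    simp only [eval_smul, smul_eq_mul, mul_assoc]

theorem isAWFunctional_contourHom (hq0 : q ≠ 0) (hq1 : ‖q‖ < 1) (hs : s ^ 2 = q)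
    (hv : ∀ i, v i ≠ 0) (h : Separates q (v 0) (v 1) (v 2) (v 3) Γ₁ Γ₂)
    (hprod : ∀ i j, i ≠ j → v i * v j ∉ Omega q) :
    IsAWFunctional q (v 0) (v 1) (v 2) (v 3) (contourHom hq0 hq1 hs hv h) := by
  intro k m
  set g := shiftBasis q (v 0) (v 1) k m with hg
  have hga : ∀ z, z ≠ 0 → AnalyticAt ℂ g z := fun z hz => analyticAt_shiftBasis q _ _ k m hz
  have h1 := Separates.contourIntegral_shiftKernel_sub hq0 hq1 hv hprod h hga
  rw [show contourHom hq0 hq1 hs hv h _ = _ from contourFunctional_eq hq1 hs h _]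
  set p := awBasis q (v 0) k * awBasis q (v 1) m
          * pearsonFactor (v 0 * q ^ k) (v 1 * q ^ m) (v 2) (v 3) with hp
  have hS : ∀ γ ∈ Γ₁ ++ Γ₂, ∀ z ∈ trace γ, _ := fun γ hγ z hz =>
    h.notMem_of_mem_traces (trace_subset_traces hγ hz)
  have h2 : contourIntegral (Γ₁ ++ Γ₂) (shiftKernel q v g)
      = contourIntegral (Γ₁ ++ Γ₂) fun z => q * shiftKernel q v g (q * z) + p.eval (xOf z)
          * (z⁻¹ * (qProd q (z ^ 2) * qProd q (z⁻¹ ^ 2) / symmDen q v z)) := by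
    refine contourIntegral_congr fun γ hγ t ht => ?_
    have hz := hS γ hγ (γ t) ⟨t, ht, rfl⟩
    have h0 : γ t ≠ 0 := fun h0 => hz (by simp [h0])
    rw [hp, ← shiftKernel_sub hq0 hq1 h0 (symmDen_ne_zero hq0 hq1 hv hz)]
    ring
  rw [contourIntegral_add h.isClosedCurve, ← h1, left_eq_add] at h2
  · exact h2
  · intro γ hγ
    refine (h.isClosedCurve γ hγ).continuousOn_comp
      (f := fun z => q * shiftKernel q v g (q * z)) fun z hz => ?_
    have hz := hS γ hγ z hz
    simp only [Set.mem_union, Set.mem_singleton_iff, not_or, mem_convPoles_iff,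
      mem_divPoles_iff] at hz
    refine ContinuousAt.continuousWithinAt ?_
    refine ContinuousAt.mul continuousAt_const (ContinuousAt.comp' (f := fun z => q * z)
      (g := shiftKernel q v g) ?_ ?_)
    · refine (analyticAt_shiftKernel hq1 (hga _ (mul_ne_zero hq0 hz.1.1))
        (mul_ne_zero hq0 hz.1.1) ?_).continuousAt
      refine Finset.prod_ne_zero_iff.2 fun i _ => mul_ne_zero ?_ ?_
      · rw [← mul_assoc, Ne, qProd_mul_eq_zero_iff hq0 hq1 (mul_ne_zero (hv i) hq0)]
        exact fun ⟨k, hk⟩ => hz.2 ⟨i, k + 1, by rw [hk]; ring⟩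
      · rw [Ne, qProd_mul_inv_eq_zero_iff hq0 hq1 (mul_ne_zero hq0 (hv i))]
        exact fun ⟨k, hk⟩ => hz.1.2 ⟨i, k, mul_left_cancel₀ hq0 (by rw [hk]; ring)⟩
    · fun_prop
  · intro γ hγ
    exact (h.isClosedCurve γ hγ).continuousOn_comp ((continuousOn_eval_xOf _ fun h0 =>
      hS γ hγ 0 h0 (by simp)).mul (continuousOn_weight hq0 hq1 hv (hS γ hγ)))

end ContourHom

/-! ### Limits of contour integrals -/

theorem IsClosedCurve.tendsto_curveIntegral {γ : ℝ → ℂ} (hγ : IsClosedCurve γ) {F : ℕ → ℂ → ℂ}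
    {f : ℂ → ℂ} {b : ℂ → ℝ} (hF : ∀ k, ContinuousOn (F k) (trace γ)) (hb : ContinuousOn b (trace γ))
    (hFb : ∀ k, ∀ z ∈ trace γ, ‖F k z‖ ≤ b z)
    (hl : ∀ z ∈ trace γ, Tendsto (fun k => F k z) atTop (𝓝 (f z))) :
    Tendsto (fun k => curveIntegral γ (F k)) atTop (𝓝 (curveIntegral γ f)) := by
  simp only [curveIntegral_eq_derivWithin]
  have hmem : ∀ t ∈ Set.uIoc (0 : ℝ) 1, t ∈ Set.Icc (0 : ℝ) 1 := fun t ht =>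
    Set.Ioc_subset_Icc_self (by rwa [Set.uIoc_of_le zero_le_one] at ht)
  have hcont {E : Type} [TopologicalSpace E] {g : ℂ → E} (hg : ContinuousOn g (trace γ)) :
      ContinuousOn (fun t => g (γ t)) (Set.Icc (0 : ℝ) 1) :=
    hg.comp hγ.continuousOn fun t ht => ⟨t, ht, rfl⟩
  refine intervalIntegral.tendsto_integral_filter_of_dominated_convergence
    (fun t => b (γ t) * ‖derivWithin γ (Set.Icc 0 1) t‖) ?_ ?_ ?_ ?_
  · refine .of_forall fun k => ?_
    rw [Set.uIoc_of_le zero_le_one]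
    exact (((hcont (hF k)).mul hγ.continuousOn_derivWithin).mono
      Set.Ioc_subset_Icc_self).aestronglyMeasurable measurableSet_Ioc
  · refine .of_forall fun k => .of_forall fun t ht => ?_
    rw [norm_mul]
    exact mul_le_mul_of_nonneg_right (hFb k _ ⟨t, hmem t ht, rfl⟩) (norm_nonneg _)
  · refine ContinuousOn.intervalIntegrable ?_
    rw [Set.uIcc_of_le zero_le_one]
    exact (hcont hb).mul hγ.continuousOn_derivWithin.norm
  · exact .of_forall fun t ht => (hl _ ⟨t, hmem t ht, rfl⟩).mul_const _

theorem tendsto_contourIntegral {Γ : List (ℝ → ℂ)} (hΓ : ∀ γ ∈ Γ, IsClosedCurve γ) {F : ℕ → ℂ → ℂ}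
    {f : ℂ → ℂ} {b : ℂ → ℝ} (hF : ∀ k, ContinuousOn (F k) (traces Γ))
    (hb : ContinuousOn b (traces Γ)) (hFb : ∀ k, ∀ z ∈ traces Γ, ‖F k z‖ ≤ b z)
    (hl : ∀ z ∈ traces Γ, Tendsto (fun k => F k z) atTop (𝓝 (f z))) :
    Tendsto (fun k => contourIntegral Γ (F k)) atTop (𝓝 (contourIntegral Γ f)) := by
  simp only [contourIntegral_eq_sum]
  refine tendsto_list_sum _ fun γ hγ => ?_
  have hs := trace_subset_traces hγ
  exact (hΓ γ hγ).tendsto_curveIntegral (fun k => (hF k).mono hs) (hb.mono hs)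
    (fun k z hz => hFb k z (hs hz)) fun z hz => hl z (hs hz)

/-! ### The unit circle -/

/-- The positively oriented unit circle. -/
def unitCircle (t : ℝ) : ℂ := Complex.exp (2 * Real.pi * Complex.I * t)

theorem hasDerivAt_unitCircle (t : ℝ) :
    HasDerivAt unitCircle (2 * Real.pi * Complex.I * unitCircle t) t := by
  have h := ((hasDerivAt_id (t : ℂ)).const_mul (2 * Real.pi * Complex.I)).cexp.comp_ofReal
  simp only [id, mul_one] at h
  rw [mul_comm]
  exact h

theorem isClosedCurve_unitCircle : IsClosedCurve unitCircle := by
  refine ⟨ContDiff.contDiffOn ?_, ?_⟩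
  · unfold unitCircle
    exact (contDiff_const.mul Complex.ofRealCLM.contDiff).cexp
  · simp [unitCircle, Complex.exp_two_pi_mul_I]

theorem unitCircle_ne_zero (t : ℝ) : unitCircle t ≠ 0 := Complex.exp_ne_zero _

theorem curveIntegral_unitCircle (f : ℂ → ℂ) :
    curveIntegral unitCircle f
      = 2 * Real.pi * Complex.I * ∫ t in (0 : ℝ)..1, f (unitCircle t) * unitCircle t := by
  rw [curveIntegral, ← intervalIntegral.integral_const_mul]
  refine intervalIntegral.integral_congr fun t _ => ?_
  simp only [(hasDerivAt_unitCircle t).deriv]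
  ring

theorem windingNumber_unitCircle_zero : windingNumber [unitCircle] 0 = 1 := by
  rw [windingNumber, contourIntegral_cons, contourIntegral_nil, curveIntegral_unitCircle]
  have : ∀ t : ℝ, (unitCircle t - 0)⁻¹ * unitCircle t = 1 := fun t => by
    rw [sub_zero, inv_mul_cancel₀ (unitCircle_ne_zero t)]
  simp only [this]
  rw [intervalIntegral.integral_const, sub_zero, one_smul, mul_one, add_zero,
    inv_mul_cancel₀ Complex.two_pi_I_ne_zero]

theorem xOf_unitCircle (t : ℝ) : xOf (unitCircle t) = (Real.cos (2 * Real.pi * t) : ℝ) := by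
  rw [xOf, unitCircle, ← Complex.exp_neg, Complex.ofReal_cos, Complex.cos]
  push_cast
  ring_nf

theorem xOf_sq (z : ℂ) (hz : z ≠ 0) : xOf (z ^ 2) = 2 * xOf z ^ 2 - 1 := by
  unfold xOf
  field_simp
  ring

/-- With x = cos θ and z = e^{iθ}, the product at 2x²-1 = cos 2θ is (qz²,q/z²;q)_∞; choosing θ =
arccos x makes it continuous in x. -/
theorem continuousOn_hProd_self {q : ℂ} (hq1 : ‖q‖ < 1) :
    ContinuousOn (fun x : ℝ => hProd q (2 * (x : ℂ) ^ 2 - 1) q) (Set.Icc (-1) 1) := by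
  have hE := (differentiable_qProd hq1).continuous
  have hc : Continuous fun x : ℝ => Complex.exp (Real.arccos x * Complex.I) := by fun_prop
  refine ContinuousOn.congr (f := fun x : ℝ =>
    qProd q (q * Complex.exp (Real.arccos x * Complex.I) ^ 2)
      * qProd q (q / Complex.exp (Real.arccos x * Complex.I) ^ 2)) ?_ ?_
  · refine Continuous.continuousOn ((hE.comp (by fun_prop)).mul (hE.comp ?_))
    exact continuous_const.div (hc.pow 2) fun x => pow_ne_zero _ (Complex.exp_ne_zero _)
  · intro x hx
    have hx' : xOf (Complex.exp (Real.arccos x * Complex.I)) = (x : ℂ) := by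
      rw [xOf, ← Complex.exp_neg, ← neg_mul, ← Complex.cos, ← Complex.ofReal_cos,
        Real.cos_arccos hx.1 hx.2]
    simp only
    rw [← hx', ← xOf_sq _ (Complex.exp_ne_zero _),
      hProd_xOf hq1 (pow_ne_zero _ (Complex.exp_ne_zero _))]

theorem norm_unitCircle (t : ℝ) : ‖unitCircle t‖ = 1 := by
  rw [unitCircle, show 2 * Real.pi * Complex.I * t = ((2 * Real.pi * t : ℝ) : ℂ) * Complex.I by
    push_cast; ring, Complex.norm_exp_ofReal_mul_I]

theorem one_le_norm_of_mem_Omega {q u : ℂ} (hq0 : q ≠ 0) (hq1 : ‖q‖ < 1) (hu : u ∈ Omega q) :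
    1 ≤ ‖u‖ := by
  obtain ⟨k, rfl⟩ := hu
  rw [zpow_neg, zpow_natCast, norm_inv, norm_pow]
  exact (one_le_inv₀ (by positivity)).2 (pow_le_one₀ (norm_nonneg _) hq1.le)

theorem exists_unitCircle_eq {x : ℝ} (hx : x ∈ Set.Icc (-1 : ℝ) 1) :
    ∃ t, Real.cos (2 * Real.pi * t) = x :=
  ⟨Real.arccos x / (2 * Real.pi), by
    rw [mul_div_cancel₀ _ (by positivity), Real.cos_arccos hx.1 hx.2]⟩

theorem hProd_self_unitCircle {q : ℂ} (hq1 : ‖q‖ < 1) (t : ℝ) :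
    hProd q (2 * ((Real.cos (2 * Real.pi * t) : ℝ) : ℂ) ^ 2 - 1) q
      = qProd q (q * unitCircle t ^ 2) * qProd q (q / unitCircle t ^ 2) := by
  rw [← xOf_unitCircle, ← xOf_sq _ (unitCircle_ne_zero t),
    hProd_xOf hq1 (pow_ne_zero _ (unitCircle_ne_zero t))]

theorem hProd_self_ne_zero {q : ℂ} (hq0 : q ≠ 0) (hq1 : ‖q‖ < 1) {x : ℝ}
    (hx : x ∈ Set.Icc (-1 : ℝ) 1) : hProd q (2 * (x : ℂ) ^ 2 - 1) q ≠ 0 := by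
  obtain ⟨t, rfl⟩ := exists_unitCircle_eq hx
  have h : ∀ u, ‖u‖ = ‖q‖ → qProd q u ≠ 0 := fun u hu h =>
    (one_le_norm_of_mem_Omega hq0 hq1 ((qProd_eq_zero_iff hq0 hq1).1 h)).not_gt (hu ▸ hq1)
  rw [hProd_self_unitCircle hq1]
  exact mul_ne_zero (h _ (by simp [norm_unitCircle])) (h _ (by simp [norm_unitCircle]))

theorem one_sub_sq_unitCircle (t : ℝ) :
    (1 - unitCircle t ^ 2) * (1 - (unitCircle t)⁻¹ ^ 2)
      = ((2 - 2 * Real.cos (4 * Real.pi * t) : ℝ) : ℂ) := by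
  have h : ((Real.cos (4 * Real.pi * t) : ℝ) : ℂ) = xOf (unitCircle t ^ 2) := by
    rw [xOf_sq _ (unitCircle_ne_zero t), xOf_unitCircle, show 4 * Real.pi * t = 2 * (2 * Real.pi * t)
      by ring, Real.cos_two_mul]
    push_cast
    ring
  have h0 := unitCircle_ne_zero t
  rw [Complex.ofReal_sub, Complex.ofReal_mul, h, xOf]
  push_cast
  field_simp
  ring

theorem integral_two_sub_cos : ∫ t in (0 : ℝ)..1, (2 - 2 * Real.cos (4 * Real.pi * t)) = 2 := by
  rw [intervalIntegral.integral_sub (by simp) (Continuous.intervalIntegrable (by fun_prop) _ _),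
    intervalIntegral.integral_const_mul,
    intervalIntegral.integral_comp_mul_left (fun x => Real.cos x) (by positivity), integral_cos]
  have : Real.sin (4 * Real.pi) = 0 := by simpa using Real.sin_nat_mul_pi 4
  simp [this]

theorem exists_polynomial_near_complex {f : ℝ → ℂ} (hf : ContinuousOn f (Set.Icc (-1) 1)) {ε : ℝ}
    (hε : 0 < ε) : ∃ p : ℂ[X], ∀ x ∈ Set.Icc (-1 : ℝ) 1, ‖p.eval (x : ℂ) - f x‖ ≤ ε := by
  obtain ⟨p₁, h₁⟩ := exists_polynomial_near_of_continuousOn (-1) 1 (fun x => (f x).re)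
    (Complex.continuous_re.comp_continuousOn hf) (ε / 2) (half_pos hε)
  obtain ⟨p₂, h₂⟩ := exists_polynomial_near_of_continuousOn (-1) 1 (fun x => (f x).im)
    (Complex.continuous_im.comp_continuousOn hf) (ε / 2) (half_pos hε)
  refine ⟨p₁.map Complex.ofRealHom + C Complex.I * p₂.map Complex.ofRealHom, fun x hx => ?_⟩
  have e : (p₁.map Complex.ofRealHom + C Complex.I * p₂.map Complex.ofRealHom).eval (x : ℂ) - f x
      = ((p₁.eval x - (f x).re : ℝ) : ℂ) + Complex.I * ((p₂.eval x - (f x).im : ℝ) : ℂ) := by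
    have h (p : ℝ[X]) : (p.map Complex.ofRealHom).eval (x : ℂ) = ((p.eval x : ℝ) : ℂ) :=
      Polynomial.eval_map_apply (f := Complex.ofRealHom) (p := p) x
    rw [eval_add, eval_mul, eval_C, h, h]
    nth_rw 1 [← Complex.re_add_im (f x)]
    push_cast
    ring
  rw [e]
  refine (norm_add_le _ _).trans ?_
  rw [norm_mul, Complex.norm_I, one_mul, Complex.norm_real, Complex.norm_real, Real.norm_eq_abs,
    Real.norm_eq_abs]
  linarith [h₁ x hx, h₂ x hx]

/-- The numerator of the weight does not annihilate all polynomials on the unit circle. -/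
theorem exists_curveIntegral_unitCircle_ne_zero {q : ℂ} (hq0 : q ≠ 0) (hq1 : ‖q‖ < 1) :
    ∃ p : ℂ[X], curveIntegral unitCircle (fun z => p.eval (xOf z)
      * (z⁻¹ * (qProd q (z ^ 2) * qProd q (z⁻¹ ^ 2)))) ≠ 0 := by
  set H : ℝ → ℂ := fun x => hProd q (2 * (x : ℂ) ^ 2 - 1) q with hH
  have hHc := continuousOn_hProd_self hq1
  have hH0 : ∀ x ∈ Set.Icc (-1 : ℝ) 1, H x ≠ 0 := fun x hx => hProd_self_ne_zero hq0 hq1 hx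
  obtain ⟨K, hK⟩ := isCompact_Icc.exists_bound_of_continuousOn hHc
  have hK0 : 0 ≤ K := (norm_nonneg _).trans (hK 0 (by norm_num))
  -- p approximates 1/H so closely that, as the weight w is at most 4 and H at most K in modulus,
  -- the error in the integral is at most 4K/(4(K+1)) ≤ 1, less than the main term ∫w = 2.
  obtain ⟨p, hp⟩ := exists_polynomial_near_complex (hHc.inv₀ hH0)
    (ε := 1 / (4 * (K + 1))) (by positivity)
  refine ⟨p, ?_⟩
  set x : ℝ → ℝ := fun t => Real.cos (2 * Real.pi * t) with hx
  have hxm : ∀ t, x t ∈ Set.Icc (-1 : ℝ) 1 := fun t => Real.cos_mem_Icc _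
  set w : ℝ → ℝ := fun t => 2 - 2 * Real.cos (4 * Real.pi * t) with hw
  -- Splitting (1-z²)(1-z^{-2}) off the numerator leaves H; on the unit circle the split factor is
  -- the real weight w.
  have hE (t : ℝ) : p.eval (xOf (unitCircle t)) * ((unitCircle t)⁻¹
      * (qProd q (unitCircle t ^ 2) * qProd q ((unitCircle t)⁻¹ ^ 2))) * unitCircle t
      = (p.eval (x t : ℂ) - (H (x t))⁻¹) * (w t * H (x t)) + w t := by
    have h1 : qProd q (unitCircle t ^ 2) * qProd q ((unitCircle t)⁻¹ ^ 2) = w t * H (x t) := by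
      rw [qProd_eq_mul hq1 (unitCircle t ^ 2), qProd_eq_mul hq1 ((unitCircle t)⁻¹ ^ 2), hw,
        ← one_sub_sq_unitCircle, hH, hx]
      simp only [hProd_self_unitCircle hq1, inv_pow, div_eq_mul_inv]
      ring
    rw [h1, xOf_unitCircle]
    have h2 := hH0 (x t) (hxm t)
    have h3 := unitCircle_ne_zero t
    field_simp
    ring
  rw [curveIntegral_unitCircle]
  simp only [hE]
  refine mul_ne_zero Complex.two_pi_I_ne_zero fun h0 => ?_
  have hxc : Continuous x := by fun_prop
  have hwc : Continuous w := by fun_prop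
  have hHx : Continuous fun t => H (x t) :=
    hHc.comp_continuous hxc hxm
  have hHi : Continuous fun t => (H (x t))⁻¹ := hHx.inv₀ fun t => hH0 _ (hxm t)
  have hpx : Continuous fun t => p.eval (x t : ℂ) := by fun_prop
  have hpw : Continuous fun t => (p.eval (x t : ℂ) - (H (x t))⁻¹) * (w t * H (x t)) :=
    (hpx.sub hHi).mul ((Complex.continuous_ofReal.comp hwc).mul hHx)
  rw [intervalIntegral.integral_add (hpw.intervalIntegrable _ _)
    (Continuous.intervalIntegrable (by fun_prop) _ _), intervalIntegral.integral_ofReal,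
    integral_two_sub_cos] at h0
  have h4 : ‖∫ t in (0 : ℝ)..1, (p.eval (x t : ℂ) - (H (x t))⁻¹) * (w t * H (x t))‖
      ≤ 1 * |(1 : ℝ) - 0| := by
    refine intervalIntegral.norm_integral_le_of_norm_le_const fun t _ => ?_
    have hwt : ‖(w t : ℂ)‖ ≤ 4 := by
      rw [Complex.norm_real, Real.norm_eq_abs, abs_le]
      constructor <;> simp only [hw] <;>
        linarith [Real.cos_le_one (4 * Real.pi * t), Real.neg_one_le_cos (4 * Real.pi * t)]
    rw [norm_mul, norm_mul]
    calc _ ≤ 1 / (4 * (K + 1)) * (4 * K) := by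
          refine mul_le_mul (hp _ (hxm t)) ?_ (by positivity) (by positivity)
          exact mul_le_mul hwt (hK _ (hxm t)) (norm_nonneg _) (by norm_num)
      _ ≤ 1 := by
          rw [div_mul_eq_mul_div, one_mul, div_le_one (by positivity)]
          linarith
  rw [eq_neg_of_add_eq_zero_left h0] at h4
  norm_num at h4

/-! ### Nonvanishing of the contour functional at 1 -/

section

variable {q s : ℂ} {v : Fin 4 → ℂ} {Γ₁ Γ₂ : List (ℝ → ℂ)}

theorem tendsto_mul_pow_zero (hq1 : ‖q‖ < 1) (u : ℂ) :
    Tendsto (fun k : ℕ => u * q ^ k) atTop (𝓝 0) := by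
  simpa using (tendsto_pow_atTop_nhds_zero_of_norm_lt_one hq1).const_mul u

/-- The alternative z = 0 is needed because a zero parameter would put the default value 0⁻¹ = 0
among the divergent poles. -/
theorem eventually_notMem_divPoles (hq1 : ‖q‖ < 1) :
    ∀ᶠ z in 𝓝 (0 : ℂ), z ∉ divPoles q (v 0) (v 1) (v 2) (v 3) ∨ z = 0 := by
  have h : ∀ i, ∀ᶠ z in 𝓝 (0 : ℂ), ‖z * v i‖ < 1 := fun i => by
    have : Tendsto (fun z : ℂ => ‖z * v i‖) (𝓝 0) (𝓝 0) := by
      simpa using ((continuous_id.mul (continuous_const (y := v i))).norm.tendsto (0 : ℂ))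
    exact this.eventually (gt_mem_nhds one_pos)
  filter_upwards [eventually_all.2 h] with z hz
  by_cases h0 : z = 0
  · exact Or.inr h0
  refine Or.inl fun hd => ?_
  obtain ⟨i, k, rfl⟩ := mem_divPoles_iff.1 hd
  have hv : v i * q ^ k ≠ 0 := fun h => h0 (by rw [h, inv_zero])
  have h1 : (v i * q ^ k)⁻¹ * v i * q ^ k = 1 := by
    rw [mul_assoc, inv_mul_cancel₀ hv]
  have h2 := congrArg norm h1
  rw [norm_mul, norm_pow, norm_one] at h2
  have h3 : ‖q‖ ^ k ≤ 1 := pow_le_one₀ (norm_nonneg _) hq1.le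
  nlinarith [hz i, norm_nonneg ((v i * q ^ k)⁻¹ * v i), pow_nonneg (norm_nonneg q) k]

/-- Separation prescribes nothing at 0, but the convergent poles accumulate there. All those close
to 0 are not divergent and have winding number 2, and the winding number is locally constant. -/
theorem Separates.windingNumber_zero (hq0 : q ≠ 0) (hq1 : ‖q‖ < 1) (hv : ∀ i, v i ≠ 0)
    (h : Separates q (v 0) (v 1) (v 2) (v 3) Γ₁ Γ₂) : windingNumber (Γ₁ ++ Γ₂) 0 = 2 := by
  have h0 : (0 : ℂ) ∉ traces (Γ₁ ++ Γ₂) := fun h0 => h.notMem_of_mem_traces h0 (by simp)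
  obtain ⟨r, hr, hball⟩ := Metric.isOpen_iff.1
    (isCompact_traces h.isClosedCurve).isClosed.isOpen_compl 0 h0
  have hlim := tendsto_mul_pow_zero hq1 (v 0)
  obtain ⟨k, hk1, hk2⟩ := ((hlim.eventually (Metric.ball_mem_nhds 0 hr)).and
    (hlim.eventually (eventually_notMem_divPoles (v := v) hq1))).exists
  have hk0 : v 0 * q ^ k ≠ 0 := mul_ne_zero (hv 0) (pow_ne_zero _ hq0)
  have h2 := h.windingNumber_conv ⟨mem_convPoles_iff.2 ⟨0, k, rfl⟩, hk2.resolve_right hk0⟩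
  rw [windingNumber, contourIntegral_inv_eq_of_mem_ball h.isClosedCurve (z₀ := 0)
    (fun z hz hz' => hball hz hz') hk1] at h2
  exact h2

/-- If L(1) = 0 then L = 0. Testing with p·∏(v_i z,v_i/z;q)_k and letting k → ∞ cancels the whole
denominator of the weight. The remaining integrand is analytic off 0, so its integral is twice that
over the unit circle, which is nonzero for some p. -/
theorem contourHom_one_ne_zero (hq0 : q ≠ 0) (hq1 : ‖q‖ < 1) (hs : s ^ 2 = q)
    (hv : ∀ i, v i ≠ 0) (h : Separates q (v 0) (v 1) (v 2) (v 3) Γ₁ Γ₂)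
    (hprod : ∀ i j, i ≠ j → v i * v j ∉ Omega q) (hB : v 0 * v 1 * v 2 * v 3 ∉ Omega q) :
    contourHom hq0 hq1 hs hv h 1 ≠ 0 := by
  intro h1
  have hL := isAWFunctional_contourHom hq0 hq1 hs hv h hprod
  have hzero := fun f => hL.eq_zero hq0 (hv 1) hB h1 f
  obtain ⟨p, hp⟩ := exists_curveIntegral_unitCircle_ne_zero hq0 hq1
  set f : ℂ → ℂ := fun z => p.eval (xOf z) * (z⁻¹ * (qProd q (z ^ 2) * qProd q (z⁻¹ ^ 2))) with hf
  have hΓ := h.isClosedCurve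
  have hS := fun z (hz : z ∈ traces (Γ₁ ++ Γ₂)) => h.notMem_of_mem_traces hz
  have h0 : (0 : ℂ) ∉ traces (Γ₁ ++ Γ₂) := fun h0 => hS 0 h0 (by simp)
  have hne : ∀ z ∈ traces (Γ₁ ++ Γ₂), z ≠ 0 := fun z hz hz0 => h0 (hz0 ▸ hz)
  have hfana : ∀ z ≠ 0, AnalyticAt ℂ f z := fun z hz => by
    refine AnalyticAt.mul ?_ ((analyticAt_inv hz).mul ((analyticAt_qProd_comp hq1
      (analyticAt_id.pow 2)).mul (analyticAt_qProd_comp hq1 ((analyticAt_inv hz).pow 2))))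
    exact AnalyticAt.fun_comp (g := fun x => p.eval x) (f := xOf) (p.differentiable.analyticAt _)
      ((analyticAt_id.add (analyticAt_inv hz)).div_const)
  have hcirc : contourIntegral (Γ₁ ++ Γ₂) f = contourIntegral [unitCircle, unitCircle] f := by
    refine contourIntegral_eq_of_windingNumber_eq hΓ (by simp [isClosedCurve_unitCircle])
      (fun z hz => hfana z (hne z hz)) (fun z hz => ?_) fun z hz => ?_
    · simp only [traces, Set.mem_iUnion] at hz
      obtain ⟨γ, hγ, t, -, rfl⟩ := hz
      have : γ = unitCircle := by simpa using hγ
      exact hfana _ (this ▸ unitCircle_ne_zero t)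
    · rcases eq_or_ne z 0 with rfl | hz0
      · refine absurd ?_ hz
        rw [h.windingNumber_zero hq0 hq1 hv, show [unitCircle, unitCircle]
          = [unitCircle] ++ [unitCircle] from rfl, windingNumber_append,
          windingNumber_unitCircle_zero]
        norm_num
      · exact ⟨f, hfana z hz0, EventuallyEq.rfl⟩
  have hΓf : contourIntegral (Γ₁ ++ Γ₂) f = 0 := by
    set P : ℕ → ℂ[X] := fun k => p * ∏ i, awBasis q (v i) k with hP
    set W : ℂ → ℂ := fun z => z⁻¹ * (qProd q (z ^ 2) * qProd q (z⁻¹ ^ 2) / symmDen q v z) with hW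
    have hPeval : ∀ k, ∀ z ≠ 0, (P k).eval (xOf z)
        = p.eval (xOf z) * ∏ i, (qPoch (v i * z) q k * qPoch (v i / z) q k) := fun k z hz => by
      simp only [hP, eval_mul, eval_prod, eval_awBasis q _ _ hz]
    have hWc : ContinuousOn W (traces (Γ₁ ++ Γ₂)) := continuousOn_weight hq0 hq1 hv hS
    set b : ℂ → ℝ := fun z => ‖p.eval (xOf z)‖ * (∏ i, (Real.exp (‖v i * z‖ * (1 - ‖q‖)⁻¹)
      * Real.exp (‖v i / z‖ * (1 - ‖q‖)⁻¹))) * ‖W z‖ with hb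
    have hlim : Tendsto (fun k => contourIntegral (Γ₁ ++ Γ₂) fun z => (P k).eval (xOf z) * W z)
        atTop (𝓝 (contourIntegral (Γ₁ ++ Γ₂) f)) := by
      refine tendsto_contourIntegral (b := b) hΓ
        (fun k => (continuousOn_eval_xOf _ h0).mul hWc) ?_ (fun k z hz => ?_) fun z hz => ?_
      · refine ((continuousOn_eval_xOf _ h0).norm.mul (continuousOn_finsetProd _ fun i _ => ?_)).mul
          hWc.norm
        refine ContinuousOn.mul (by fun_prop) (Real.continuous_exp.comp_continuousOn ?_)
        exact ((continuousOn_const.div continuousOn_id hne).norm).mul continuousOn_const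
      · rw [hPeval k z (hne z hz), norm_mul, norm_mul, norm_prod]
        refine mul_le_mul_of_nonneg_right (mul_le_mul_of_nonneg_left ?_ (norm_nonneg _))
          (norm_nonneg _)
        refine Finset.prod_le_prod (fun _ _ => norm_nonneg _) fun i _ => ?_
        rw [norm_mul]
        exact mul_le_mul (norm_qPoch_le hq1 _ _) (norm_qPoch_le hq1 _ _) (norm_nonneg _)
          (Real.exp_pos _).le
      · have hden := symmDen_ne_zero hq0 hq1 hv (hS z hz)
        have e : f z = p.eval (xOf z) * (∏ i, (qProd q (v i * z) * qProd q (v i / z))) * W z := by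
          simp only [hf, hW, div_eq_mul_inv _ z]
          rw [← symmDen]
          field_simp
        rw [e]
        refine Tendsto.mul_const _ ?_
        simp only [hPeval _ z (hne z hz)]
        exact (tendsto_finsetProd _ fun i _ =>
          (tendsto_qPoch hq1 _).mul (tendsto_qPoch hq1 _)).const_mul _
    refine tendsto_nhds_unique hlim ?_
    have : ∀ k, (contourIntegral (Γ₁ ++ Γ₂) fun z => (P k).eval (xOf z) * W z) = 0 := fun k => by
      rw [hW, ← contourFunctional_eq hq1 hs h]
      exact hzero (P k)
    simp only [this]
    exact tendsto_const_nhds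
  rw [hΓf, contourIntegral_cons, contourIntegral_cons, contourIntegral_nil, add_zero,
    ← two_mul] at hcirc
  exact (mul_ne_zero two_ne_zero hp) hcirc.symm

end

/-! ### Existence of the contours -/

/-- The circle with centre `w` and radius `r`, parametrised by `[0,1]`. -/
def circleCurve (w : ℂ) (r : ℝ) (t : ℝ) : ℂ := circleMap w r (2 * Real.pi * t)

theorem isClosedCurve_circleCurve (w : ℂ) (r : ℝ) : IsClosedCurve (circleCurve w r) := by
  refine ⟨ContDiff.contDiffOn ?_, ?_⟩
  · exact (contDiff_circleMap w r).comp (contDiff_const.mul contDiff_id)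
  · simp only [circleCurve, mul_zero, mul_one]
    simpa using (periodic_circleMap w r 0).symm

theorem curveIntegral_circleCurve (w : ℂ) (r : ℝ) (f : ℂ → ℂ) :
    curveIntegral (circleCurve w r) f = ∮ z in C(w, r), f z := by
  have h := intervalIntegral.smul_integral_comp_mul_left (a := 0) (b := 1)
    (fun θ => deriv (circleMap w r) θ • f (circleMap w r θ)) (2 * Real.pi)
  rw [mul_zero, mul_one] at h
  rw [circleIntegral, ← h, curveIntegral, ← intervalIntegral.integral_smul]
  refine intervalIntegral.integral_congr fun t _ => ?_
  have hd : deriv (circleCurve w r) t = (2 * Real.pi : ℝ) • deriv (circleMap w r) (2 * Real.pi * t) :=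
    deriv_comp_mul_left (2 * Real.pi) (circleMap w r) t
  simp only [hd, circleCurve, Complex.real_smul, smul_eq_mul]
  ring

theorem windingNumber_circleCurve_of_mem {w z : ℂ} {r : ℝ} (hz : z ∈ Metric.ball w r) :
    windingNumber [circleCurve w r] z = 1 := by
  rw [windingNumber, contourIntegral_cons, contourIntegral_nil, add_zero,
    curveIntegral_circleCurve, circleIntegral.integral_sub_inv_of_mem_ball hz,
    inv_mul_cancel₀ Complex.two_pi_I_ne_zero]

theorem windingNumber_circleCurve_of_notMem {w z : ℂ} {r : ℝ} (hr : 0 ≤ r)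
    (hz : z ∉ Metric.closedBall w r) : windingNumber [circleCurve w r] z = 0 := by
  have h : ∀ x ∈ Metric.closedBall w r, DifferentiableAt ℂ (fun x => (x - z)⁻¹) x := fun x hx =>
    (differentiableAt_id.sub_const z).inv (sub_ne_zero.2 fun h => hz (h ▸ hx))
  rw [windingNumber, contourIntegral_cons, contourIntegral_nil, add_zero,
    curveIntegral_circleCurve,
    Complex.circleIntegral_eq_zero_of_differentiable_on_off_countable hr Set.countable_empty
      (fun x hx => (h x hx).continuousAt.continuousWithinAt)
      (fun x hx => h x (Metric.ball_subset_closedBall hx.1)), mul_zero]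

theorem dist_circleCurve (w : ℂ) {r : ℝ} (hr : 0 ≤ r) (t : ℝ) : dist (circleCurve w r t) w = r :=
  circleMap_mem_sphere w hr _

/-- Around finitely many isolated points of `S` a contour can be modified so that its winding
numbers about them change by `1` or `-1`, and no others do. -/
theorem exists_contour_add {S : Set ℂ} {Γ₀ : List (ℝ → ℂ)} (hΓ₀ : IsContourAvoiding Γ₀ S)
    (m : ℂ → ℂ) (E : Finset ℂ) (hm : ∀ e ∈ E, m e = 1 ∨ m e = -1)
    (hE : ∀ e ∈ E, ∀ᶠ z in 𝓝 e, z ∈ S → z = e) :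
    ∃ Γ, IsContourAvoiding Γ S ∧ ∀ z ∈ S,
      windingNumber Γ z = windingNumber Γ₀ z + if z ∈ E then m z else 0 := by
  induction E using Finset.induction_on with
  | empty => exact ⟨Γ₀, hΓ₀, by simp⟩
  | insert e E he ih =>
    obtain ⟨Γ, hΓ, hw⟩ := ih (fun e' h => hm e' (Finset.mem_insert_of_mem h))
      (fun e' h => hE e' (Finset.mem_insert_of_mem h))
    obtain ⟨δ, hδ, hball⟩ := Metric.nhds_basis_closedBall.eventually_iff.1
      (hE e (Finset.mem_insert_self e E))
    have havoid : ∀ t, circleCurve e δ t ∉ S := fun t ht => by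
      have h := hball (Metric.mem_closedBall.2 (dist_circleCurve e hδ.le t).le) ht
      have h2 := dist_circleCurve e hδ.le t
      rw [h, dist_self] at h2
      exact hδ.ne h2
    have hwind : ∀ z ∈ S, windingNumber [circleCurve e δ] z = if z = e then 1 else 0 := by
      intro z hz
      split_ifs with h
      · exact windingNumber_circleCurve_of_mem (h ▸ Metric.mem_ball_self hδ)
      · exact windingNumber_circleCurve_of_notMem hδ.le fun hz' => h (hball hz' hz)
    have hcl := isClosedCurve_circleCurve e δ
    obtain ⟨γ, hγ, hγS, hγw⟩ : ∃ γ, IsClosedCurve γ ∧ (∀ t ∈ Set.Icc (0 : ℝ) 1, γ t ∉ S) ∧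
        ∀ z ∈ S, windingNumber [γ] z = if z = e then m z else 0 := by
      rcases hm e (Finset.mem_insert_self e E) with h | h
      · refine ⟨circleCurve e δ, hcl, fun t _ => havoid t, fun z hz => ?_⟩
        rw [hwind z hz]
        split_ifs with hze
        · rw [hze, h]
        · rfl
      · refine ⟨reverse (circleCurve e δ), hcl.reverse, fun t _ => havoid _, fun z hz => ?_⟩
        have : windingNumber [reverse (circleCurve e δ)] z = -windingNumber [circleCurve e δ] z := by
          rw [windingNumber, windingNumber, ← mul_neg, ← contourIntegral_map_reverse]
          rfl
        rw [this, hwind z hz]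
        split_ifs with hze
        · rw [hze, h]
        · exact neg_zero
    refine ⟨[γ] ++ Γ, ?_, fun z hz => ?_⟩
    · intro γ' hγ'
      rcases List.mem_append.1 hγ' with h | h
      · obtain rfl := List.mem_singleton.1 h
        exact ⟨hγ.1, hγ.2, hγS⟩
      · exact hΓ γ' h
    · rw [windingNumber_append, hγw z hz, hw z hz]
      by_cases hze : z = e
      · subst hze
        simp [he, add_comm]
      · simp [hze]

section

variable {q : ℂ} {v : Fin 4 → ℂ}

theorem inv_mem_convPoles_iff {z : ℂ} : z⁻¹ ∈ convPoles q (v 0) (v 1) (v 2) (v 3) ↔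
    z ∈ divPoles q (v 0) (v 1) (v 2) (v 3) := by
  rw [mem_convPoles_iff, mem_divPoles_iff]
  simp only [inv_eq_iff_eq_inv]

theorem finite_convPoles_norm_ge (hq1 : ‖q‖ < 1) {ρ : ℝ} (hρ : 0 < ρ) :
    (convPoles q (v 0) (v 1) (v 2) (v 3) ∩ {z | ρ ≤ ‖z‖}).Finite := by
  have h : ∀ i, {k : ℕ | ρ ≤ ‖v i * q ^ k‖}.Finite := fun i => by
    have h1 : ∀ᶠ k in atTop, ‖v i * q ^ k‖ < ρ :=
      (by simpa using (tendsto_mul_pow_zero hq1 (v i)).norm :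
        Tendsto (fun k : ℕ => ‖v i * q ^ k‖) atTop (𝓝 0)).eventually (gt_mem_nhds hρ)
    obtain ⟨K, hK⟩ := eventually_atTop.1 h1
    exact (Set.finite_lt_nat K).subset fun k hk => lt_of_not_ge fun hle => (hK k hle).not_ge hk
  refine (Set.finite_iUnion fun i => (h i).image fun k => v i * q ^ k).subset ?_
  rintro z ⟨hz, hzρ⟩
  obtain ⟨i, k, rfl⟩ := mem_convPoles_iff.1 hz
  exact Set.mem_iUnion.2 ⟨i, k, hzρ, rfl⟩

theorem finite_divPoles_norm_le (hq1 : ‖q‖ < 1) (R : ℝ) :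
    (divPoles q (v 0) (v 1) (v 2) (v 3) ∩ {z | ‖z‖ ≤ R ∧ z ≠ 0}).Finite := by
  rcases le_or_gt R 0 with hR | hR
  · refine Set.Finite.subset Set.finite_empty ?_
    rintro z ⟨-, hz, hz0⟩
    exact hz0 (norm_le_zero_iff.1 (hz.trans hR))
  refine ((finite_convPoles_norm_ge (v := v) hq1 (inv_pos.2 hR)).image fun z => z⁻¹).subset ?_
  rintro z ⟨hz, hzR, hz0⟩
  refine ⟨z⁻¹, ⟨inv_mem_convPoles_iff.2 hz, ?_⟩, inv_inv z⟩
  rw [Set.mem_ofPred_eq, norm_inv]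
  exact inv_anti₀ (norm_pos_iff.2 hz0) hzR

theorem countable_convPoles : (convPoles q (v 0) (v 1) (v 2) (v 3)).Countable := by
  refine (Set.countable_range fun x : Fin 4 × ℕ => v x.1 * q ^ x.2).mono fun z hz => ?_
  obtain ⟨i, k, rfl⟩ := mem_convPoles_iff.1 hz
  exact ⟨(i, k), rfl⟩

theorem countable_divPoles : (divPoles q (v 0) (v 1) (v 2) (v 3)).Countable := by
  refine (countable_convPoles (q := q) (v := v)).image (fun z => z⁻¹) |>.mono fun z hz => ?_
  exact ⟨z⁻¹, inv_mem_convPoles_iff.2 hz, inv_inv z⟩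

/-- There are contours with winding number `1` about the poles in `A` and `0` about the others. -/
theorem exists_contour (hq0 : q ≠ 0) (hq1 : ‖q‖ < 1) (hv : ∀ i, v i ≠ 0) {A : Set ℂ}
    (hA : A ⊆ convPoles q (v 0) (v 1) (v 2) (v 3)) :
    ∃ Γ, IsContourAvoiding Γ ({0} ∪ convPoles q (v 0) (v 1) (v 2) (v 3)
        ∪ divPoles q (v 0) (v 1) (v 2) (v 3)) ∧ (∀ z ∈ A, windingNumber Γ z = 1) ∧
      ∀ z ∈ divPoles q (v 0) (v 1) (v 2) (v 3), z ∉ A → windingNumber Γ z = 0 := by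
  classical
  set cp := convPoles q (v 0) (v 1) (v 2) (v 3) with hcp
  set dp := divPoles q (v 0) (v 1) (v 2) (v 3) with hdp
  have hc0 : ∀ z ∈ cp, z ≠ 0 := fun z hz => by
    obtain ⟨i, k, rfl⟩ := mem_convPoles_iff.1 hz
    exact mul_ne_zero (hv i) (pow_ne_zero _ hq0)
  have hd0 : ∀ z ∈ dp, z ≠ 0 := fun z hz h =>
    hc0 _ (inv_mem_convPoles_iff.2 hz) (by rw [h, inv_zero])
  have hfin : ∀ ρ R : ℝ, 0 < ρ → ((cp ∪ dp) ∩ {z | ρ ≤ ‖z‖ ∧ ‖z‖ ≤ R}).Finite := fun ρ R hρ => by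
    refine ((finite_convPoles_norm_ge (v := v) hq1 hρ).union
      (finite_divPoles_norm_le (v := v) hq1 R)).subset ?_
    rintro z ⟨hz | hz, hz1, hz2⟩
    · exact Or.inl ⟨hz, hz1⟩
    · exact Or.inr ⟨hz, hz2, hd0 z hz⟩
  have hiso : ∀ e ≠ 0, ∀ᶠ z in 𝓝 e, z ∈ {0} ∪ cp ∪ dp → z = e := fun e he => by
    have hpos := norm_pos_iff.2 he
    have h1 : ∀ᶠ z in 𝓝 e, ‖e‖ / 2 < ‖z‖ ∧ ‖z‖ < 2 * ‖e‖ :=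
      ((continuous_norm.tendsto e).eventually (lt_mem_nhds (half_lt_self hpos))).and
        ((continuous_norm.tendsto e).eventually (gt_mem_nhds (by linarith)))
    have h2 := (((hfin (‖e‖ / 2) (2 * ‖e‖) (half_pos hpos)).subset
      (Set.sdiff_subset (t := {e}))).isClosed.isOpen_compl).mem_nhds (x := e) (by simp)
    filter_upwards [h1, h2] with z hz hz2 hzS
    by_contra hze
    refine hz2 ⟨⟨?_, hz.1.le, hz.2.le⟩, hze⟩
    rcases hzS with (hz0 | hz0) | hz0
    · rw [Set.mem_singleton_iff.1 hz0, norm_zero] at hz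
      linarith [hz.1]
    · exact Or.inl hz0
    · exact Or.inr hz0
  -- There are countably many poles, so some radius differs from all their moduli.
  obtain ⟨r, hr, hr0, -⟩ := (((countable_convPoles.union countable_divPoles).image
    norm : (norm '' (cp ∪ dp)).Countable).dense_compl ℝ).exists_between (zero_lt_one)
  have hr' : ∀ z ∈ cp ∪ dp, ‖z‖ ≠ r := fun z hz h => hr ⟨z, hz, h⟩
  -- The finitely many poles on the wrong side of the circle; a small positively or negatively
  -- oriented circle about each corrects its winding number.
  have hE : ((A ∩ {z | r ≤ ‖z‖}) ∪ ((dp \ A) ∩ {z | ‖z‖ ≤ r})).Finite := by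
    refine ((finite_convPoles_norm_ge hq1 hr0).subset
      (Set.inter_subset_inter_left _ hA)).union ((finite_divPoles_norm_le (v := v) hq1 r).subset ?_)
    rintro z ⟨⟨hz, -⟩, hzr⟩
    exact ⟨hz, hzr, hd0 z hz⟩
  have hcirc : IsContourAvoiding [circleCurve 0 r] ({0} ∪ cp ∪ dp) := by
    intro γ hγ
    obtain rfl := List.mem_singleton.1 hγ
    refine ⟨(isClosedCurve_circleCurve 0 r).1, (isClosedCurve_circleCurve 0 r).2, fun t _ ht => ?_⟩
    have hn := dist_circleCurve 0 hr0.le t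
    rw [dist_zero_right] at hn
    rcases ht with (h | h) | h
    · rw [Set.mem_singleton_iff.1 h, norm_zero] at hn
      exact hr0.ne hn
    · exact hr' _ (Or.inl h) hn
    · exact hr' _ (Or.inr h) hn
  obtain ⟨Γ, hΓ, hw⟩ := exists_contour_add hcirc (fun z => if z ∈ A then 1 else -1) hE.toFinset
    (fun e _ => by by_cases h : e ∈ A <;> simp [h])
    (fun e he => hiso e (by
      rcases hE.mem_toFinset.1 he with h | h
      · exact hc0 e (hA h.1)
      · exact hd0 e h.1.1))
  have hin : ∀ z, ‖z‖ < r → windingNumber [circleCurve 0 r] z = 1 := fun z hz =>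
    windingNumber_circleCurve_of_mem (by simpa using hz)
  have hout : ∀ z, r < ‖z‖ → windingNumber [circleCurve 0 r] z = 0 := fun z hz =>
    windingNumber_circleCurve_of_notMem hr0.le (by simpa using hz)
  refine ⟨Γ, hΓ, fun z hz => ?_, fun z hz hzA => ?_⟩
  · rw [hw z (Or.inl (Or.inr (hA hz)))]
    rcases lt_or_gt_of_ne (hr' z (Or.inl (hA hz))) with h | h
    · simp [hin z h, hz, h.not_ge]
    · simp [hout z h, hz, h.le]
  · rw [hw z (Or.inr hz)]
    rcases lt_or_gt_of_ne (hr' z (Or.inr hz)) with h | h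
    · simp [hin z h, hz, hzA, h.le]
    · simp [hout z h, hzA, h.not_ge]

/-- Γ₁ prescribes winding number 1 about the poles that are only convergent, Γ₂ about all convergent
poles. -/
theorem exists_separates (hq0 : q ≠ 0) (hq1 : ‖q‖ < 1) (hv : ∀ i, v i ≠ 0) :
    ∃ Γ₁ Γ₂, Separates q (v 0) (v 1) (v 2) (v 3) Γ₁ Γ₂ := by
  obtain ⟨Γ₁, h₁, h₁A, h₁D⟩ := exists_contour hq0 hq1 hv Set.sdiff_subset
  obtain ⟨Γ₂, h₂, h₂A, h₂D⟩ := exists_contour hq0 hq1 hv subset_rfl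
  exact ⟨Γ₁, Γ₂, h₁, h₂, h₁A, fun w hw => h₁D w hw fun h => h.2 hw, h₂A,
    fun w hw => h₂D w hw.1 hw.2⟩

end

/-! ### The parameters -/

section Parameters

variable {q a b c d : ℂ} {N M : ℕ}

theorem zpow_mem_Omega_iff {q : ℂ} (hq0 : q ≠ 0) (hq1 : ‖q‖ < 1) {k : ℤ} :
    q ^ k ∈ Omega q ↔ k ≤ 0 := by
  constructor
  · rintro ⟨n, hn⟩
    have : q ^ (k + n) = 1 := by rw [zpow_add₀ hq0, hn, ← zpow_add₀ hq0]; simp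
    rw [zpow_eq_one_iff_of_norm_lt hq1] at this
    omega
  · intro hk
    exact ⟨k.natAbs, by congr 1; omega⟩

theorem mul_pow_notMem_Omega {x : ℂ} (hq0 : q ≠ 0) (hx : x ∉ Omega q) (n : ℕ) :
    x * q ^ n ∉ Omega q := by
  rintro ⟨k, hk⟩
  refine hx (mem_Omega_of_mul_pow (i := n + k) ?_)
  rw [pow_add, ← mul_assoc, hk, zpow_neg, zpow_natCast, inv_mul_cancel₀ (pow_ne_zero _ hq0)]

/-- The hypotheses on the parameters exclude all mixed products from `Ω(q)`, even from `q^{1-N}`. -/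
theorem mixed_products_notMem_Omega (hq0 : q ≠ 0) (hq1 : ‖q‖ < 1) (hMN : M + 2 ≤ N)
    (hab : a * b = q ^ (1 - (N : ℤ))) (ha : a ^ 2 = q ^ (-(M : ℤ)))
    (habcd : a * b * c * d ∉ Omega q)
    (hΛ : ∀ w ∈ ({a * c, a * d, b * c, b * d, c * d} : Set ℂ),
      w ∉ Omega q \ {q ^ (1 - (N : ℤ))}) :
    a * c ∉ Omega q ∧ a * d ∉ Omega q ∧ b * c ∉ Omega q ∧ b * d ∉ Omega q ∧ c * d ∉ Omega q := by
  have hab0 : a * b ≠ 0 := hab ▸ zpow_ne_zero _ hq0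
  have ha0 := left_ne_zero_of_mul hab0
  have hb0 := right_ne_zero_of_mul hab0
  have hΛ' : ∀ w ∈ ({a * c, a * d, b * c, b * d, c * d} : Set ℂ), w ∈ Omega q → w = a * b :=
    fun w hw hwΩ => by
      by_contra h
      exact hΛ w hw ⟨hwΩ, by rwa [Set.mem_singleton_iff, ← hab]⟩
  have hb2 : b ^ 2 = q ^ (2 - 2 * (N : ℤ) + M) := by
    have : a ^ 2 * b ^ 2 = q ^ (-(M : ℤ)) * q ^ (2 - 2 * (N : ℤ) + M) := by
      rw [← zpow_add₀ hq0, ← mul_pow, hab, ← zpow_natCast, ← zpow_mul]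
      congr 1
      push_cast
      ring
    rw [ha] at this
    exact mul_left_cancel₀ (zpow_ne_zero _ hq0) this
  have hbb : b * b ∈ Omega q ∧ b * b ≠ a * b := by
    rw [← sq, hb2, hab, zpow_mem_Omega_iff hq0 hq1]
    refine ⟨by omega, fun h => ?_⟩
    have := (zpow_inj_of_norm_lt hq0 hq1).1 h
    omega
  have haa : a * a ∈ Omega q ∧ a * a ≠ a * b := by
    rw [← sq, ha, hab, zpow_mem_Omega_iff hq0 hq1]
    refine ⟨by omega, fun h => ?_⟩
    have := (zpow_inj_of_norm_lt hq0 hq1).1 h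
    omega
  -- A product in Ω(q) must equal q^{1-N} = ab. For ac or ad this gives c = b or d = b, and then bc
  -- or bd is b² ∈ Ω(q), b² ≠ ab. For bc or bd the same happens with a². For cd it gives abcd =
  -- q^{2-2N} ∈ Ω(q).
  refine ⟨fun h => ?_, fun h => ?_, fun h => ?_, fun h => ?_, fun h => ?_⟩
  · obtain rfl := mul_left_cancel₀ ha0 (hΛ' _ (by simp) h)
    exact hbb.2 (hΛ' (c * c) (by simp) hbb.1)
  · obtain rfl := mul_left_cancel₀ ha0 (hΛ' _ (by simp) h)
    exact hbb.2 (hΛ' (d * d) (by simp) hbb.1)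
  · obtain rfl := mul_left_cancel₀ hb0 ((hΛ' _ (by simp) h).trans (mul_comm a b))
    exact haa.2 (hΛ' (c * c) (by simp) haa.1)
  · obtain rfl := mul_left_cancel₀ hb0 ((hΛ' _ (by simp) h).trans (mul_comm a b))
    exact haa.2 (hΛ' (d * d) (by simp) haa.1)
  · refine habcd ?_
    rw [mul_assoc, hΛ' _ (by simp) h, hab, ← zpow_add₀ hq0, zpow_mem_Omega_iff hq0 hq1]
    omega

/-- A zero of (aq/c;q)_j would mean c = aq^{i+1} with i + 1 < N, hence bc = q^{2-N+i} ∈ Ω(q);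
likewise for d. -/
theorem regularAt_of_sq_eq (hq0 : q ≠ 0) (hq1 : ‖q‖ < 1) (hc : c ≠ 0) (hd : d ≠ 0)
    (hMN : M + 2 ≤ N) (hab : a * b = q ^ (1 - (N : ℤ))) (ha : a ^ 2 = q ^ (-(M : ℤ)))
    (hbc : b * c ∉ Omega q) (hbd : b * d ∉ Omega q) : RegularAt q c d N a := by
  have key : ∀ u : ℂ, u ≠ 0 → b * u ∉ Omega q → ∀ i, i + 1 < N → a * u⁻¹ * q * q ^ i ≠ 1 := by
    intro u hu hbu i hi h
    refine hbu ?_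
    have : u = a * q ^ (i + 1) := by
      field_simp at h
      rw [← h]
      ring
    rw [this, show b * (a * q ^ (i + 1)) = a * b * q ^ (i + 1) by ring, hab, ← zpow_natCast,
      ← zpow_add₀ hq0, zpow_mem_Omega_iff hq0 hq1]
    push_cast
    omega
  refine ⟨left_ne_zero_of_mul (hab ▸ zpow_ne_zero _ hq0), fun i _ => ⟨fun h => ?_, fun hi' =>
    ⟨key c hc hbc i hi', key d hd hbd i hi'⟩⟩⟩
  rw [ha, ← zpow_natCast, ← zpow_natCast, ← zpow_add₀ hq0, ← zpow_add₀ hq0,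
    zpow_eq_one_iff_of_norm_lt hq1] at h
  omega

end Parameters

/-! ### The zeros of `p_N` -/

section Roots

variable {q a b c d : ℂ} {N M : ℕ}

theorem rootMultiplicity_node_eq_one (hq0 : q ≠ 0) (hq1 : ‖q‖ < 1) (ha0 : a ≠ 0)
    (hB : a * b * c * d ∉ Omega q) (hMN : M < N) (hab : a * b = q ^ (1 - (N : ℤ)))
    (ha : a ^ 2 = q ^ (-(M : ℤ))) {j : ℕ} (hj : (M < j ∧ j < N) ∨ 2 * j = M) :
    (awPoly q a b c d N).rootMultiplicity (node q j a) = 1 := by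
  rw [rootMultiplicity_awPoly hq0 hq1 ha0 hB hab, Finset.card_eq_one]
  refine ⟨j, ?_⟩
  ext i
  rw [Finset.mem_filter, Finset.mem_range, node_eq_node_iff hq0 hq1 ha, Finset.mem_singleton]
  omega

theorem rootMultiplicity_node_eq_two (hq0 : q ≠ 0) (hq1 : ‖q‖ < 1) (ha0 : a ≠ 0)
    (hB : a * b * c * d ∉ Omega q) (hMN : M < N) (hab : a * b = q ^ (1 - (N : ℤ)))
    (ha : a ^ 2 = q ^ (-(M : ℤ))) {j : ℕ} (hj : 2 * j < M) :
    (awPoly q a b c d N).rootMultiplicity (node q j a) = 2 := by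
  rw [rootMultiplicity_awPoly hq0 hq1 ha0 hB hab, Finset.card_eq_two]
  refine ⟨j, M - j, by omega, ?_⟩
  ext i
  rw [Finset.mem_filter, Finset.mem_range, node_eq_node_iff hq0 hq1 ha, Finset.mem_insert,
    Finset.mem_singleton]
  omega

theorem isRoot_awPoly_iff (hq0 : q ≠ 0) (hq1 : ‖q‖ < 1) (ha0 : a ≠ 0)
    (hB : a * b * c * d ∉ Omega q) (hab : a * b = q ^ (1 - (N : ℤ))) {x : ℂ} :
    (awPoly q a b c d N).IsRoot x ↔ ∃ j < N, x = node q j a := by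
  rw [← rootMultiplicity_pos (isMonicSeqOn_awPoly hq0 hq1 ha0 hB N trivial).1.ne_zero,
    rootMultiplicity_awPoly hq0 hq1 ha0 hB hab, Finset.card_pos]
  simp only [Finset.Nonempty, Finset.mem_filter, Finset.mem_range, eq_comm]

/-- `L₀` annihilates the multiples of `p_N`. -/
theorem limitFunctional_eq_zero_of_dvd (hq0 : q ≠ 0) (hq1 : ‖q‖ < 1) (ha0 : a ≠ 0)
    (hB : a * b * c * d ∉ Omega q) (hMN : M < N) (hab : a * b = q ^ (1 - (N : ℤ)))
    (ha : a ^ 2 = q ^ (-(M : ℤ))) {f : ℂ[X]} (hf : awPoly q a b c d N ∣ f) :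
    limitFunctional q a c d N M f = 0 := by
  obtain ⟨g, rfl⟩ := hf
  have h1 : ∀ j < N, (awPoly q a b c d N * g).eval (node q j a) = 0 := fun j hj => by
    rw [eval_mul, (isRoot_awPoly_iff hq0 hq1 ha0 hB hab).2 ⟨j, hj, rfl⟩, zero_mul]
  have h2 : ∀ j, 2 * j < M → (derivative (awPoly q a b c d N * g)).eval (node q j a) = 0 :=
    fun j hj => by
      have hm := rootMultiplicity_node_eq_two hq0 hq1 ha0 hB hMN hab ha hj
      have hd := pow_rootMultiplicity_dvd (awPoly q a b c d N) (node q j a)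
      rw [hm] at hd
      obtain ⟨r, hr⟩ := hd
      rw [hr]
      simp [derivative_mul, derivative_pow]
  rw [limitFunctional, Finset.sum_eq_zero, Finset.sum_eq_zero, add_zero, zero_add]
  · split_ifs
    · rw [h1 _ (by omega), mul_zero]
    · rfl
  · intro j hj
    rw [h1 j (Finset.mem_Ico.1 hj).2, mul_zero]
  · intro j hj
    have hj := Finset.mem_range.1 hj
    rw [h1 j (by omega), h2 j (by omega), mul_zero, mul_zero, add_zero]

end Roots

/-! ### The Sobolev form -/

/-- `(f, g) ↦ L₀(f g) + L(𝒟_q^N f · 𝒟_q^N g)` as a bilinear map. -/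
def sobolevBilin (s : ℂ) (N : ℕ) (L₀ L : ℂ[X] →ₗ[ℂ] ℂ) : ℂ[X] →ₗ[ℂ] ℂ[X] →ₗ[ℂ] ℂ :=
  (LinearMap.mul ℂ ℂ[X]).compr₂ L₀
    + ((LinearMap.mul ℂ ℂ[X]).compr₂ L).compl₁₂ (awDiffHom s ^ N) (awDiffHom s ^ N)

theorem sobolevBilin_apply (s : ℂ) (N : ℕ) (L₀ L : ℂ[X] →ₗ[ℂ] ℂ) (f g : ℂ[X]) :
    sobolevBilin s N L₀ L f g = L₀ (f * g) + L ((awDiff s)^[N] f * (awDiff s)^[N] g) := by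
  simp [sobolevBilin, awDiffHom_pow_apply]

theorem sobolevBilin_comm (s : ℂ) (N : ℕ) (L₀ L : ℂ[X] →ₗ[ℂ] ℂ) (f g : ℂ[X]) :
    sobolevBilin s N L₀ L f g = sobolevBilin s N L₀ L g f := by
  rw [sobolevBilin_apply, sobolevBilin_apply, mul_comm f, mul_comm ((awDiff s)^[N] f)]

end AskeyWilson

end

/-! ### Assembly of the Sobolev orthogonality -/

theorem mainTheorem4 (q s a b c d : ℂ) (N M : ℕ)
    (hq0 : q ≠ 0) (hq1 : ‖q‖ < 1) (hs : s ^ 2 = q)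
    (hc : c ≠ 0) (hd : d ≠ 0)
    (hMN : M + 2 ≤ N)
    (hab : a * b = q ^ (1 - (N : ℤ)))
    (ha : a ^ 2 = q ^ (-(M : ℤ)))
    (habcd : a * b * c * d ∉ AskeyWilson.Omega q)
    (hΛ : ∀ w ∈ ({a * c, a * d, b * c, b * d, c * d} : Set ℂ),
      w ∉ AskeyWilson.Omega q \ {q ^ (1 - (N : ℤ))}) :
    -- `L₀` is the limit of `L₀^α / (α - a)` as `α → a`
    (∀ p : ℂ[X], Tendsto (fun α => AskeyWilson.racahFunctional q c d N M α p / (α - a))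
      (𝓝[≠] a) (𝓝 (AskeyWilson.limitFunctional q a c d N M p))) ∧
    -- the polynomials of degree at most `N` are orthogonal and determined by `L₀`
    AskeyWilson.IsMonicSeqOn (AskeyWilson.awPoly q a b c d) Set.univ ∧
    (∀ n m : ℕ, m < n → n ≤ N → AskeyWilson.limitFunctional q a c d N M
      (AskeyWilson.awPoly q a b c d n * AskeyWilson.awPoly q a b c d m) = 0) ∧
    (∀ P : ℕ → ℂ[X], AskeyWilson.IsMonicSeqOn P (Set.Iic N) →
      (∀ n m : ℕ, m < n → n ≤ N →
        AskeyWilson.limitFunctional q a c d N M (P n * P m) = 0) →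
      ∀ n ≤ N, P n = AskeyWilson.awPoly q a b c d n) ∧
    -- the roots of `p_N`
    (∀ j : ℕ, (M < j ∧ j < N) ∨ 2 * j = M →
      (AskeyWilson.awPoly q a b c d N).rootMultiplicity (AskeyWilson.node q j a) = 1) ∧
    (∀ j : ℕ, 2 * j < M →
      (AskeyWilson.awPoly q a b c d N).rootMultiplicity (AskeyWilson.node q j a) = 2) ∧
    (∀ x : ℂ, (AskeyWilson.awPoly q a b c d N).IsRoot x →
      ∃ j < N, x = AskeyWilson.node q j a) ∧
    -- the Sobolev orthogonality, which determines the whole sequence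
    (∃ Γ₁ Γ₂ : List (ℝ → ℂ),
      AskeyWilson.Separates q (a * s ^ N) (b * s ^ N) (c * s ^ N) (d * s ^ N) Γ₁ Γ₂) ∧
    (∀ Γ₁ Γ₂ : List (ℝ → ℂ),
      AskeyWilson.Separates q (a * s ^ N) (b * s ^ N) (c * s ^ N) (d * s ^ N) Γ₁ Γ₂ →
      (∀ n m : ℕ, n ≠ m → AskeyWilson.sobolevForm q s a b c d N M Γ₁ Γ₂
        (AskeyWilson.awPoly q a b c d n) (AskeyWilson.awPoly q a b c d m) = 0) ∧
      (∀ n : ℕ, AskeyWilson.sobolevForm q s a b c d N M Γ₁ Γ₂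
        (AskeyWilson.awPoly q a b c d n) (AskeyWilson.awPoly q a b c d n) ≠ 0) ∧
      (∀ P : ℕ → ℂ[X], AskeyWilson.IsMonicSeqOn P Set.univ →
        (∀ n m : ℕ, n ≠ m → AskeyWilson.sobolevForm q s a b c d N M Γ₁ Γ₂ (P n) (P m) = 0) →
        P = AskeyWilson.awPoly q a b c d)) := by
  have hB := habcd
  obtain ⟨hac, had, hbc, hbd, hcd⟩ :=
    AskeyWilson.mixed_products_notMem_Omega hq0 hq1 hMN hab ha habcd hΛ
  have ha0 : a ≠ 0 := left_ne_zero_of_mul (hab ▸ zpow_ne_zero _ hq0)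
  have hb0 : b ≠ 0 := right_ne_zero_of_mul (hab ▸ zpow_ne_zero _ hq0)
  have hs0 : s ≠ 0 := fun h => hq0 (by rw [← hs, h, zero_pow two_ne_zero])
  have hMN' : M < N := by omega
  have hreg := AskeyWilson.regularAt_of_sq_eq hq0 hq1 hc hd hMN hab ha hbc hbd
  have hL₀ := AskeyWilson.isAWFunctional_limitHom hq0 hq1 hc hd hMN ha hreg hac had hab
  have hL₀1 := AskeyWilson.limitHom_one_ne_zero hq0 hq1 hc hd hMN ha hreg hac had hab hB
  have hmonic := AskeyWilson.isMonicSeqOn_awPoly hq0 hq1 ha0 hB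
  have habi : ∀ n ≤ N - 1, ∀ i < n, a * b * q ^ i ≠ 1 := fun n hn i hi h => by
    rw [hab, ← zpow_natCast, ← zpow_add₀ hq0, AskeyWilson.zpow_eq_one_iff_of_norm_lt hq1] at h
    omega
  have horth₀ : ∀ n m : ℕ, m < n → AskeyWilson.limitHom q a c d N M
      (AskeyWilson.awPoly q a b c d n * AskeyWilson.awPoly q a b c d m) = 0 := fun n m hmn =>
    hL₀.orthogonal hq0 hq1 ha0 hb0 hB hmn
  have hnorm₀ : ∀ n < N, AskeyWilson.limitHom q a c d N M
      (AskeyWilson.awPoly q a b c d n * AskeyWilson.awPoly q a b c d n) ≠ 0 := fun n hn =>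
    hL₀.norm_ne_zero hq0 hq1 ha0 hb0 hc hd hB hac had hbc hbd hcd (habi n (by omega)) hL₀1
  set v : Fin 4 → ℂ := ![a * s ^ N, b * s ^ N, c * s ^ N, d * s ^ N] with hv_def
  have hsN : s ^ N * s ^ N = q ^ N := by rw [← mul_pow, ← sq, hs]
  have hsN0 := pow_ne_zero N hs0
  have hv : ∀ i, v i ≠ 0 := by
    intro i
    fin_cases i
    exacts [mul_ne_zero ha0 hsN0, mul_ne_zero hb0 hsN0, mul_ne_zero hc hsN0, mul_ne_zero hd hsN0]
  have hprod : ∀ i j, i < j → v i * v j ∉ AskeyWilson.Omega q := by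
    have hmul : ∀ x y : ℂ, x * y ∉ AskeyWilson.Omega q →
        x * s ^ N * (y * s ^ N) ∉ AskeyWilson.Omega q := fun x y h => by
      rw [mul_mul_mul_comm, hsN]
      exact AskeyWilson.mul_pow_notMem_Omega hq0 h N
    -- This product is q^{1-N}q^N = q, outside Ω(q): after N differences the degeneracy of ab
    -- disappears.
    have hab' : a * s ^ N * (b * s ^ N) ∉ AskeyWilson.Omega q := by
      rw [mul_mul_mul_comm, hsN, hab, ← zpow_natCast, ← zpow_add₀ hq0,
        AskeyWilson.zpow_mem_Omega_iff hq0 hq1]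
      omega
    intro i j hij
    fin_cases i <;> fin_cases j <;> first | exact absurd hij (by decide) | skip
    exacts [hab', hmul _ _ hac, hmul _ _ had, hmul _ _ hbc, hmul _ _ hbd, hmul _ _ hcd]
  have hprod' : ∀ i j, i ≠ j → v i * v j ∉ AskeyWilson.Omega q := fun i j hij => by
    rcases lt_or_gt_of_ne hij with h | h
    · exact hprod i j h
    · rw [mul_comm]
      exact hprod j i h
  have hvB : v 0 * v 1 * v 2 * v 3 ∉ AskeyWilson.Omega q := by
    have : v 0 * v 1 * v 2 * v 3 = a * b * c * d * q ^ (N + N) := by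
      rw [pow_add, ← hsN]
      simp only [hv_def, Matrix.cons_val]
      ring
    rw [this]
    exact AskeyWilson.mul_pow_notMem_Omega hq0 hB _
  refine ⟨fun p => AskeyWilson.tendsto_racahFunctional_div hq0 hq1 hc hd hMN ha hreg hac had p,
    hmonic, fun n m hmn _ => horth₀ n m hmn, fun P hP hPo => ?_,
    fun j hj => AskeyWilson.rootMultiplicity_node_eq_one hq0 hq1 ha0 hB hMN' hab ha hj,
    fun j hj => AskeyWilson.rootMultiplicity_node_eq_two hq0 hq1 ha0 hB hMN' hab ha hj,
    fun x hx => (AskeyWilson.isRoot_awPoly_iff hq0 hq1 ha0 hB hab).1 hx,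
    AskeyWilson.exists_separates hq0 hq1 hv, fun Γ₁ Γ₂ hΓ => ?_⟩
  · exact AskeyWilson.monic_orthogonal_unique
      ((LinearMap.mul ℂ ℂ[X]).compr₂ (AskeyWilson.limitHom q a c d N M))
      (AskeyWilson.awPoly q a b c d) P N (fun n _ => hmonic n trivial) (fun n hn => hP n hn)
      (fun n m hmn _ => horth₀ n m hmn) hnorm₀ hPo
      fun f g => congrArg (AskeyWilson.limitHom q a c d N M) (mul_comm f g)
  have hΓ' : AskeyWilson.Separates q (v 0) (v 1) (v 2) (v 3) Γ₁ Γ₂ := hΓ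
  set L := AskeyWilson.contourHom hq0 hq1 hs hv hΓ' with hL_def
  have hL := AskeyWilson.isAWFunctional_contourHom hq0 hq1 hs hv hΓ' hprod'
  have hL1 := AskeyWilson.contourHom_one_ne_zero hq0 hq1 hs hv hΓ' hprod' hvB
  set B := AskeyWilson.sobolevBilin s N (AskeyWilson.limitHom q a c d N M) L with hB_def
  have hform : ∀ f g, AskeyWilson.sobolevForm q s a b c d N M Γ₁ Γ₂ f g = B f g := fun f g =>
    (AskeyWilson.sobolevBilin_apply s N (AskeyWilson.limitHom q a c d N M) L f g).symm
  have hderiv : ∀ n < N, (AskeyWilson.awDiff s)^[N] (AskeyWilson.awPoly q a b c d n) = 0 :=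
    fun n hn => AskeyWilson.iterate_awDiff_awPoly_of_lt hs0 hs hq1 hn ha0 hB
  have hderiv' : ∀ n, ∃ κ : ℂ, κ ≠ 0 ∧
      (AskeyWilson.awDiff s)^[N] (AskeyWilson.awPoly q a b c d (n + N))
        = C κ * AskeyWilson.awPoly q (v 0) (v 1) (v 2) (v 3) n := fun n =>
    AskeyWilson.iterate_awDiff_awPoly hs0 hs hq1 N ha0 hB n
  have hLmul : ∀ (κ κ' : ℂ) (f g : ℂ[X]), L (C κ * f * (C κ' * g)) = κ * κ' * L (f * g) :=
    fun κ κ' f g => by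
      rw [mul_mul_mul_comm, ← C_mul, ← smul_eq_C_mul, map_smul, smul_eq_mul]
  have horth : ∀ n m : ℕ, m < n →
      B (AskeyWilson.awPoly q a b c d n) (AskeyWilson.awPoly q a b c d m) = 0 := by
    intro n m hmn
    rw [hB_def, AskeyWilson.sobolevBilin_apply, horth₀ n m hmn, zero_add]
    rcases lt_or_ge m N with hm | hm
    · rw [hderiv m hm, mul_zero, map_zero]
    · obtain ⟨m, rfl⟩ := Nat.exists_eq_add_of_le' hm
      obtain ⟨n, rfl⟩ := Nat.exists_eq_add_of_le' (hm.trans hmn.le)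
      obtain ⟨κ, -, hκ⟩ := hderiv' n
      obtain ⟨κ', -, hκ'⟩ := hderiv' m
      rw [hκ, hκ', hLmul, hL.orthogonal hq0 hq1 (hv 0) (hv 1) hvB (by omega), mul_zero]
  have hnorm : ∀ n : ℕ,
      B (AskeyWilson.awPoly q a b c d n) (AskeyWilson.awPoly q a b c d n) ≠ 0 := by
    intro n
    rw [hB_def, AskeyWilson.sobolevBilin_apply]
    rcases lt_or_ge n N with hn | hn
    · rw [hderiv n hn, mul_zero, map_zero, add_zero]
      exact hnorm₀ n hn
    -- From degree N on, p_n² is a multiple of p_N, so L₀ contributes nothing and the norm is that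
    -- of the shifted polynomial under L_N.
    · have hdvd : AskeyWilson.awPoly q a b c d N ∣ AskeyWilson.awPoly q a b c d n := by
        obtain ⟨κ, hκ0, hκ⟩ := AskeyWilson.awPoly_eq_C_mul_awBasis hq0 hq1 ha0 hB hab
        rw [hκ]
        exact (isUnit_C.2 hκ0.isUnit).mul_left_dvd.2
          (AskeyWilson.awBasis_dvd_awPoly c d hq0 hab hn)
      have hzero : AskeyWilson.limitHom q a c d N M
          (AskeyWilson.awPoly q a b c d n * AskeyWilson.awPoly q a b c d n) = 0 :=
        AskeyWilson.limitFunctional_eq_zero_of_dvd hq0 hq1 ha0 hB hMN' hab ha (hdvd.mul_right _)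
      obtain ⟨n, rfl⟩ := Nat.exists_eq_add_of_le' hn
      obtain ⟨κ, hκ0, hκ⟩ := hderiv' n
      rw [hzero, zero_add, hκ, hLmul]
      refine mul_ne_zero (mul_ne_zero hκ0 hκ0) (hL.norm_ne_zero hq0 hq1 (hv 0) (hv 1) (hv 2) (hv 3)
        hvB (hprod 0 2 (by decide)) (hprod 0 3 (by decide)) (hprod 1 2 (by decide))
        (hprod 1 3 (by decide)) (hprod 2 3 (by decide)) (fun i _ h => ?_) hL1)
      exact hprod 0 1 (by decide) (AskeyWilson.mem_Omega_of_mul_pow h)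
  simp only [hform]
  refine ⟨fun n m hnm => ?_, hnorm, fun P hP hPo => ?_⟩
  · rcases lt_or_gt_of_ne hnm with h | h
    · rw [hB_def, AskeyWilson.sobolevBilin_comm]
      exact horth m n h
    · exact horth n m h
  · funext n
    exact AskeyWilson.monic_orthogonal_unique B (AskeyWilson.awPoly q a b c d) P n
      (fun k _ => hmonic k trivial) (fun k _ => hP k trivial) (fun k m hmk _ => horth k m hmk)
      (fun k _ => hnorm k) (fun k m hmk _ => hPo k m hmk.ne')
      (AskeyWilson.sobolevBilin_comm s N _ L) n le_rfl
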